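/- Let $\mathfrak g$ be a compact simple real Lie algebra (its Killing form $B$ is negative definite), $\mathfrak t\subset\mathfrak g$ a maximal torus, $\Delta$ the root system of $(\mathfrak g_{\mathbb C},\mathfrak t_{\mathbb C})$, and $\alpha_1,\dots,\alpha_n$ simple roots numbered as in Bourbaki, except that $\alpha_1$ is short and $\alpha_2$ long for $\mathfrak g_2$. The type of $\mathfrak g_{\mathbb C}$ is $\mathfrak a_n$ $(n\ge1)$, $\mathfrak b_n$ $(n\geq 3)$, $\mathfrak c_n$ $(n\geq 2)$, $\mathfrak d_n$ $(n\geq 4)$, $\mathfrak e_6,\mathfrak e_7,\mathfrak e_8,\mathfrak f_4$ or $\mathfrak g_2$. Write $\alpha=\sum_k n_k(\alpha)\alpha_k$ for $\alpha\in\Delta$, let $\mu=\sum_k m_k\alpha_k$ be the highest root, let $H_k\in\mathfrak t_{\mathbb C}$ be given by $\alpha_p(H_k)=\delta_{kp}/m_k$, and put $\kappa=\langle\mu,\mu\rangle=B(H_\mu,H_\mu)$, where $H_\mu\in\mathfrak t_{\mathbb C}$ represents $\mu$ through $B$. Let $\sigma$ be an automorphism of $\mathfrak g$ of order $3$ of the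 form * **Type $A_3II$:** $\sigma=\mathrm{Ad}_{\exp 2\pi\sqrt{-1}H}$, $H=\tfrac13(H_i+H_j)$, $i<j$, $m_i=m_j=1$; or * **Type $A_3III$:** $\sigma=\mathrm{Ad}_{\exp 2\pi\sqrt{-1}H}$, $H=\tfrac23H_i$, $m_i=2$. Let $M=G/K$ be the corresponding compact irreducible $3$-symmetric space, with $\mathfrak k=\mathfrak g^\sigma$, $T_oM=\mathfrak m=\ker(1+\sigma+\sigma^2)$, metric induced by $\langle\cdot,\cdot\rangle=-\frac12B|_{\mathfrak m}$ and $J=\frac1{\sqrt3}(2\sigma+1)|_{\mathfrak m}$. Let $r=\mathrm{Ric}-\mathrm{Ric}^*$, where $\mathrm{Ric}(X,Y)=\sum_a\langle R_{X\,e_a}Y,e_a\rangle$ and $\mathrm{Ric}^*(X,Y)=\sum_a\langle R_{X\,e_a}JY,Je_a\rangle$ for an orthonormal basis $(e_a)$, with $R_{X\,Y}=\nabla_{[X,Y]}-[\nabla_X,\nabla_Y]$. For a set $\Sigma$ of roots let $\mathfrak p(\Sigma)$ be the span of the real planes $\mathfrak g\cap(\mathfrak g_\alpha\oplus\mathfrak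 g_{-\alpha})$ over the positive roots $\alpha\in\Sigma$. **(II)** In Type $A_3II$, $\mathfrak k=\mathfrak t\oplus\mathfrak p(n_i=n_j=0)$ and $\mathfrak m=\mathcal V_1\oplus\mathcal V_2\oplus\mathcal V_3$, where $\mathcal V_1=\mathfrak p(n_i=n_j=1)$, $\mathcal V_2=\mathfrak p(n_i=1,n_j=0)$, $\mathcal V_3=\mathfrak p(n_i=0,n_j=1)$. These are $\mathrm{ad}(\mathfrak k)$-invariant, and $r$ is multiplication by $l,k,m$ on $\mathcal V_1,\mathcal V_2,\mathcal V_3$ respectively, as follows; no other cases occur. | $G/K$ (up to coverings) | type; $(i,j)$ | $(l,k,m)$ | $\dim\mathcal V_1$ | $\dim\mathcal V_2$ | $\dim\mathcal V_3$ | |---|---|---|---|---|---| | $SU(n)/S(U(r_1)\times U(r_2)\times U(r_3))$, $n=r_1+r_2+r_3$, $r_a\ge1$ | $\mathfrak a_{n-1}$; $(r_1,r_1+r_2)$ | $(2r_2\kappa,2r_3\kappa,2r_1\kappa)$ | $2r_1r_3$ | $2r_1r_2$ | $2r_2r_3$ | | $SO(2n)/(U(n-1)\times SO(2))$, $n\ge4$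 | $\mathfrak d_n$; $(n-1,n)$ | $(4\kappa,2(n-2)\kappa,2(n-2)\kappa)$ | $(n-1)(n-2)$ | $2(n-1)$ | $2(n-1)$ | | the same space, relabelled | $\mathfrak d_n$; $(1,n-1)$ or $(1,n)$ | $(2(n-2)\kappa,2(n-2)\kappa,4\kappa)$ | $2(n-1)$ | $2(n-1)$ | $(n-1)(n-2)$ | | $E_6/(SO(8)\times SO(2)\times SO(2))$ | $\mathfrak e_6$; $(1,6)$ | $(8\kappa,8\kappa,8\kappa)$ | $16$ | $16$ | $16$ | **(III)** In Type $A_3III$, $\mathfrak k=\mathfrak t\oplus\mathfrak p(n_i=0)$ and $\mathfrak m=\mathcal V\oplus\mathcal H$, where $\mathcal V=\mathfrak p(n_i=2)$ and $\mathcal H=\mathfrak p(n_i=1)$. These are $\mathrm{ad}(\mathfrak k)$-invariant, and $r$ is multiplication by $l$ on $\mathcal V$ and by $k$ on $\mathcal H$, as follows; no other cases occur. | $G/K$ (up to coverings) | type; $i$ | $(l,k)$ | $\dim\mathcal V$ | $\dim\mathcal H$ | |---|---|---|---|---| | $SO(2n+1)/(U(i)\times SO(2(n-i)+1))$, $n\ge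 3$, $2\le i\le n$ | $\mathfrak b_n$; $i$ | $(2(2(n-i)+1)\kappa,2(i-1)\kappa)$ | $i(i-1)$ | $2i(2(n-i)+1)$ | | $Sp(n)/(U(i)\times Sp(n-i))$, $n\ge2$, $1\le i<n$ | $\mathfrak c_n$; $i$ | $(2(n-i)\kappa,(i+1)\kappa)$ | $i(i+1)$ | $4i(n-i)$ | | $SO(2n)/(U(i)\times SO(2(n-i)))$, $n\ge4$, $2\le i\le n-2$ | $\mathfrak d_n$; $i$ | $(4(n-i)\kappa,2(i-1)\kappa)$ | $i(i-1)$ | $4i(n-i)$ | | $G_2/U(2)$ | $\mathfrak g_2$; $2$ | $(4\kappa,2\kappa)$ | $2$ | $8$ | | $F_4/(Spin(7)\times T^1)$ | $\mathfrak f_4$; $4$ | $(4\kappa,7\kappa)$ | $14$ | $16$ | | $F_4/(Sp(3)\times T^1)$ | $\mathfrak f_4$; $1$ | $(14\kappa,2\kappa)$ | $2$ | $28$ | | $E_6/(S(U(5)\times U(1))\times SU(2))$ | $\mathfrak e_6$; $3$ or $5$ | $(12\kappa,6\kappa)$ | $10$ | $40$ | | $E_6/(SU(6)\times T^1)$ |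 $\mathfrak e_6$; $2$ | $(20\kappa,2\kappa)$ | $2$ | $40$ | | $E_7/(SU(2)\times SO(10)\times SO(2))$ | $\mathfrak e_7$; $6$ | $(16\kappa,10\kappa)$ | $20$ | $64$ | | $E_7/(SO(12)\times SO(2))$ | $\mathfrak e_7$; $1$ | $(32\kappa,2\kappa)$ | $2$ | $64$ | | $E_7/S(U(7)\times U(1))$ | $\mathfrak e_7$; $2$ | $(20\kappa,8\kappa)$ | $14$ | $70$ | | $E_8/(SO(14)\times SO(2))$ | $\mathfrak e_8$; $1$ | $(32\kappa,14\kappa)$ | $28$ | $128$ | | $E_8/(E_7\times T^1)$ | $\mathfrak e_8$; $8$ | $(56\kappa,2\kappa)$ | $2$ | $112$ | -/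

import Mathlib

open scoped TensorProduct Matrix

noncomputable section

namespace ThreeSymmetric

/-! ## Compact simple Lie algebras -/

/-- A compact simple real Lie algebra: simple, with negative definite Killing form. -/
class IsCompactSimple (g : Type*) [LieRing g] [LieAlgebra ℝ g] : Prop where
  simple : LieAlgebra.IsSimple ℝ g
  killing_neg : ∀ x : g, x ≠ 0 → killingForm ℝ g x x < 0

section Complexification

variable (g : Type*) [LieRing g] [LieAlgebra ℝ g] [Module.Finite ℝ g]

theorem killingForm_nondegenerate_baseChange [IsCompactSimple g] :
    (killingForm ℂ (ℂ ⊗[ℝ] g)).Nondegenerate := by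
  have h : (killingForm ℝ g).Nondegenerate :=
    (LieModule.traceForm_isSymm ℝ g g).isRefl.nondegenerate_iff_separatingLeft.mpr <| by
      intro x hx
      by_contra hne
      exact absurd (hx x) (IsCompactSimple.killing_neg x hne).ne
  let b := Module.finBasis ℝ g
  rw [← LinearMap.BilinForm.nondegenerate_toMatrix_iff b,
    Matrix.nondegenerate_iff_det_ne_zero] at h
  rw [← LinearMap.BilinForm.nondegenerate_toMatrix_iff (b.baseChange ℂ),
    Matrix.nondegenerate_iff_det_ne_zero]
  have key : LinearMap.BilinForm.toMatrix (b.baseChange ℂ) (killingForm ℂ (ℂ ⊗[ℝ] g)) =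
      (LinearMap.BilinForm.toMatrix b (killingForm ℝ g)).map (algebraMap ℝ ℂ) := by
    have e : killingForm ℂ (ℂ ⊗[ℝ] g) = (killingForm ℝ g).baseChange ℂ :=
      LieModule.traceForm_baseChange (R := ℝ) (L := g) (M := g) ℂ
    ext i j
    simp [e, LinearMap.BilinForm.toMatrix_apply]
  rw [key, ← RingHom.mapMatrix_apply, ← RingHom.map_det]
  simpa using h

/-- The complexification of a compact simple Lie algebra has nondegenerate Killing form. -/
instance instIsKillingComplexification [IsCompactSimple g] :
    LieAlgebra.IsKilling ℂ (ℂ ⊗[ℝ] g) where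
  killingCompl_top_eq_bot := by
    have h := (killingForm_nondegenerate_baseChange g).ker_eq_bot
    rw [← LieIdeal.coe_killingCompl_top] at h
    exact (LieSubmodule.toSubmodule_eq_bot _).mp h

end Complexification

/-! ## Geometry of an infinitesimal `3`-symmetric space -/

/-- An infinitesimal `3`-symmetric space on `g`: an automorphism `σ` of order `3`.  It describes
the coset space `M = G / K`, with `G` the connected centreless Lie group with Lie algebra `g` and
`K` the connected subgroup with Lie algebra `𝔨 = g^σ`. -/
structure Triple (g : Type*) [LieRing g] [LieAlgebra ℝ g] where
  σ : g ≃ₗ⁅ℝ⁆ g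
  order_three : ∀ x, σ (σ (σ x)) = x
  ne_refl : ∃ x, σ x ≠ x

namespace Triple

variable {g : Type*} [LieRing g] [LieAlgebra ℝ g] (S : Triple g)

/-- `σ` as a linear map. -/
def σl : g →ₗ[ℝ] g := (S.σ : g →ₗ⁅ℝ⁆ g)

@[simp] theorem σl_apply (x : g) : S.σl x = S.σ x := rfl

/-- The isotropy algebra `𝔨 = g^σ`. -/
def isotropy : Submodule ℝ g := LinearMap.ker (S.σl - LinearMap.id)

/-- The complement `𝔪 = ker (1 + σ + σ²)`, identified with the tangent space of `M` at the
origin. -/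
def tangent : Submodule ℝ g := LinearMap.ker (LinearMap.id + S.σl + S.σl ∘ₗ S.σl)

theorem mem_tangent {x : g} : x ∈ S.tangent ↔ x + S.σ x + S.σ (S.σ x) = 0 := Iff.rfl

/-- The projection of `g = 𝔨 ⊕ 𝔪` onto `𝔨`. -/
def projK : g →ₗ[ℝ] g := (3⁻¹ : ℝ) • (LinearMap.id + S.σl + S.σl ∘ₗ S.σl)

theorem projK_apply (x : g) : S.projK x = (3⁻¹ : ℝ) • (x + S.σ x + S.σ (S.σ x)) := rfl

/-- The projection of `g = 𝔨 ⊕ 𝔪` onto `𝔪`. -/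
def projM : g →ₗ[ℝ] S.tangent :=
  LinearMap.codRestrict S.tangent (LinearMap.id - S.projK) <| by
    intro x
    rw [mem_tangent]
    simp only [LinearMap.sub_apply, LinearMap.id_apply, projK_apply, map_sub, map_smul, map_add,
      S.order_three]
    module

/-- The bilinear map `(X, Y) ↦ [X, Y]_𝔪` on `𝔪`. -/
def bracketM : S.tangent →ₗ[ℝ] S.tangent →ₗ[ℝ] S.tangent :=
  LinearMap.mk₂ ℝ (fun X Y => S.projM ⁅(X : g), (Y : g)⁆)
    (by simp) (by simp) (by simp) (by simp)

/-- The bilinear map `(X, Y) ↦ [X, Y]_𝔨` on `𝔪`. -/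
def bracketK : S.tangent →ₗ[ℝ] S.tangent →ₗ[ℝ] g :=
  LinearMap.mk₂ ℝ (fun X Y => S.projK ⁅(X : g), (Y : g)⁆)
    (by simp) (by simp) (by simp) (by simp)

/-- The action of `A ∈ 𝔨` on `𝔪` by `ad A` (the projection to `𝔪` has no effect for such `A`). -/
def adM : g →ₗ[ℝ] S.tangent →ₗ[ℝ] S.tangent :=
  LinearMap.mk₂ ℝ (fun A Z => S.projM ⁅A, (Z : g)⁆)
    (by simp) (by simp) (by simp) (by simp)

/-- The canonical almost complex structure `J = (2σ + 1) / √3` on `𝔪`. -/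
def J : S.tangent →ₗ[ℝ] S.tangent :=
  LinearMap.restrict ((√3)⁻¹ • ((2 : ℝ) • S.σl + LinearMap.id)) <| by
    intro x hx
    rw [mem_tangent] at hx ⊢
    have h2 : S.σ x + S.σ (S.σ x) + S.σ (S.σ (S.σ x)) = 0 := by
      rw [← map_add, ← map_add, hx, map_zero]
    have e : (√3)⁻¹ • ((2 : ℝ) • (S.σ x + S.σ (S.σ x) + S.σ (S.σ (S.σ x)))
        + (x + S.σ x + S.σ (S.σ x))) = (0 : g) := by rw [h2, hx]; simp
    rw [← e]
    simp only [LinearMap.smul_apply, LinearMap.add_apply, σl_apply, LinearMap.id_apply, map_smul,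
      map_add]
    module

/-- The inner product `⟨·,·⟩ = -½ B` on `𝔪`, where `B` is the Killing form of `g`; it induces the
invariant nearly Kähler metric of `M`. -/
def inner : LinearMap.BilinForm ℝ S.tangent :=
  (-(1 / 2) : ℝ) • (killingForm ℝ g).restrict S.tangent

theorem inner_apply (X Y : S.tangent) :
    S.inner X Y = -(1 / 2) * killingForm ℝ g (X : g) (Y : g) := rfl

section Metric

variable [IsCompactSimple g]

theorem inner_pos (X : S.tangent) (hX : X ≠ 0) : 0 < S.inner X X := by
  have h : killingForm ℝ g (X : g) (X : g) < 0 :=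
    IsCompactSimple.killing_neg (X : g) (by simpa using hX)
  rw [inner_apply]
  linarith

theorem inner_nondegenerate : S.inner.Nondegenerate := by
  have hs : S.inner.IsSymm := ⟨fun X Y => by
    simp only [inner_apply, LieModule.traceForm_comm ℝ g g (X : g)]⟩
  refine hs.isRefl.nondegenerate_iff_separatingLeft.mpr fun X hX => ?_
  by_contra hne
  exact absurd (hX X) (S.inner_pos X hne).ne'

variable [Module.Finite ℝ g]

/-- The tangent vector representing a linear functional through the inner product. -/
def sharp : Module.Dual ℝ S.tangent ≃ₗ[ℝ] S.tangent :=
  (LinearMap.BilinForm.toDual S.inner S.inner_nondegenerate).symm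

theorem inner_sharp (φ : Module.Dual ℝ S.tangent) (Z : S.tangent) :
    S.inner (S.sharp φ) Z = φ Z := by
  rw [← LinearMap.BilinForm.toDual_def S.inner_nondegenerate, sharp, LinearEquiv.apply_symm_apply]

/-- The Levi-Civita connection of the invariant metric at the origin, `nabla X Y = ∇_X Y^*`, where
`Y^*` is the local invariant field extending `Y`; it is given by the Koszul formula (see `koszul`). -/
def nabla : S.tangent →ₗ[ℝ] S.tangent →ₗ[ℝ] S.tangent :=
  LinearMap.mk₂ ℝ
    (fun X Y => S.sharp ((2⁻¹ : ℝ) •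
      (S.inner (S.bracketM X Y) - S.inner X ∘ₗ S.bracketM Y - S.inner Y ∘ₗ S.bracketM X)))
    (fun X X' Y => by
      rw [← map_add]; congr 1; ext Z; simp; ring)
    (fun c X Y => by
      rw [← map_smul]; congr 1; ext Z; simp; ring)
    (fun X Y Y' => by
      rw [← map_add]; congr 1; ext Z; simp; ring)
    (fun c X Y => by
      rw [← map_smul]; congr 1; ext Z; simp; ring)

theorem koszul (X Y Z : S.tangent) :
    2 * S.inner (S.nabla X Y) Z =
      S.inner (S.bracketM X Y) Z - S.inner X (S.bracketM Y Z) - S.inner Y (S.bracketM X Z) := by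
  rw [nabla, LinearMap.mk₂_apply, inner_sharp]
  simp

/-- The Riemannian curvature tensor at the origin, `curvature X Y Z = R_{X Y} Z`, with the sign
convention `R_{X Y} = ∇_{[X, Y]} - [∇_X, ∇_Y]`. -/
def curvature : S.tangent →ₗ[ℝ] S.tangent →ₗ[ℝ] S.tangent →ₗ[ℝ] S.tangent :=
  LinearMap.mk₂ ℝ
    (fun X Y => S.nabla (S.bracketM X Y) + S.adM (S.bracketK X Y)
      - (S.nabla X ∘ₗ S.nabla Y - S.nabla Y ∘ₗ S.nabla X))
    (fun X X' Y => by ext Z; simp; abel)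
    (fun c X Y => by ext Z; simp [smul_sub, smul_add])
    (fun X Y Y' => by ext Z; simp; abel)
    (fun c X Y => by ext Z; simp [smul_sub, smul_add])

theorem curvature_apply (X Y Z : S.tangent) :
    S.curvature X Y Z = S.nabla (S.bracketM X Y) Z + S.adM (S.bracketK X Y) Z
      - (S.nabla X (S.nabla Y Z) - S.nabla Y (S.nabla X Z)) := rfl

/-- The Ricci form `Ric(X, Y) = ∑ᵢ ⟨R_{X eᵢ} Y, eᵢ⟩`, the trace of `Z ↦ R_{X Z} Y`. -/
def ricci : LinearMap.BilinForm ℝ S.tangent :=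
  LinearMap.mk₂ ℝ (fun X Y => LinearMap.trace ℝ S.tangent ((S.curvature X).flip Y))
    (fun X X' Y => by rw [← map_add]; congr 1; ext Z; simp)
    (fun c X Y => by rw [← map_smul]; congr 1; ext Z; simp)
    (fun X Y Y' => by rw [← map_add]; congr 1; ext Z; simp)
    (fun c X Y => by rw [← map_smul]; congr 1; ext Z; simp)

/-- The `*`-Ricci form `Ric*(X, Y) = ∑ᵢ ⟨R_{X eᵢ} JY, J eᵢ⟩`, which is minus the trace of
`Z ↦ J (R_{X Z} JY)`, since `J` is skew-symmetric. -/
def ricciStar : LinearMap.BilinForm ℝ S.tangent :=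
  LinearMap.mk₂ ℝ
    (fun X Y => - LinearMap.trace ℝ S.tangent (S.J ∘ₗ (S.curvature X).flip (S.J Y)))
    (fun X X' Y => by rw [← neg_add, ← map_add]; congr 2; ext Z; simp)
    (fun c X Y => by rw [smul_neg, ← map_smul]; congr 2; ext Z; simp)
    (fun X Y Y' => by rw [← neg_add, ← map_add]; congr 2; ext Z; simp)
    (fun c X Y => by rw [smul_neg, ← map_smul]; congr 2; ext Z; simp)

/-- The operator `r = Ric - Ric*` on `𝔪`, that is `⟨r X, Y⟩ = Ric(X, Y) - Ric*(X, Y)`. -/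
def r : S.tangent →ₗ[ℝ] S.tangent := S.sharp.toLinearMap ∘ₗ (S.ricci - S.ricciStar)

theorem inner_r (X Y : S.tangent) :
    S.inner (S.r X) Y = S.ricci X Y - S.ricciStar X Y := by
  simp [r, inner_sharp]

end Metric

end Triple

/-! ## Roots -/

/-- The inner automorphism `Ad (exp X) = e^{ad X}` of `g`, as a linear map. -/
def adExp {g : Type*} [LieRing g] [LieAlgebra ℝ g] [Module.Finite ℝ g] (X : g) : g →ₗ[ℝ] g :=
  Matrix.toLin (Module.finBasis ℝ g) (Module.finBasis ℝ g)
    (NormedSpace.exp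
      (LinearMap.toMatrix (Module.finBasis ℝ g) (Module.finBasis ℝ g) (LieAlgebra.ad ℝ g X)))


/-- A maximal torus `t` of `g`, with `H = t_ℂ` a Cartan subalgebra of `g_ℂ = ℂ ⊗ g`, together with
a base `Π = {α₁, …, αₙ}` of the root system `Δ` of `(g_ℂ, H)`, numbered by `Fin n`
(`simple k` is `α_{k+1}`). -/
structure RootFrame (g : Type*) [LieRing g] [LieAlgebra ℝ g] [Module.Finite ℝ g]
    [IsCompactSimple g] (n : ℕ) where
  t : LieSubalgebra ℝ g
  H : LieSubalgebra ℂ (ℂ ⊗[ℝ] g)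
  H_eq : H.toSubmodule = t.toSubmodule.baseChange ℂ
  [cartan : H.IsCartanSubalgebra]
  base : (LieAlgebra.IsKilling.rootSystem H).Base
  simple : Fin n ≃ base.support

attribute [instance] RootFrame.cartan

namespace RootFrame

variable {g : Type*} [LieRing g] [LieAlgebra ℝ g] [Module.Finite ℝ g] [IsCompactSimple g]
  {n : ℕ} (F : RootFrame g n)

/-- The set `Δ` of (nonzero) roots. -/
abbrev Root := {α : LieModule.Weight ℂ F.H (ℂ ⊗[ℝ] g) // α ∈ F.H.root}

/-- The simple root `αₖ`. -/
def simpleRoot (k : Fin n) : F.Root := (F.simple k : F.Root)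

/-- The Cartan matrix `2⟨αₚ, α_q⟩ / ⟨α_q, α_q⟩`. -/
def cartanMatrix : Matrix (Fin n) (Fin n) ℤ :=
  Matrix.of fun p q => F.base.cartanMatrix (F.simple p) (F.simple q)

/-- The coefficient `nₖ(α)` in `α = ∑ₖ nₖ(α) αₖ`. -/
def coeff (α : F.Root) (k : Fin n) : ℤ :=
  F.base.toWeightBasisInt.repr ((LieAlgebra.IsKilling.rootSystem F.H).rootSpanMem ℤ α) (F.simple k)

/-- `μ` is the highest root. -/
def IsHighest (μ : F.Root) : Prop := ∀ α k, F.coeff α k ≤ F.coeff μ k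

/-- `κ = ⟨μ, μ⟩ = B(H_μ, H_μ)` where `H_μ ∈ H` represents `μ` through the Killing form `B` of `g_ℂ`
(this complex number is real). -/
def kappa (μ : F.Root) : ℝ :=
  (killingForm ℂ (ℂ ⊗[ℝ] g)
    ((LieAlgebra.IsKilling.cartanEquivDual F.H).symm (LieModule.Weight.toLinear ℂ F.H _ μ.1))
    ((LieAlgebra.IsKilling.cartanEquivDual F.H).symm (LieModule.Weight.toLinear ℂ F.H _ μ.1))).re

/-- The real plane `g ∩ (g_α ⊕ g_{-α}) = ℝ U⁰_α + ℝ U¹_α`, where `U⁰_α = E_α - E_{-α}` and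
`U¹_α = √-1 (E_α + E_{-α})`, for root vectors `E_{±α}` adapted to the compact form `g`. -/
def plane (α : F.Root) : Submodule ℝ g :=
  Submodule.comap (TensorProduct.mk ℝ ℂ g 1)
    ((LieAlgebra.rootSpace F.H (α.1 : F.H → ℂ) ⊔
      LieAlgebra.rootSpace F.H (-(α.1 : F.H → ℂ))).toSubmodule.restrictScalars ℝ)

/-- The span of the planes of the positive roots satisfying `P`. -/
def planes (P : F.Root → Prop) : Submodule ℝ g :=
  ⨆ α : F.Root, ⨆ _ : F.base.IsPos α ∧ P α, F.plane α

/-- `h` is the vector `Hᵢ` defined by `αₖ(Hᵢ) = δᵢₖ / mᵢ`, where `μ = ∑ₖ mₖ αₖ`. -/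
def IsDualVector (μ : F.Root) (i : Fin n) (h : F.H) : Prop :=
  ∀ k, (F.simpleRoot k).1 h = if k = i then 1 / (F.coeff μ i : ℂ) else 0

/-- `σ = Ad (exp 2π√-1 h)`, with `√-1 h` in `t`. -/
def IsAdExp (S : Triple g) (h : F.H) : Prop :=
  ∃ X ∈ F.t, (1 : ℂ) ⊗ₜ[ℝ] X = (2 * Real.pi * Complex.I) • (h : ℂ ⊗[ℝ] g) ∧
    ∀ Y, S.σ Y = adExp X Y

/-- Type `A₃II`: `mᵢ = mⱼ = 1`, `i < j` and `σ = Ad (exp 2π√-1 H)` with `H = (Hᵢ + Hⱼ) / 3`. -/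
def IsTypeII (μ : F.Root) (i j : Fin n) (S : Triple g) : Prop :=
  i < j ∧ F.coeff μ i = 1 ∧ F.coeff μ j = 1 ∧
    ∃ Hi Hj : F.H, F.IsDualVector μ i Hi ∧ F.IsDualVector μ j Hj ∧
      F.IsAdExp S ((1 / 3 : ℂ) • (Hi + Hj))

/-- Type `A₃III`: `mᵢ = 2` and `σ = Ad (exp 2π√-1 H)` with `H = (2 / 3) Hᵢ`. -/
def IsTypeIII (μ : F.Root) (i : Fin n) (S : Triple g) : Prop :=
  F.coeff μ i = 2 ∧ ∃ Hi : F.H, F.IsDualVector μ i Hi ∧ F.IsAdExp S ((2 / 3 : ℂ) • Hi)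

end RootFrame

/-- `V` is an eigenbundle of `r` for the eigenvalue `c`, of rank `d`: a subspace of `𝔪` of
dimension `d`, invariant under `𝔨`, on which `r` is multiplication by `c`. -/
structure IsEigenbundle {g : Type*} [LieRing g] [LieAlgebra ℝ g] [Module.Finite ℝ g]
    [IsCompactSimple g] (S : Triple g) (V : Submodule ℝ g) (c : ℝ) (d : ℕ) : Prop where
  le : V ≤ S.tangent
  invariant : ∀ A ∈ S.isotropy, ∀ X ∈ V, ⁅A, X⁆ ∈ V
  apply_eq : ∀ X : S.tangent, (X : g) ∈ V → S.r X = c • X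
  finrank_eq : Module.finrank ℝ V = d

/-! ## Dynkin types and the tables -/

/-- The types of the complex simple Lie algebras, each listed once. -/
inductive DynkinType
  | A (n : ℕ) (hn : 1 ≤ n)
  | B (n : ℕ) (hn : 3 ≤ n)
  | C (n : ℕ) (hn : 2 ≤ n)
  | D (n : ℕ) (hn : 4 ≤ n)
  | E6
  | E7
  | E8
  | F4
  | G2

namespace DynkinType

/-- The rank. -/
def rank : DynkinType → ℕ
  | A n _ => n
  | B n _ => n
  | C n _ => n
  | D n _ => n
  | E6 => 6
  | E7 => 7
  | E8 => 8
  | F4 => 4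
  | G2 => 2

/-- The Cartan matrix, with Bourbaki's numbering of the simple roots (for `G2`, `α₁` is short and
`α₂` is long). -/
def cartan : (X : DynkinType) → Matrix (Fin X.rank) (Fin X.rank) ℤ
  | A n _ => CartanMatrix.A n
  | B n _ => CartanMatrix.B n
  | C n _ => CartanMatrix.C n
  | D n _ => CartanMatrix.D n
  | E6 => CartanMatrix.E₆
  | E7 => CartanMatrix.E₇
  | E8 => CartanMatrix.E₈
  | F4 => CartanMatrix.F₄
  | G2 => CartanMatrix.G₂ᵀ

end DynkinType

/-- The table for Type `A₃II`: `TableII X i j l k m d₁ d₂ d₃` says that for `g` of type `X` and the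
nodes `i < j` (numbered from `1`) the eigenvalues are `(l κ, k κ, m κ)` and the eigenbundles have
dimensions `d₁, d₂, d₃`. -/
inductive TableII : DynkinType → ℕ → ℕ → ℕ → ℕ → ℕ → ℕ → ℕ → ℕ → Prop
  /-- `SU(r₁ + r₂ + r₃) / S(U(r₁) × U(r₂) × U(r₃))` -/
  | su (r₁ r₂ r₃ : ℕ) (h₁ : 1 ≤ r₁) (h₂ : 1 ≤ r₂) (h₃ : 1 ≤ r₃) :
      TableII (.A (r₁ + r₂ + r₃ - 1) (by omega)) r₁ (r₁ + r₂)
        (2 * r₂) (2 * r₃) (2 * r₁) (2 * r₁ * r₃) (2 * r₁ * r₂) (2 * r₂ * r₃)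
  /-- `SO(2n) / (U(n - 1) × SO(2))` -/
  | so (n : ℕ) (hn : 4 ≤ n) :
      TableII (.D n hn) (n - 1) n
        4 (2 * (n - 2)) (2 * (n - 2)) ((n - 1) * (n - 2)) (2 * (n - 1)) (2 * (n - 1))
  /-- The same space `SO(2n) / (U(n - 1) × SO(2))`, presented by a conjugate automorphism; the
  eigenbundles are relabelled. -/
  | so' (n : ℕ) (hn : 4 ≤ n) (j : ℕ) (hj : j = n - 1 ∨ j = n) :
      TableII (.D n hn) 1 j
        (2 * (n - 2)) (2 * (n - 2)) 4 (2 * (n - 1)) (2 * (n - 1)) ((n - 1) * (n - 2))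
  /-- `E₆ / (SO(8) × SO(2) × SO(2))` -/
  | e6 : TableII .E6 1 6 8 8 8 16 16 16

/-- The table for Type `A₃III`: `TableIII X i l k d₁ d₂` says that for `g` of type `X` and the node
`i` (numbered from `1`) the eigenvalues are `(l κ, k κ)` and the eigenbundles have dimensions
`d₁, d₂`. -/
inductive TableIII : DynkinType → ℕ → ℕ → ℕ → ℕ → ℕ → Prop
  /-- `SO(2n + 1) / (U(i) × SO(2(n - i) + 1))` -/
  | soOdd (n : ℕ) (hn : 3 ≤ n) (i : ℕ) (hi : 2 ≤ i) (hin : i ≤ n) :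
      TableIII (.B n hn) i
        (2 * (2 * (n - i) + 1)) (2 * (i - 1)) (i * (i - 1)) (2 * i * (2 * (n - i) + 1))
  /-- `Sp(n) / (U(i) × Sp(n - i))` -/
  | sp (n : ℕ) (hn : 2 ≤ n) (i : ℕ) (hi : 1 ≤ i) (hin : i < n) :
      TableIII (.C n hn) i
        (2 * (n - i)) (i + 1) (i * (i + 1)) (4 * i * (n - i))
  /-- `SO(2n) / (U(i) × SO(2(n - i)))` -/
  | soEven (n : ℕ) (hn : 4 ≤ n) (i : ℕ) (hi : 2 ≤ i) (hin : i ≤ n - 2) :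
      TableIII (.D n hn) i
        (4 * (n - i)) (2 * (i - 1)) (i * (i - 1)) (4 * i * (n - i))
  /-- `G₂ / U(2)` -/
  | g2 : TableIII .G2 2 4 2 2 8
  /-- `F₄ / (Spin(7) × T¹)` -/
  | f4_spin7 : TableIII .F4 4 4 7 14 16
  /-- `F₄ / (Sp(3) × T¹)` -/
  | f4_sp3 : TableIII .F4 1 14 2 2 28
  /-- `E₆ / (S(U(5) × U(1)) × SU(2))`; the nodes `3` and `5` give isomorphic spaces. -/
  | e6_su5 (i : ℕ) (hi : i = 3 ∨ i = 5) : TableIII .E6 i 12 6 10 40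
  /-- `E₆ / (SU(6) × T¹)` -/
  | e6_su6 : TableIII .E6 2 20 2 2 40
  /-- `E₇ / (SU(2) × SO(10) × SO(2))` -/
  | e7_so10 : TableIII .E7 6 16 10 20 64
  /-- `E₇ / (SO(12) × SO(2))` -/
  | e7_so12 : TableIII .E7 1 32 2 2 64
  /-- `E₇ / S(U(7) × U(1))` -/
  | e7_su7 : TableIII .E7 2 20 8 14 70
  /-- `E₈ / (SO(14) × SO(2))` -/
  | e8_so14 : TableIII .E8 1 32 14 28 128
  /-- `E₈ / (E₇ × T¹)` -/
  | e8_e7 : TableIII .E8 8 56 2 2 112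

end ThreeSymmetric

end

/-! The metric is naturally reductive, so `∇_X Y = ½[X, Y]_𝔪`, while `J` anticommutes with every
`[X, ·]_𝔪` and commutes with `ad 𝔨` on `𝔪`. In `Ric - Ric*` the curvature enters only through
`R_{XZ} Y + J R_{XZ} JY`, where everything cancels except the term coming from `[X, Z]_𝔪`. What
remains is `⟨rX, Y⟩ = -tr (ad_𝔪 Y ∘ ad_𝔪 X)` (`Triple.inner_r_eq`), and the task is to find the `c`
for which this compressed trace is `c/2` times the Killing form.

After complexification the projection `P` onto `𝔪` is diagonal on the root decomposition: on the
weight `χ` it is `0` or `1` according to whether an integer read off from `nᵢ` (or from `nᵢ + nⱼ`)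
is divisible by `3`. For `x ∈ g_α` and `y ∈ g_{-α}` the trace of `P ad y P ad x` splits over grades.
The highest root bounds the grades, so for every grade that contributes, a translate by `α` or `-α`
falls off the end of the grading. There, after a cyclic shift if needed, `ad y ad x` may be replaced
by `0` or by `± ad [x, y]`. Since `[x, y] = B(x, y) H_α`, the trace becomes `B(x, y)` times sums of
`⟨β, α⟩` over the roots `β` of a fixed grade (`compressedTrace_of_grading_one` and its three
companions).

Such a sum is linear in `α` and vanishes at every simple root other than `αᵢ` and `αⱼ`, because
reflections in those simple roots preserve the grade. It is therefore determined by evaluation on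
fundamental coweights `ω`, that is, by the number of roots in the grade. These numbers solve linear
equations: `B(ωᵢ, ωⱼ) = ∑ nᵢ nⱼ` over all roots and, for one coefficient, the value of the sum of
the positive roots on `ωᵢ`. The scale is fixed by `B(μ^∨, μ^∨) = 4h^∨`, with `h^∨` the dual Coxeter
number, which makes `κ = 1/h^∨`.

Each case thus needs only data of the Cartan matrix: the highest root, the coefficients of its
coroot, root lengths, and fundamental coweights in terms of simple coroots. The highest root is
certified by a chain of simple reflections from a long simple root to a dominant root
(`RootFrame.IsHighest.coeff_eq_and_Q`). `RootFrame.IsHighest.typeII` and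
`RootFrame.IsHighest.typeIII` convert the data into the geometric conclusion. `exists_isTypeData`
supplies the data, numerically for the exceptional types and by formulas in the rank for the
classical ones. -/

set_option linter.unusedSectionVars false

noncomputable section

namespace ThreeSymmetric

open LieModule LieAlgebra LieAlgebra.IsKilling Module

namespace Triple

variable {g : Type*} [LieRing g] [LieAlgebra ℝ g] (S : Triple g)

/-! ### The Ricci operator of a naturally reductive `3`-symmetric space -/

theorem coe_projM (x : g) : (S.projM x : g) = x - S.projK x := rfl

theorem map_projK (x : g) : S.σ (S.projK x) = S.projK x := by
  simp only [projK_apply, map_smul, map_add, S.order_three]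
  module

theorem map_map_coe (X : S.tangent) : S.σ (S.σ (X : g)) = -(X : g) - S.σ (X : g) := by
  have hx := S.mem_tangent.mp X.2
  rw [← sub_eq_zero, ← hx]; abel

theorem coe_J (X : S.tangent) :
    (S.J X : g) = (√3)⁻¹ • ((2 : ℝ) • S.σ (X : g) + (X : g)) := by
  simp [J]

theorem map_projM (x : g) : S.σ (S.projM x : g) = S.projM (S.σ x) := by
  simp only [coe_projM, projK_apply, map_sub, map_smul, map_add, S.order_three]

theorem coe_bracketM (X Y : S.tangent) :
    (S.bracketM X Y : g) = (S.projM ⁅(X : g), (Y : g)⁆ : g) := rfl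

theorem bracketM_swap (X Y : S.tangent) : S.bracketM X Y = - S.bracketM Y X := by
  ext
  rw [Submodule.coe_neg, coe_bracketM, coe_bracketM, ← lie_skew, map_neg, Submodule.coe_neg]

/-- `[X, σ Y]_𝔪 = σ² [X, Y]_𝔪` on `𝔪`. -/
theorem projM_lie_map (X Y : S.tangent) :
    (S.projM ⁅(X : g), S.σ (Y : g)⁆ : g) = S.σ (S.σ (S.bracketM X Y : g)) := by
  set a := ⁅(X : g), (Y : g)⁆ with ha
  set b := ⁅(X : g), S.σ (Y : g)⁆ with hb
  set c := ⁅S.σ (X : g), (Y : g)⁆ with hc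
  have h1 : S.σ b = -c - S.σ a := by
    rw [hb, LieEquiv.map_lie, map_map_coe, lie_sub, lie_neg, ha, LieEquiv.map_lie]
  have h2 : S.σ (S.σ b) = -a - c := by
    rw [hb, LieEquiv.map_lie, LieEquiv.map_lie, S.order_three, map_map_coe, sub_lie, neg_lie]
  -- The difference eliminates the mixed bracket `c = [σX, Y]`.
  have h3 : S.σ (S.σ b) - S.σ b = S.σ a - a := by rw [h2, h1]; abel
  have h4 : S.σ (S.projM (S.σ b) : g) - S.σ (S.projM b : g) = S.projM (S.σ a - a) := by
    rw [map_projM, map_projM, ← h3]; simp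
  have hb' := S.map_map_coe (S.projM b)
  have ha' := S.map_map_coe (S.projM a)
  rw [← map_projM, hb', map_sub, Submodule.coe_sub, ← map_projM] at h4
  rw [coe_bracketM, ← ha, ha']
  have h5 := congrArg S.σ h4
  simp only [map_sub, map_neg, hb', ha'] at h5
  -- On `𝔪` the relation reads `-(1 + 2σ) b = σa - a`. Since `(1 + 2σ)² = -3` there, adding twice
  -- its image under `σ` solves for `3b`.
  have h6 : (3 : ℝ) • (S.projM b : g) = (3 : ℝ) • (-(S.projM a : g) - S.σ (S.projM a : g)) := by
    linear_combination (norm := module) h4 + (2 : ℝ) • h5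
  exact smul_right_injective g (three_ne_zero) h6

/-- By `projM_lie_map`, moving `σ` out of the bracket turns it into `σ² = -1 - σ`, and this
substitution changes the sign of `2σ + 1`. -/
theorem bracketM_J (X Y : S.tangent) : S.bracketM X (S.J Y) = - S.J (S.bracketM X Y) := by
  ext
  rw [Submodule.coe_neg, coe_J, coe_bracketM, coe_J]
  have h : (S.projM ⁅(X : g), (√3)⁻¹ • ((2 : ℝ) • S.σ (Y : g) + (Y : g))⁆ : g)
      = (√3)⁻¹ • ((2 : ℝ) • (S.projM ⁅(X : g), S.σ (Y : g)⁆ : g)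
        + (S.projM ⁅(X : g), (Y : g)⁆ : g)) := by simp
  rw [h, projM_lie_map, coe_bracketM, map_map_coe]
  module

theorem J_J (X : S.tangent) : S.J (S.J X) = -X := by
  ext
  have h3 : (√3)⁻¹ * (√3)⁻¹ = (1 / 3 : ℝ) := by
    rw [← mul_inv, Real.mul_self_sqrt (by norm_num)]; norm_num
  rw [coe_J, coe_J]
  simp only [map_smul, map_add, map_map_coe, Submodule.coe_neg]
  have : (√3)⁻¹ • ((2 : ℝ) • (√3)⁻¹ • ((2 : ℝ) • (-(X : g) - S.σ (X : g)) + S.σ (X : g))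
      + (√3)⁻¹ • ((2 : ℝ) • S.σ (X : g) + (X : g))) = ((√3)⁻¹ * (√3)⁻¹ * -3) • (X : g) := by
    module
  rw [this, h3]
  module

/-- The `𝔨`-part of a bracket is fixed by `σ`, so its adjoint action commutes with `σ` and hence
with `J`. -/
theorem adM_bracketK_J (X Y Z : S.tangent) :
    S.adM (S.bracketK X Y) (S.J Z) = S.J (S.adM (S.bracketK X Y) Z) := by
  have hk : S.σ (S.bracketK X Y) = S.bracketK X Y := S.map_projK _
  have e (A : g) (Z : S.tangent) : (S.adM A Z : g) = S.projM ⁅A, (Z : g)⁆ := rfl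
  ext
  rw [e, coe_J, coe_J, e, map_projM, LieEquiv.map_lie, hk]
  simp

/-- `ad X ∘ ad Y` compressed to `𝔪`. -/
theorem trace_bracketM [Module.Finite ℝ g] (X Y : S.tangent) :
    LinearMap.trace ℝ S.tangent (S.bracketM Y ∘ₗ S.bracketM X) =
      LinearMap.trace ℝ g ((LinearMap.id - S.projK) ∘ₗ LieAlgebra.ad ℝ g (Y : g) ∘ₗ
        (LinearMap.id - S.projK) ∘ₗ LieAlgebra.ad ℝ g (X : g)) := by
  have h1 : (LinearMap.id - S.projK) = S.tangent.subtype ∘ₗ S.projM := rfl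
  have h2 (X : S.tangent) :
    S.bracketM X = S.projM ∘ₗ (LieAlgebra.ad ℝ g (X : g) : g →ₗ[ℝ] g) ∘ₗ S.tangent.subtype := rfl
  rw [h1, h2, h2]
  exact Eq.symm <| LinearMap.trace_comp_comm' (S.projM ∘ₗ (LieAlgebra.ad ℝ g (Y : g) : g →ₗ[ℝ] g) ∘ₗ
    S.tangent.subtype ∘ₗ S.projM ∘ₗ (LieAlgebra.ad ℝ g (X : g) : g →ₗ[ℝ] g)) S.tangent.subtype

/-! ### Reduction of `r` to a compressed trace -/

section Metric

theorem killingForm_map_map (x y : g) :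
    killingForm ℝ g (S.σ x) (S.σ y) = killingForm ℝ g x y :=
  LieAlgebra.killingForm_of_equiv_apply S.σ x y

/-- Invariance of the form moves the average over the powers of `σ` onto `Z`, where `1 + σ + σ²`
vanishes; so `𝔨 ⊥ 𝔪`. -/
theorem killingForm_projK_coe (x : g) (Z : S.tangent) :
    killingForm ℝ g (S.projK x) Z = 0 := by
  have h1 : killingForm ℝ g (S.σ x) Z = killingForm ℝ g x (S.σ (S.σ (Z : g))) := by
    rw [← killingForm_map_map, ← killingForm_map_map, S.order_three]
  have h2 : killingForm ℝ g (S.σ (S.σ x)) Z = killingForm ℝ g x (S.σ (Z : g)) := by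
    rw [← killingForm_map_map, S.order_three]
  rw [projK_apply, map_smul, LinearMap.smul_apply, map_add, map_add, LinearMap.add_apply,
    LinearMap.add_apply, h1, h2, map_map_coe, map_sub, map_neg]
  ring_nf

theorem inner_projM (x : g) (Z : S.tangent) :
    S.inner (S.projM x) Z = -(1 / 2) * killingForm ℝ g x Z := by
  rw [inner_apply, coe_projM, map_sub, LinearMap.sub_apply, killingForm_projK_coe, sub_zero]

theorem inner_comm (X Y : S.tangent) : S.inner X Y = S.inner Y X := by
  rw [inner_apply, inner_apply, LieModule.traceForm_comm]

theorem inner_bracketM (X Y Z : S.tangent) :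
    S.inner (S.bracketM X Y) Z = S.inner X (S.bracketM Y Z) := by
  rw [S.inner_comm X, show S.bracketM X Y = S.projM ⁅(X : g), (Y : g)⁆ from rfl,
    show S.bracketM Y Z = S.projM ⁅(Y : g), (Z : g)⁆ from rfl, inner_projM, inner_projM,
    LieModule.traceForm_apply_lie_apply, LieModule.traceForm_comm ℝ g g _ (X : g)]

variable [IsCompactSimple g] [Module.Finite ℝ g]

/-- `M` is naturally reductive. -/
theorem nabla_eq (X Y : S.tangent) : S.nabla X Y = (2⁻¹ : ℝ) • S.bracketM X Y := by
  refine sub_eq_zero.mp (S.inner_nondegenerate.1 _ fun Z => ?_)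
  have h := S.koszul X Y Z
  rw [← inner_bracketM, ← inner_bracketM, S.bracketM_swap Y X] at h
  simp only [map_neg, LinearMap.neg_apply, map_sub, map_smul, LinearMap.sub_apply,
    LinearMap.smul_apply, smul_eq_mul] at h ⊢
  linarith

/-- `J` passes through two factors `∇`, or through `ad` of the `𝔨`-part, without a sign, and `J² =
-1` cancels these terms. The single factor `∇_{[X, Z]_𝔪}` brings an extra sign, so its term doubles.
-/
theorem curvature_add_J (X Y Z : S.tangent) :
    S.curvature X Z Y + S.J (S.curvature X Z (S.J Y)) = - S.bracketM Y (S.bracketM X Z) := by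
  simp only [curvature_apply, nabla_eq, adM_bracketK_J, bracketM_J, map_add, map_sub, map_smul,
    map_neg, J_J]
  rw [S.bracketM_swap Y (S.bracketM X Z)]
  module

theorem inner_r_eq (X Y : S.tangent) :
    S.inner (S.r X) Y = - LinearMap.trace ℝ S.tangent (S.bracketM Y ∘ₗ S.bracketM X) := by
  rw [inner_r, ricci, ricciStar, LinearMap.mk₂_apply, LinearMap.mk₂_apply, sub_neg_eq_add,
    ← map_add, ← map_neg]
  congr 1
  ext1 Z
  exact S.curvature_add_J X Y Z

/-- The factor `c / 2` absorbs the normalisation `-½B` of the metric. The trace is taken over all of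
`g` so that it can be complexified and computed on root spaces. -/
theorem r_apply_eq {X : S.tangent} {c : ℝ}
    (h : ∀ Y : S.tangent, LinearMap.trace ℝ g ((LinearMap.id - S.projK) ∘ₗ
      LieAlgebra.ad ℝ g (Y : g) ∘ₗ (LinearMap.id - S.projK) ∘ₗ LieAlgebra.ad ℝ g (X : g)) =
        c / 2 * killingForm ℝ g (X : g) (Y : g)) :
    S.r X = c • X := by
  refine sub_eq_zero.mp (S.inner_nondegenerate.1 _ fun Y => ?_)
  rw [map_sub, LinearMap.sub_apply, inner_r_eq, trace_bracketM, h, map_smul,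
    LinearMap.smul_apply, inner_apply, smul_eq_mul]
  ring

end Metric

end Triple

section Weights

variable {L : Type*} [LieRing L] [LieAlgebra ℂ L] [Module.Finite ℂ L]
  (H : LieSubalgebra ℂ L) [H.IsCartanSubalgebra]

/-! ### A basis of weight vectors -/

open Classical in
theorem isInternal_rootSpace :
    DirectSum.IsInternal fun χ : Weight ℂ H L => (rootSpace H (χ : H → ℂ)).toSubmodule := by
  rw [DirectSum.isInternal_submodule_iff_iSupIndep_and_iSup_eq_top]
  refine ⟨?_, ?_⟩
  · exact LieSubmodule.iSupIndep_toSubmodule.mpr (iSupIndep_genWeightSpace' ℂ H L)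
  · rw [← LieSubmodule.iSup_toSubmodule, iSup_genWeightSpace_eq_top' ℂ H L,
      LieSubmodule.top_toSubmodule]

/-- The index type of a basis of weight vectors. -/
abbrev WeightIndex : Type _ :=
  Σ χ : Weight ℂ H L, Fin (finrank ℂ (rootSpace H (χ : H → ℂ)).toSubmodule)

open Classical in
/-- A basis of `L` consisting of weight vectors. -/
def weightBasis : Basis (WeightIndex H) ℂ L :=
  (isInternal_rootSpace H).collectedBasis fun χ =>
    Module.finBasis ℂ (rootSpace H (χ : H → ℂ)).toSubmodule

theorem weightBasis_mem (k : WeightIndex H) : weightBasis H k ∈ rootSpace H (k.1 : H → ℂ) := by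
  classical
  exact (isInternal_rootSpace H).collectedBasis_mem _ k

variable {H}

theorem weightBasis_repr_of_ne {ψ : H → ℂ} {v : L} (hv : v ∈ rootSpace H ψ) {k : WeightIndex H}
    (hk : (k.1 : H → ℂ) ≠ ψ) : (weightBasis H).repr v k = 0 := by
  classical
  by_cases hψ : rootSpace H ψ = ⊥
  · rw [hψ, LieSubmodule.mem_bot] at hv
    simp [hv]
  · obtain ⟨χ, a⟩ := k
    exact (isInternal_rootSpace H).collectedBasis_repr_of_mem_ne _ (i := ⟨ψ, hψ⟩) (j := χ)
      (fun h => hk (congrArg (fun χ : Weight ℂ H L => (χ : H → ℂ)) h.symm)) hv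

theorem rootSpace_eq_bot {ψ : H → ℂ} (h : ∀ χ : Weight ℂ H L, (χ : H → ℂ) ≠ ψ) :
    rootSpace H ψ = ⊥ := by
  by_contra hψ
  exact h ⟨ψ, hψ⟩ rfl

variable (H) in
/-- The sum of the weight spaces whose weights satisfy `p`. -/
def weightSum (p : (H → ℂ) → Prop) : Submodule ℂ L where
  carrier := {v | ∀ k : WeightIndex H, ¬ p k.1 → (weightBasis H).repr v k = 0}
  add_mem' hv hw k hk := by simp [hv k hk, hw k hk]
  zero_mem' := by simp
  smul_mem' c v hv k hk := by simp [hv k hk]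

theorem rootSpace_le_weightSum {p : (H → ℂ) → Prop} {ψ : H → ℂ} (hψ : p ψ) :
    (rootSpace H ψ).toSubmodule ≤ weightSum H p := fun _ hv _ hk =>
  weightBasis_repr_of_ne hv fun h => hk (h ▸ hψ)

theorem mem_weightSum_of_mem {p : (H → ℂ) → Prop} {ψ : H → ℂ} (hψ : p ψ) {v : L}
    (hv : v ∈ rootSpace H ψ) : v ∈ weightSum H p := rootSpace_le_weightSum hψ hv

theorem weightSum_le {p : (H → ℂ) → Prop} {W : Submodule ℂ L}
    (h : ∀ χ : Weight ℂ H L, p χ → (rootSpace H (χ : H → ℂ)).toSubmodule ≤ W) :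
    weightSum H p ≤ W := by
  intro v hv
  rw [← (weightBasis H).sum_repr v]
  refine Submodule.sum_mem _ fun k _ => ?_
  by_cases hk : p k.1
  · exact W.smul_mem _ (h k.1 hk (weightBasis_mem H k))
  · rw [hv k hk, zero_smul]; exact W.zero_mem

theorem weightSum_mono {p q : (H → ℂ) → Prop} (h : ∀ χ : Weight ℂ H L, p χ → q χ) :
    weightSum H p ≤ weightSum H q :=
  weightSum_le fun χ hχ => rootSpace_le_weightSum (h χ hχ)

theorem lie_mem_weightSum {p q r : (H → ℂ) → Prop}
    (h : ∀ χ ψ : Weight ℂ H L, p χ → q ψ → r (χ + ψ)) {v w : L} (hv : v ∈ weightSum H p)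
    (hw : w ∈ weightSum H q) : ⁅v, w⁆ ∈ weightSum H r := by
  have h1 : weightSum H p ≤ (weightSum H r).comap ((ad ℂ L : L →ₗ[ℂ] End ℂ L).flip w) := by
    refine weightSum_le fun χ hχ x hx => ?_
    have h2 : weightSum H q ≤ (weightSum H r).comap (ad ℂ L x) :=
      weightSum_le fun ψ hψ y hy =>
        rootSpace_le_weightSum (h χ ψ hχ hψ) (lie_mem_genWeightSpace_of_mem_genWeightSpace hx hy)
    exact h2 hw
  exact h1 hv

variable (H) in
/-- The operator acting on the weight space of `χ` as multiplication by `f χ`. -/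
def weightDiag (f : (H → ℂ) → ℂ) : End ℂ L :=
  (weightBasis H).constr ℂ fun k => f k.1 • weightBasis H k

theorem weightDiag_basis (f : (H → ℂ) → ℂ) (k : WeightIndex H) :
    weightDiag H f (weightBasis H k) = f k.1 • weightBasis H k :=
  (weightBasis H).constr_basis ..

theorem repr_weightDiag (f : (H → ℂ) → ℂ) (v : L) (k : WeightIndex H) :
    (weightBasis H).repr (weightDiag H f v) k = f k.1 * (weightBasis H).repr v k := by
  classical
  have : (weightBasis H).coord k ∘ₗ weightDiag H f = f k.1 • (weightBasis H).coord k := by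
    refine (weightBasis H).ext fun l => ?_
    rw [LinearMap.comp_apply, weightDiag_basis]
    by_cases hkl : l = k
    · subst hkl; simp
    · simp [hkl]
  exact LinearMap.congr_fun this v

theorem weightDiag_apply {ψ : H → ℂ} {v : L} (hv : v ∈ rootSpace H ψ) (f : (H → ℂ) → ℂ) :
    weightDiag H f v = f ψ • v := by
  refine (weightBasis H).ext_elem fun k => ?_
  rw [repr_weightDiag, map_smul, Finsupp.smul_apply, smul_eq_mul]
  by_cases hk : (k.1 : H → ℂ) = ψ
  · rw [hk]
  · rw [weightBasis_repr_of_ne hv hk, mul_zero, mul_zero]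

theorem ext_rootSpace {M : Type*} [AddCommMonoid M] [Module ℂ M] {A B : L →ₗ[ℂ] M}
    (h : ∀ (χ : Weight ℂ H L), ∀ v ∈ rootSpace H (χ : H → ℂ), A v = B v) : A = B :=
  (weightBasis H).ext fun k => h k.1 _ (weightBasis_mem H k)

theorem weightDiag_add (f f' : (H → ℂ) → ℂ) :
    weightDiag H (f + f') = weightDiag H f + weightDiag H f' :=
  ext_rootSpace fun χ v hv => by
    rw [LinearMap.add_apply, weightDiag_apply hv, weightDiag_apply hv, weightDiag_apply hv,
      Pi.add_apply, add_smul]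

open Classical in
theorem mem_weightSum_iff_weightDiag {p : (H → ℂ) → Prop} {v : L} :
    v ∈ weightSum H p ↔ weightDiag H (fun χ => if p χ then 1 else 0) v = v := by
  constructor
  · intro hv
    refine (weightBasis H).ext_elem fun k => ?_
    rw [repr_weightDiag]
    by_cases hk : p k.1
    · rw [if_pos hk, one_mul]
    · rw [if_neg hk, zero_mul, hv k hk]
  · intro hv k hk
    rw [← hv, repr_weightDiag, if_neg hk, zero_mul]

theorem mem_weightSum_of_weightDiag_eq {f : (H → ℂ) → ℂ} {c : ℂ} {v : L}
    (hv : weightDiag H f v = c • v) : v ∈ weightSum H fun χ => f χ = c := by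
  intro k hk
  have := congrArg (fun w => (weightBasis H).repr w k) hv
  simp only [repr_weightDiag, map_smul, Finsupp.smul_apply, smul_eq_mul] at this
  have h2 : (f k.1 - c) * (weightBasis H).repr v k = 0 := by rw [sub_mul, this, sub_self]
  exact (mul_eq_zero.mp h2).resolve_left (sub_ne_zero.mpr hk)

theorem weightDiag_of_mem_weightSum {f : (H → ℂ) → ℂ} {c : ℂ} {v : L}
    (hv : v ∈ weightSum H fun χ => f χ = c) : weightDiag H f v = c • v := by
  refine (weightBasis H).ext_elem fun k => ?_
  rw [repr_weightDiag, map_smul, Finsupp.smul_apply, smul_eq_mul]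
  by_cases hk : f k.1 = c
  · rw [hk]
  · rw [hv k hk, mul_zero, mul_zero]

/-! ### Traces -/

theorem trace_weightDiag_comp (f : (H → ℂ) → ℂ) (A : End ℂ L) :
    LinearMap.trace ℂ L (weightDiag H f ∘ₗ A) =
      ∑ k, f k.1 * (weightBasis H).repr (A (weightBasis H k)) k := by
  classical
  rw [LinearMap.trace_eq_matrix_trace ℂ (weightBasis H), Matrix.trace]
  refine Finset.sum_congr rfl fun k _ => ?_
  rw [Matrix.diag_apply, LinearMap.toMatrix_apply, LinearMap.comp_apply, repr_weightDiag]

/-- An operator shifting all weights by `γ ≠ 0` has zero diagonal in a basis of weight vectors. -/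
theorem trace_weightDiag_comp_eq_zero (f : (H → ℂ) → ℂ) {A : End ℂ L} {γ : H → ℂ} (hγ : γ ≠ 0)
    (hA : ∀ (χ : Weight ℂ H L), ∀ v ∈ rootSpace H (χ : H → ℂ), A v ∈ rootSpace H (χ + γ)) :
    LinearMap.trace ℂ L (weightDiag H f ∘ₗ A) = 0 := by
  rw [trace_weightDiag_comp]
  refine Finset.sum_eq_zero fun k _ => ?_
  rw [weightBasis_repr_of_ne (hA _ _ (weightBasis_mem H k)) (by simpa using hγ), mul_zero]

variable [IsKilling ℂ L]

theorem trace_weightDiag (f : (H → ℂ) → ℂ) :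
    LinearMap.trace ℂ L (weightDiag H f) =
      ∑ χ : Weight ℂ H L, (finrank ℂ (rootSpace H (χ : H → ℂ)) : ℂ) * f χ := by
  have := trace_weightDiag_comp f (LinearMap.id : End ℂ L)
  rw [LinearMap.comp_id] at this
  rw [this]
  simp only [LinearMap.id_apply, Basis.repr_self, Finsupp.single_eq_same, mul_one]
  rw [Fintype.sum_sigma]
  refine Finset.sum_congr rfl fun χ _ => ?_
  rw [Finset.sum_congr rfl fun y _ => (rfl : f _ = f χ), Finset.sum_const, Finset.card_univ,
    Fintype.card_fin, nsmul_eq_mul]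
  rfl

/-- Root spaces are one-dimensional, and the zero weight drops out because it vanishes at `z`. -/
theorem trace_weightDiag_ad (f : (H → ℂ) → ℂ) (z : H) :
    LinearMap.trace ℂ L (weightDiag H f ∘ₗ (ad ℂ L (z : L) : End ℂ L)) =
      ∑ α : H.root, f α.1 * α.1 z := by
  have h1 : weightDiag H f ∘ₗ (ad ℂ L (z : L) : End ℂ L) = weightDiag H (fun χ => f χ * χ z) :=
    ext_rootSpace (H := H) fun χ v hv => by
      have := lie_eq_smul_of_mem_rootSpace hv z
      rw [LinearMap.comp_apply, ad_apply, ← LieSubalgebra.coe_bracket_of_module, this, map_smul,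
        weightDiag_apply hv, weightDiag_apply hv, smul_smul, mul_comm]
  rw [h1, trace_weightDiag, Finset.sum_coe_sort H.root (fun α => f α * α z)]
  rw [← Finset.sum_subset (Finset.subset_univ H.root)]
  · refine Finset.sum_congr rfl fun χ hχ => ?_
    have hχ' : χ.IsNonZero := by simpa [LieSubalgebra.root] using hχ
    rw [finrank_rootSpace_eq_one χ hχ', Nat.cast_one, one_mul]
  · intro χ _ hχ
    have hχ' : χ.IsZero := by simpa [LieSubalgebra.root] using hχ
    rw [hχ'.eq]; simp

/-- The dimension is the trace of the diagonal projection, which counts one-dimensional root spaces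
once the zero weight is excluded. -/
theorem finrank_weightSum (p : (H → ℂ) → Prop) [DecidablePred p] (hp : ¬ p 0) :
    finrank ℂ (weightSum H p) = Fintype.card {α : H.root // p α.1} := by
  classical
  have hproj : LinearMap.IsProj (weightSum H p)
      (weightDiag H (fun χ => if p χ then 1 else 0) : L →ₗ[ℂ] L) := by
    refine ⟨fun v k hk => ?_, fun v hv => ?_⟩
    · rw [repr_weightDiag, if_neg hk, zero_mul]
    · convert mem_weightSum_iff_weightDiag.mp hv
  have h1 := hproj.trace
  rw [trace_weightDiag] at h1
  have h2 : (finrank ℂ (weightSum H p) : ℂ) = (Fintype.card {α : H.root // p α.1} : ℂ) := by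
    rw [← h1, Fintype.card_subtype, Finset.card_filter, Nat.cast_sum,
      Finset.sum_coe_sort H.root (fun α => ((if p α then 1 else 0 : ℕ) : ℂ)),
      ← Finset.sum_subset (Finset.subset_univ H.root)]
    · refine Finset.sum_congr rfl fun χ hχ => ?_
      have hχ' : χ.IsNonZero := by simpa [LieSubalgebra.root] using hχ
      rw [finrank_rootSpace_eq_one χ hχ', Nat.cast_one, one_mul]
      push_cast; rfl
    · intro χ _ hχ
      have hχ' : χ.IsZero := by simpa [LieSubalgebra.root] using hχ
      rw [hχ'.eq, if_neg hp, mul_zero]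
  exact_mod_cast h2

end Weights

/-! ### Compressed traces as sums over roots -/

section WeightTraces

variable {L : Type*} [LieRing L] [LieAlgebra ℂ L] [Module.Finite ℂ L] [IsKilling ℂ L]
  {H : LieSubalgebra ℂ L} [H.IsCartanSubalgebra] {α : Weight ℂ H L} {x y : L}

/-- The sum `∑ f(β) ⟨β, α⟩` over the roots `β`. -/
def rootSum (f : (H → ℂ) → ℂ) (α : Weight ℂ H L) : ℂ :=
  ∑ β : H.root, f β.1 * β.1 ((cartanEquivDual H).symm (Weight.toLinear ℂ H L α))

theorem trace_weightDiag_ad_lie (f : (H → ℂ) → ℂ) (hx : x ∈ rootSpace H α)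
    (hy : y ∈ rootSpace H (-(α : H → ℂ))) :
    LinearMap.trace ℂ L (weightDiag H f ∘ₗ (ad ℂ L ⁅x, y⁆ : End ℂ L)) =
      killingForm ℂ L x y * rootSum f α := by
  rw [lie_eq_killingForm_smul_of_mem_rootSpace_of_mem_rootSpace_neg hx hy, map_smul,
    LinearMap.comp_smul, map_smul, smul_eq_mul]
  congr 1
  exact trace_weightDiag_ad f _

theorem lie_mem_of_neg {χ : H → ℂ} {v : L} (hy : y ∈ rootSpace H (-(α : H → ℂ)))
    (hv : v ∈ rootSpace H χ) : ⁅y, v⁆ ∈ rootSpace H (χ - α) := by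
  have := lie_mem_genWeightSpace_of_mem_genWeightSpace hy hv
  rwa [neg_add_eq_sub] at this

theorem lie_mem_of_pos {χ : H → ℂ} {v : L} (hx : x ∈ rootSpace H α)
    (hv : v ∈ rootSpace H χ) : ⁅x, v⁆ ∈ rootSpace H (χ + α) := by
  have := lie_mem_genWeightSpace_of_mem_genWeightSpace hx hv
  rwa [add_comm] at this

/-- Where `f ≠ 0` the operator `ad y` vanishes, so `ad y ad x = -ad [x, y]` there, and `[x, y] =
B(x, y) H_α`. -/
theorem trace_weightDiag_ad_ad_of_neg {f : (H → ℂ) → ℂ} (hx : x ∈ rootSpace H α)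
    (hy : y ∈ rootSpace H (-(α : H → ℂ)))
    (hf : ∀ χ : Weight ℂ H L, f χ ≠ 0 → rootSpace H ((χ : H → ℂ) - α) = ⊥) :
    LinearMap.trace ℂ L (weightDiag H f ∘ₗ (ad ℂ L y : End ℂ L) ∘ₗ (ad ℂ L x : End ℂ L)) =
      - (killingForm ℂ L x y * rootSum f α) := by
  rw [← trace_weightDiag_ad_lie f hx hy, ← map_neg]
  congr 1
  refine ext_rootSpace (H := H) fun χ v hv => ?_
  have h1 : ⁅x, ⁅y, v⁆⁆ ∈ rootSpace H (χ : H → ℂ) := by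
    have := lie_mem_of_pos hx (lie_mem_of_neg hy hv)
    rwa [sub_add_cancel] at this
  have h2 : ⁅y, ⁅x, v⁆⁆ ∈ rootSpace H (χ : H → ℂ) := by
    have := lie_mem_of_neg hy (lie_mem_of_pos hx hv)
    rwa [add_sub_cancel_right] at this
  have h3 : f χ • ⁅x, ⁅y, v⁆⁆ = 0 := by
    by_cases h : f χ = 0
    · rw [h, zero_smul]
    · have h4 := lie_mem_of_neg hy hv
      rw [hf χ h, LieSubmodule.mem_bot] at h4
      rw [h4, lie_zero, smul_zero]
  simp only [LinearMap.comp_apply, LinearMap.neg_apply, ad_apply, lie_lie, map_sub]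
  rw [weightDiag_apply h1, weightDiag_apply h2, h3, zero_sub, neg_neg]

theorem trace_weightDiag_ad_ad_eq_zero {f : (H → ℂ) → ℂ} (hx : x ∈ rootSpace H α)
    (hy : y ∈ rootSpace H (-(α : H → ℂ)))
    (hf : ∀ χ : Weight ℂ H L, f χ ≠ 0 → rootSpace H ((χ : H → ℂ) + α) = ⊥) :
    LinearMap.trace ℂ L (weightDiag H f ∘ₗ (ad ℂ L y : End ℂ L) ∘ₗ (ad ℂ L x : End ℂ L)) = 0 := by
  rw [← map_zero (LinearMap.trace ℂ L)]
  congr 1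
  refine ext_rootSpace (H := H) fun χ v hv => ?_
  have h2 : ⁅y, ⁅x, v⁆⁆ ∈ rootSpace H (χ : H → ℂ) := by
    have := lie_mem_of_neg hy (lie_mem_of_pos hx hv)
    rwa [add_sub_cancel_right] at this
  simp only [LinearMap.comp_apply, LinearMap.zero_apply, ad_apply]
  rw [weightDiag_apply h2]
  by_cases h : f χ = 0
  · rw [h, zero_smul]
  · have h4 := lie_mem_of_pos hx hv
    rw [hf χ h, LieSubmodule.mem_bot] at h4
    rw [h4, lie_zero, smul_zero]

/-- Moving the diagonal operator past `ad y` shifts `f` by `α`, and cyclicity of the trace then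
reverses the order to `ad x ad y`. On the shifted support `ad x` vanishes, which leaves `ad [x, y]`.
The shift is why `f` is defined on all functionals and not only on weights. -/
theorem trace_weightDiag_ad_ad_of_pos {f : (H → ℂ) → ℂ} (hx : x ∈ rootSpace H α)
    (hy : y ∈ rootSpace H (-(α : H → ℂ)))
    (hf : ∀ χ : Weight ℂ H L, f (χ - α) ≠ 0 → rootSpace H ((χ : H → ℂ) + α) = ⊥) :
    LinearMap.trace ℂ L (weightDiag H f ∘ₗ (ad ℂ L y : End ℂ L) ∘ₗ (ad ℂ L x : End ℂ L)) =
      killingForm ℂ L x y * rootSum (fun χ => f (χ - (α : H → ℂ))) α := by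
  have h1 : weightDiag H f ∘ₗ (ad ℂ L y : End ℂ L) =
      (ad ℂ L y : End ℂ L) ∘ₗ weightDiag H fun χ => f (χ - (α : H → ℂ)) :=
    ext_rootSpace (H := H) fun χ v hv => by
      rw [LinearMap.comp_apply, LinearMap.comp_apply, weightDiag_apply hv, map_smul, ad_apply,
        weightDiag_apply (lie_mem_of_neg hy hv)]
  rw [← LinearMap.comp_assoc, h1, LinearMap.comp_assoc, LinearMap.trace_comp_comm',
    LinearMap.comp_assoc, ← trace_weightDiag_ad_lie _ hx hy]
  congr 1
  refine ext_rootSpace (H := H) fun χ v hv => ?_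
  have h1 : ⁅x, ⁅y, v⁆⁆ ∈ rootSpace H (χ : H → ℂ) := by
    have := lie_mem_of_pos hx (lie_mem_of_neg hy hv)
    rwa [sub_add_cancel] at this
  have h2 : ⁅y, ⁅x, v⁆⁆ ∈ rootSpace H (χ : H → ℂ) := by
    have := lie_mem_of_neg hy (lie_mem_of_pos hx hv)
    rwa [add_sub_cancel_right] at this
  have h3 : f (χ - α) • ⁅y, ⁅x, v⁆⁆ = 0 := by
    by_cases h : f (χ - α) = 0
    · rw [h, zero_smul]
    · have h4 := lie_mem_of_pos hx hv
      rw [hf χ h, LieSubmodule.mem_bot] at h4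
      rw [h4, lie_zero, smul_zero]
  simp only [LinearMap.comp_apply, ad_apply, lie_lie, map_sub]
  rw [weightDiag_apply h1, weightDiag_apply h2, h3, sub_zero]

/-- `tr (P ∘ ad y ∘ P ∘ ad x)` for the operator `P` with eigenvalues `f`. -/
def compressedTrace (f : (H → ℂ) → ℂ) : L →ₗ[ℂ] L →ₗ[ℂ] ℂ :=
  LinearMap.mk₂ ℂ (fun x y => LinearMap.trace ℂ L (weightDiag H f ∘ₗ (ad ℂ L y : End ℂ L) ∘ₗ
      weightDiag H f ∘ₗ (ad ℂ L x : End ℂ L)))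
    (fun x x' y => by rw [← map_add]; congr 1; ext v; simp)
    (fun c x y => by rw [← map_smul]; congr 1; ext v; simp)
    (fun x y y' => by rw [← map_add]; congr 1; ext v; simp)
    (fun c x y => by rw [← map_smul]; congr 1; ext v; simp)

/-- `ad y ad x` preserves each weight space, so the two diagonal operators act by scalars, one at
`χ` and one at `χ + α`. -/
theorem compressedTrace_eq {f k : (H → ℂ) → ℂ} (hx : x ∈ rootSpace H α)
    (hy : y ∈ rootSpace H (-(α : H → ℂ))) (hk : ∀ χ : Weight ℂ H L, f χ * f (χ + α) = k χ) :
    compressedTrace f x y =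
      LinearMap.trace ℂ L (weightDiag H k ∘ₗ (ad ℂ L y : End ℂ L) ∘ₗ (ad ℂ L x : End ℂ L)) := by
  rw [compressedTrace, LinearMap.mk₂_apply]
  congr 1
  refine ext_rootSpace (H := H) fun χ v hv => ?_
  have h2 : ⁅y, ⁅x, v⁆⁆ ∈ rootSpace H (χ : H → ℂ) := by
    have := lie_mem_of_neg hy (lie_mem_of_pos hx hv)
    rwa [add_sub_cancel_right] at this
  simp only [LinearMap.comp_apply, ad_apply]
  rw [weightDiag_apply (lie_mem_of_pos hx hv), lie_smul, map_smul, weightDiag_apply h2,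
    weightDiag_apply h2, smul_smul, ← hk, mul_comm]

/-- If `tr (P ∘ ad y ∘ P ∘ ad x) = c B(x, y)` for `x`, `y` in opposite root spaces, then this holds
for all `y`. -/
theorem compressedTrace_eq_killingForm {f : (H → ℂ) → ℂ} {c : ℂ} (hx : x ∈ rootSpace H α)
    (h : ∀ y ∈ rootSpace H (-(α : H → ℂ)), compressedTrace f x y = c * killingForm ℂ L x y)
    (y : L) : compressedTrace f x y = c * killingForm ℂ L x y := by
  have : compressedTrace f x = c • killingForm ℂ L x := by
    refine ext_rootSpace (H := H) fun χ v hv => ?_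
    by_cases hχ : (χ : H → ℂ) = -α
    · rw [hχ] at hv
      exact h v hv
    · have h0 : (α : H → ℂ) + χ ≠ 0 := fun h0 => hχ (eq_neg_of_add_eq_zero_right h0)
      rw [LinearMap.smul_apply, killingForm_apply_eq_zero_of_mem_rootSpace_of_add_ne_zero ℂ L H hx hv h0,
        smul_zero, compressedTrace, LinearMap.mk₂_apply]
      -- The whole composite shifts weights by `α + χ ≠ 0`, so the trace vanishes together with the
      -- Killing form.
      refine trace_weightDiag_comp_eq_zero (γ := (α : H → ℂ) + χ) f h0 fun ψ w hw => ?_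
      have h1 := lie_mem_of_pos hx hw
      have h2 : ⁅v, ⁅x, w⁆⁆ ∈ rootSpace H (ψ + (α + χ : H → ℂ)) := by
        have := lie_mem_genWeightSpace_of_mem_genWeightSpace hv h1
        rwa [show (χ : H → ℂ) + (ψ + α) = ψ + (α + χ) by abel] at this
      simp only [LinearMap.comp_apply, ad_apply]
      rw [weightDiag_apply h1, lie_smul]
      exact Submodule.smul_mem _ _ h2
  rw [this]; rfl

/-! ### Gradings -/

open Classical in
/-- `0` on `3ℤ` and `1` elsewhere. -/
def notThree (z : ℂ) : ℂ := if ∃ k : ℤ, z = 3 * k then 0 else 1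

theorem notThree_intCast (n : ℤ) : notThree n = if (3 : ℤ) ∣ n then 0 else 1 := by
  classical
  unfold notThree
  congr 1
  simp only [eq_iff_iff]
  exact exists_congr fun k => by norm_cast

open Classical in
/-- The indicator function of a predicate. -/
def ind (p : (H → ℂ) → Prop) (χ : H → ℂ) : ℂ := if p χ then 1 else 0

/-- The weights take integral values of absolute value at most two at `h`. -/
def IsGrading (h : H) : Prop := ∀ χ : Weight ℂ H L, ∃ n : ℤ, χ h = n ∧ -2 ≤ n ∧ n ≤ 2

theorem IsGrading.rootSpace_eq_bot {h : H} (hh : IsGrading h) {ψ : H → ℂ} {n : ℤ}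
    (hn : ψ h = n) (h2 : n < -2 ∨ 2 < n) : rootSpace H ψ = ⊥ :=
  ThreeSymmetric.rootSpace_eq_bot fun χ hχ => by
    obtain ⟨m, hm, h3, h4⟩ := hh χ
    rw [hχ, hn] at hm
    have : n = m := by exact_mod_cast hm
    omega

theorem rootSum_neg (f : (H → ℂ) → ℂ) (α : Weight ℂ H L) :
    rootSum (fun χ => f (-χ)) α = - rootSum f α := by
  let e : H.root ≃ H.root :=
    { toFun := fun β => ⟨-β.1, by have := β.2; simp only [LieSubalgebra.root, Finset.mem_filter,
        Finset.mem_univ, true_and] at this ⊢; exact this.neg⟩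
      invFun := fun β => ⟨-β.1, by have := β.2; simp only [LieSubalgebra.root, Finset.mem_filter,
        Finset.mem_univ, true_and] at this ⊢; exact this.neg⟩
      left_inv := fun β => by simp
      right_inv := fun β => by simp }
  rw [rootSum, rootSum, ← Finset.sum_neg_distrib]
  refine Fintype.sum_equiv e _ _ fun β => ?_
  simp [e]

theorem ind_ne_zero {p : (H → ℂ) → Prop} {χ : H → ℂ} (h : ind p χ ≠ 0) : p χ := by
  by_contra hp
  exact h (if_neg hp)

theorem ind_congr {p q : (H → ℂ) → Prop} {χ ψ : H → ℂ} (h : p χ ↔ q ψ) : ind p χ = ind q ψ := by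
  by_cases hp : p χ
  · rw [ind, ind, if_pos hp, if_pos (h.mp hp)]
  · rw [ind, ind, if_neg hp, if_neg (mt h.mpr hp)]

theorem rootSum_congr {f f' : (H → ℂ) → ℂ} (h : ∀ χ, f χ = f' χ) (α : Weight ℂ H L) :
    rootSum f α = rootSum f' α := by
  rw [show f = f' from funext h]

/-- Grade `n` contributes when `3` divides neither `n` nor `n + 1`, that is for `n = 1` and `n =
-2`. For `n = 1` the cyclic shift leads to grade `2`, where `ad x` vanishes; on grade `-2` already
`ad y` vanishes. Both parts equal the sum over grade `2`, hence the factor `2`. -/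
theorem compressedTrace_of_grading_one {h : H} (hh : IsGrading (L := L) h) (hα : α h = 1)
    (hx : x ∈ rootSpace H α) (hy : y ∈ rootSpace H (-(α : H → ℂ))) :
    compressedTrace (fun χ => notThree (χ h)) x y =
      2 * rootSum (ind fun χ => χ h = 2) α * killingForm ℂ L x y := by
  rw [compressedTrace_eq (k := (ind fun χ => χ h = 1) + ind fun χ => χ h = -2) hx hy,
    weightDiag_add, LinearMap.add_comp, map_add, trace_weightDiag_ad_ad_of_pos hx hy,
    trace_weightDiag_ad_ad_of_neg hx hy]
  · rw [rootSum_congr (f' := fun χ => ind (fun χ => χ h = 2) (-χ)) (f := ind fun χ => χ h = -2),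
      rootSum_neg, rootSum_congr (f' := ind fun χ => χ h = 2)]
    · ring
    · intro χ
      simp only [ind, Pi.sub_apply, hα]
      congr 1
      simp only [eq_iff_iff]
      constructor <;> intro h <;> linear_combination h
    · intro χ
      simp only [ind, Pi.neg_apply, neg_eq_iff_eq_neg]
  · intro χ hχ
    refine hh.rootSpace_eq_bot (n := -3) ?_ (by norm_num)
    rw [Pi.sub_apply, ind_ne_zero hχ, hα]; norm_num
  · intro χ hχ
    refine hh.rootSpace_eq_bot (n := 3) ?_ (by norm_num)
    have := ind_ne_zero hχ
    rw [Pi.sub_apply, hα] at this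
    rw [Pi.add_apply, hα]; push_cast; linear_combination this
  · intro χ
    obtain ⟨n, hn, h1, h2⟩ := hh χ
    have e1 : notThree (χ h) = if (3 : ℤ) ∣ n then 0 else 1 := by rw [hn, notThree_intCast]
    have e2 : notThree (((χ : H → ℂ) + α) h) = if (3 : ℤ) ∣ (n + 1) then 0 else 1 := by
      rw [← notThree_intCast, Pi.add_apply, hn, hα]; push_cast; rfl
    rw [e1, e2]
    simp only [ind, Pi.add_apply, hn]
    clear hn e1 e2
    interval_cases n <;> norm_num

/-- Here `3` must divide neither `n` nor `n + 2`, which leaves `n = 2` and `n = -1`. The first gives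
zero since there is no grade `4`; on the second `ad y` would lead to grade `-3`, so `ad y` vanishes.
-/
theorem compressedTrace_of_grading_two {h : H} (hh : IsGrading (L := L) h) (hα : α h = 2)
    (hx : x ∈ rootSpace H α) (hy : y ∈ rootSpace H (-(α : H → ℂ))) :
    compressedTrace (fun χ => notThree (χ h)) x y =
      rootSum (ind fun χ => χ h = 1) α * killingForm ℂ L x y := by
  rw [compressedTrace_eq (k := (ind fun χ => χ h = 2) + ind fun χ => χ h = -1) hx hy,
    weightDiag_add, LinearMap.add_comp, map_add, trace_weightDiag_ad_ad_eq_zero hx hy,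
    trace_weightDiag_ad_ad_of_neg hx hy]
  · rw [rootSum_congr (f' := fun χ => ind (fun χ => χ h = 1) (-χ)) (f := ind fun χ => χ h = -1),
      rootSum_neg]
    · ring
    · intro χ
      simp only [ind, Pi.neg_apply, neg_eq_iff_eq_neg]
  · intro χ hχ
    refine hh.rootSpace_eq_bot (n := -3) ?_ (by norm_num)
    rw [Pi.sub_apply, ind_ne_zero hχ, hα]; norm_num
  · intro χ hχ
    refine hh.rootSpace_eq_bot (n := 4) ?_ (by norm_num)
    rw [Pi.add_apply, ind_ne_zero hχ, hα]; norm_num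
  · intro χ
    obtain ⟨n, hn, h1, h2⟩ := hh χ
    have e1 : notThree (χ h) = if (3 : ℤ) ∣ n then 0 else 1 := by rw [hn, notThree_intCast]
    have e2 : notThree (((χ : H → ℂ) + α) h) = if (3 : ℤ) ∣ (n + 2) then 0 else 1 := by
      rw [← notThree_intCast, Pi.add_apply, hn, hα]; push_cast; rfl
    rw [e1, e2]
    simp only [ind, Pi.add_apply, hn]
    clear hn e1 e2
    interval_cases n <;> norm_num

/-- The weights take values in `{0, ±(1, 0), ±(0, 1), ±(1, 1)}` at `(h, h')`. -/
def IsBigrading (h h' : H) : Prop :=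
  ∀ χ : Weight ℂ H L, ∃ m n : ℤ, χ h = m ∧ χ h' = n ∧ -1 ≤ m ∧ m ≤ 1 ∧ -1 ≤ n ∧ n ≤ 1 ∧
    -1 ≤ m - n ∧ m - n ≤ 1

theorem IsBigrading.swap {h h' : H} (hh : IsBigrading (L := L) h h') :
    IsBigrading (L := L) h' h := fun χ => by
  obtain ⟨m, n, hm, hn, h1, h2, h3, h4, h5, h6⟩ := hh χ
  exact ⟨n, m, hn, hm, h3, h4, h1, h2, by omega, by omega⟩

theorem IsBigrading.rootSpace_eq_bot {h h' : H} (hh : IsBigrading (L := L) h h') {ψ : H → ℂ}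
    {m n : ℤ} (hm : ψ h = m) (hn : ψ h' = n)
    (h2 : m < -1 ∨ 1 < m ∨ n < -1 ∨ 1 < n ∨ m - n < -1 ∨ 1 < m - n) : rootSpace H ψ = ⊥ :=
  ThreeSymmetric.rootSpace_eq_bot fun χ hχ => by
    obtain ⟨m', n', hm', hn', h⟩ := hh χ
    rw [hχ, hm] at hm'
    rw [hχ, hn] at hn'
    have : m = m' := by exact_mod_cast hm'
    have : n = n' := by exact_mod_cast hn'
    omega

/-- The contributing bidegrees are `(1, 0)`, `(0, 1)` and `(-1, -1)`. The first gives zero because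
`(2, 0)` is empty. The other two each give the sum over bidegree `(1, 1)`, one after the cyclic
shift and one after a change of sign. -/
theorem compressedTrace_of_bigrading_one {h h' : H} (hh : IsBigrading (L := L) h h')
    (hα : α h = 1) (hα' : α h' = 0)
    (hx : x ∈ rootSpace H α) (hy : y ∈ rootSpace H (-(α : H → ℂ))) :
    compressedTrace (fun χ => notThree (χ h + χ h')) x y =
      2 * rootSum (ind fun χ => χ h = 1 ∧ χ h' = 1) α * killingForm ℂ L x y := by
  rw [compressedTrace_eq (k := (ind fun χ => χ h = 1 ∧ χ h' = 0) +
      ((ind fun χ => χ h = 0 ∧ χ h' = 1) + ind fun χ => χ h = -1 ∧ χ h' = -1)) hx hy,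
    weightDiag_add, weightDiag_add, LinearMap.add_comp, LinearMap.add_comp, map_add, map_add,
    trace_weightDiag_ad_ad_eq_zero hx hy, trace_weightDiag_ad_ad_of_pos hx hy,
    trace_weightDiag_ad_ad_of_neg hx hy]
  · rw [rootSum_congr (f' := fun χ => ind (fun χ => χ h = 1 ∧ χ h' = 1) (-χ))
      (f := ind fun χ => χ h = -1 ∧ χ h' = -1),
      rootSum_neg, rootSum_congr (f' := ind fun χ => χ h = 1 ∧ χ h' = 1)]
    · ring
    · intro χ
      refine ind_congr ?_
      simp only [Pi.sub_apply, hα, hα', sub_zero, sub_eq_zero]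
    · intro χ
      refine ind_congr ?_
      simp only [Pi.neg_apply, neg_eq_iff_eq_neg]
  · intro χ hχ
    have := ind_ne_zero hχ
    refine hh.rootSpace_eq_bot (m := -2) (n := -1) ?_ ?_ (by norm_num)
    · rw [Pi.sub_apply, this.1, hα]; norm_num
    · rw [Pi.sub_apply, this.2, hα']; norm_num
  · intro χ hχ
    have := ind_ne_zero hχ
    rw [Pi.sub_apply, hα, Pi.sub_apply, hα'] at this
    refine hh.rootSpace_eq_bot (m := 2) (n := 1) ?_ ?_ (by norm_num)
    · rw [Pi.add_apply, hα]; push_cast; linear_combination this.1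
    · rw [Pi.add_apply, hα']; push_cast; linear_combination this.2
  · intro χ hχ
    have := ind_ne_zero hχ
    refine hh.rootSpace_eq_bot (m := 2) (n := 0) ?_ ?_ (by norm_num)
    · rw [Pi.add_apply, this.1, hα]; norm_num
    · rw [Pi.add_apply, this.2, hα']; norm_num
  · intro χ
    obtain ⟨m, n, hm, hn, h1, h2, h3, h4, h5, h6⟩ := hh χ
    have e1 : notThree (χ h + χ h') = if (3 : ℤ) ∣ m + n then 0 else 1 := by
      rw [hm, hn, ← notThree_intCast, Int.cast_add]
    have e2 : notThree (((χ : H → ℂ) + α) h + ((χ : H → ℂ) + α) h') =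
        if (3 : ℤ) ∣ (m + n + 1) then 0 else 1 := by
      rw [← notThree_intCast, Pi.add_apply, Pi.add_apply, hm, hn, hα, hα']
      congr 1; push_cast; ring
    rw [e1, e2]
    simp only [ind, Pi.add_apply, hm, hn]
    clear hm hn e1 e2
    interval_cases m <;> interval_cases n <;> first | omega | norm_num

/-- The contributing bidegrees are `(1, 1)`, which `ad x` kills, and `(-1, 0)`, `(0, -1)`, which `ad
y` kills. -/
theorem compressedTrace_of_bigrading_two {h h' : H} (hh : IsBigrading (L := L) h h')
    (hα : α h = 1) (hα' : α h' = 1)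
    (hx : x ∈ rootSpace H α) (hy : y ∈ rootSpace H (-(α : H → ℂ))) :
    compressedTrace (fun χ => notThree (χ h + χ h')) x y =
      (rootSum (ind fun χ => χ h = 1 ∧ χ h' = 0) α + rootSum (ind fun χ => χ h = 0 ∧ χ h' = 1) α) *
        killingForm ℂ L x y := by
  rw [compressedTrace_eq (k := (ind fun χ => χ h = 1 ∧ χ h' = 1) +
      ((ind fun χ => χ h = -1 ∧ χ h' = 0) + ind fun χ => χ h = 0 ∧ χ h' = -1)) hx hy,
    weightDiag_add, weightDiag_add, LinearMap.add_comp, LinearMap.add_comp, map_add, map_add,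
    trace_weightDiag_ad_ad_eq_zero hx hy, trace_weightDiag_ad_ad_of_neg hx hy,
    trace_weightDiag_ad_ad_of_neg hx hy]
  · rw [rootSum_congr (f' := fun χ => ind (fun χ => χ h = 1 ∧ χ h' = 0) (-χ))
      (f := ind fun χ => χ h = -1 ∧ χ h' = 0),
      rootSum_neg, rootSum_congr (f' := fun χ => ind (fun χ => χ h = 0 ∧ χ h' = 1) (-χ))
      (f := ind fun χ => χ h = 0 ∧ χ h' = -1), rootSum_neg]
    · ring
    · intro χ
      refine ind_congr ?_
      simp only [Pi.neg_apply, neg_eq_iff_eq_neg, neg_zero]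
    · intro χ
      refine ind_congr ?_
      simp only [Pi.neg_apply, neg_eq_iff_eq_neg, neg_zero]
  · intro χ hχ
    have := ind_ne_zero hχ
    refine hh.rootSpace_eq_bot (m := -1) (n := -2) ?_ ?_ (by norm_num)
    · rw [Pi.sub_apply, this.1, hα]; norm_num
    · rw [Pi.sub_apply, this.2, hα']; norm_num
  · intro χ hχ
    have := ind_ne_zero hχ
    refine hh.rootSpace_eq_bot (m := -2) (n := -1) ?_ ?_ (by norm_num)
    · rw [Pi.sub_apply, this.1, hα]; norm_num
    · rw [Pi.sub_apply, this.2, hα']; norm_num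
  · intro χ hχ
    have := ind_ne_zero hχ
    refine hh.rootSpace_eq_bot (m := 2) (n := 2) ?_ ?_ (by norm_num)
    · rw [Pi.add_apply, this.1, hα]; norm_num
    · rw [Pi.add_apply, this.2, hα']; norm_num
  · intro χ
    obtain ⟨m, n, hm, hn, h1, h2, h3, h4, h5, h6⟩ := hh χ
    have e1 : notThree (χ h + χ h') = if (3 : ℤ) ∣ m + n then 0 else 1 := by
      rw [hm, hn, ← notThree_intCast, Int.cast_add]
    have e2 : notThree (((χ : H → ℂ) + α) h + ((χ : H → ℂ) + α) h') =
        if (3 : ℤ) ∣ (m + n + 2) then 0 else 1 := by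
      rw [← notThree_intCast, Pi.add_apply, Pi.add_apply, hm, hn, hα, hα']
      congr 1; push_cast; ring
    rw [e1, e2]
    simp only [ind, Pi.add_apply, hm, hn]
    clear hm hn e1 e2
    interval_cases m <;> interval_cases n <;> first | omega | norm_num

end WeightTraces

/-! ### Complexification -/

-- Applying a matrix to the fixed vector `w` is linear on a finite-dimensional space, hence
-- continuous, and so it carries the exponential series of `A` to that of `c`. The real matrix is
-- extended entrywise because its eigenvectors are complex.
open scoped Matrix.Norms.Operator in
theorem exp_map_mulVec {ι : Type*} [Fintype ι] [DecidableEq ι] (A : Matrix ι ι ℝ) {w : ι → ℂ}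
    {c : ℂ} (h : A.map (algebraMap ℝ ℂ) *ᵥ w = c • w) :
    (NormedSpace.exp A).map (algebraMap ℝ ℂ) *ᵥ w = Complex.exp c • w := by
  let φ : Matrix ι ι ℝ →ₗ[ℝ] ι → ℂ :=
    { toFun := fun M => M.map (algebraMap ℝ ℂ) *ᵥ w
      map_add' := fun M N => by rw [Matrix.map_add _ (map_add _), Matrix.add_mulVec]
      map_smul' := fun r M => by
        ext i
        simp [Matrix.mulVec, dotProduct, Finset.mul_sum, mul_assoc] }
  have hpow (n : ℕ) : φ (A ^ n) = c ^ n • w := by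
    induction n with
    | zero => simp [φ]
    | succ n ih =>
      change (A ^ (n + 1)).map (algebraMap ℝ ℂ) *ᵥ w = _
      rw [pow_succ, Matrix.map_mul, ← Matrix.mulVec_mulVec, h, Matrix.mulVec_smul]
      change c • φ (A ^ n) = _
      rw [ih, smul_smul, pow_succ']
  have h1 := (NormedSpace.exp_series_hasSum_exp' (𝕂 := ℝ) A).map φ
    (LinearMap.continuous_of_finiteDimensional φ)
  have h2 : HasSum (fun n : ℕ => (((n.factorial : ℂ)⁻¹) * c ^ n) • w) (Complex.exp c • w) := by
    have := NormedSpace.exp_series_hasSum_exp' (𝕂 := ℂ) c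
    rw [← Complex.exp_eq_exp_ℂ] at this
    exact this.smul_const w
  refine h1.unique ?_
  convert h2 using 1
  ext1 n
  simp only [Function.comp_apply, map_smul, hpow]
  rw [mul_smul]
  ext i
  simp

section Real

variable {g : Type*} [LieRing g] [LieAlgebra ℝ g]

/-- The real part of a vector of the complexification. -/
def rePart : ℂ ⊗[ℝ] g →ₗ[ℝ] g :=
  (TensorProduct.lid ℝ g).toLinearMap ∘ₗ LinearMap.rTensor g Complex.reLm

/-- The complex conjugation of the complexification. -/
def conjMap : ℂ ⊗[ℝ] g →ₗ[ℝ] ℂ ⊗[ℝ] g := LinearMap.rTensor g Complex.conjAe.toLinearMap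

@[simp] theorem rePart_tmul (z : ℂ) (x : g) : rePart (z ⊗ₜ[ℝ] x) = z.re • x := by
  simp [rePart]

@[simp] theorem conjMap_tmul (z : ℂ) (x : g) :
    conjMap (z ⊗ₜ[ℝ] x) = (starRingEnd ℂ z) ⊗ₜ[ℝ] x := by
  simp [conjMap]

theorem one_tmul_rePart (v : ℂ ⊗[ℝ] g) :
    (1 : ℂ) ⊗ₜ[ℝ] rePart v = (2⁻¹ : ℂ) • (v + conjMap v) := by
  induction v with
  | zero => simp
  | tmul z x =>
    rw [rePart_tmul, conjMap_tmul, ← TensorProduct.add_tmul, Complex.add_conj,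
      TensorProduct.tmul_smul, TensorProduct.smul_tmul', TensorProduct.smul_tmul']
    congr 1
    simp
  | add v w hv hw =>
    rw [map_add, TensorProduct.tmul_add, hv, hw, map_add]
    module

theorem eq_rePart_add (v : ℂ ⊗[ℝ] g) :
    v = (1 : ℂ) ⊗ₜ[ℝ] rePart v + Complex.I • (1 : ℂ) ⊗ₜ[ℝ] rePart (-Complex.I • v) := by
  induction v with
  | zero => simp
  | tmul z x =>
    rw [TensorProduct.smul_tmul', TensorProduct.smul_tmul', rePart_tmul, rePart_tmul,
      TensorProduct.tmul_smul, TensorProduct.tmul_smul, TensorProduct.smul_tmul',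
      TensorProduct.smul_tmul', ← TensorProduct.add_tmul]
    congr 1
    apply Complex.ext <;> simp
  | add v w hv hw =>
    conv_lhs => rw [hv, hw]
    rw [map_add, smul_add, map_add, TensorProduct.tmul_add, TensorProduct.tmul_add, smul_add]
    abel

theorem conjMap_smul (c : ℂ) (v : ℂ ⊗[ℝ] g) :
    conjMap (c • v) = (starRingEnd ℂ c) • conjMap v := by
  induction v with
  | zero => simp
  | tmul z x => simp [TensorProduct.smul_tmul']
  | add v w hv hw => rw [smul_add, map_add, hv, hw, map_add, smul_add]

theorem conjMap_ad_one_tmul (x : g) (v : ℂ ⊗[ℝ] g) :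
    conjMap (ad ℂ (ℂ ⊗[ℝ] g) ((1 : ℂ) ⊗ₜ[ℝ] x) v) =
      ad ℂ (ℂ ⊗[ℝ] g) ((1 : ℂ) ⊗ₜ[ℝ] x) (conjMap v) := by
  induction v with
  | zero => simp
  | tmul z y => simp
  | add v w hv hw => rw [map_add, map_add, hv, hw, map_add, map_add]

theorem one_tmul_injective : Function.Injective fun x : g => (1 : ℂ) ⊗ₜ[ℝ] x := fun x y h => by
  have := congrArg rePart h
  simpa using this

variable [Module.Finite ℝ g]

theorem killingForm_one_tmul (x y : g) :
    killingForm ℂ (ℂ ⊗[ℝ] g) ((1 : ℂ) ⊗ₜ[ℝ] x) ((1 : ℂ) ⊗ₜ[ℝ] y) = (killingForm ℝ g x y : ℂ) := by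
  have e : killingForm ℂ (ℂ ⊗[ℝ] g) = (killingForm ℝ g).baseChange ℂ :=
    LieModule.traceForm_baseChange (R := ℝ) (L := g) (M := g) ℂ
  rw [e]
  simp

/-- `B(v, v̄)` is a negative real number for `v ≠ 0`. -/
theorem killingForm_conjMap_ne_zero [IsCompactSimple g] {v : ℂ ⊗[ℝ] g} (hv : v ≠ 0) :
    killingForm ℂ (ℂ ⊗[ℝ] g) v (conjMap v) ≠ 0 := by
  set a := rePart v
  set b := rePart (-Complex.I • v)
  have h1 : v = (1 : ℂ) ⊗ₜ[ℝ] a + Complex.I • (1 : ℂ) ⊗ₜ[ℝ] b := eq_rePart_add v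
  have h2 : conjMap v = (1 : ℂ) ⊗ₜ[ℝ] a - Complex.I • (1 : ℂ) ⊗ₜ[ℝ] b := by
    rw [h1, map_add, conjMap_smul]
    simp [sub_eq_add_neg]
  have h3 : killingForm ℂ (ℂ ⊗[ℝ] g) v (conjMap v) =
      ((killingForm ℝ g a a + killingForm ℝ g b b : ℝ) : ℂ) := by
    rw [h2, h1]
    simp only [map_add, map_sub, map_smul, LinearMap.add_apply, LinearMap.smul_apply,
      killingForm_one_tmul, smul_eq_mul, LieModule.traceForm_comm ℝ g g b a]
    push_cast
    linear_combination (-(killingForm ℝ g b b : ℂ)) * Complex.I_mul_I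
  rw [h3]
  have hle (x : g) : killingForm ℝ g x x ≤ 0 := by
    by_cases hx : x = 0
    · simp [hx]
    · exact (IsCompactSimple.killing_neg x hx).le
  have hab : a ≠ 0 ∨ b ≠ 0 := by
    by_contra! h
    rw [h.1, h.2] at h1
    exact hv (by simpa using h1)
  have : killingForm ℝ g a a + killingForm ℝ g b b < 0 := by
    rcases hab with h | h
    · linarith [hle b, IsCompactSimple.killing_neg a h]
    · linarith [hle a, IsCompactSimple.killing_neg b h]
  exact_mod_cast this.ne

theorem trace_compressed_ofReal (P : g →ₗ[ℝ] g) (x y : g) :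
    ((LinearMap.trace ℝ g (P ∘ₗ LieAlgebra.ad ℝ g y ∘ₗ P ∘ₗ LieAlgebra.ad ℝ g x) : ℝ) : ℂ) =
      LinearMap.trace ℂ (ℂ ⊗[ℝ] g) (P.baseChange ℂ ∘ₗ
        (ad ℂ (ℂ ⊗[ℝ] g) ((1 : ℂ) ⊗ₜ[ℝ] y) : End ℂ (ℂ ⊗[ℝ] g)) ∘ₗ P.baseChange ℂ ∘ₗ
        (ad ℂ (ℂ ⊗[ℝ] g) ((1 : ℂ) ⊗ₜ[ℝ] x) : End ℂ (ℂ ⊗[ℝ] g))) := by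
  have had (x : g) : (ad ℂ (ℂ ⊗[ℝ] g) ((1 : ℂ) ⊗ₜ[ℝ] x) : End ℂ (ℂ ⊗[ℝ] g)) =
      LinearMap.baseChange ℂ (ad ℝ g x : g →ₗ[ℝ] g) :=
    LieModule.toEnd_baseChange (R := ℝ) (L := g) (M := g) ℂ x
  rw [had, had, ← LinearMap.baseChange_comp, ← LinearMap.baseChange_comp,
    ← LinearMap.baseChange_comp, LinearMap.trace_baseChange]
  rfl

theorem adExp_baseChange_apply {X : g} {v : ℂ ⊗[ℝ] g} {c : ℂ}
    (h : ad ℂ (ℂ ⊗[ℝ] g) ((1 : ℂ) ⊗ₜ[ℝ] X) v = c • v) :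
    (adExp X).baseChange ℂ v = Complex.exp c • v := by
  set b := Module.finBasis ℝ g
  have had : LinearMap.toMatrix (Algebra.TensorProduct.basis ℂ b) (Algebra.TensorProduct.basis ℂ b)
      (LinearMap.baseChange ℂ (ad ℝ g X : g →ₗ[ℝ] g)) =
      (LinearMap.toMatrix b b (ad ℝ g X)).map (algebraMap ℝ ℂ) :=
    LinearMap.toMatrix_baseChange ℂ _ b b
  have hexp : LinearMap.toMatrix (Algebra.TensorProduct.basis ℂ b) (Algebra.TensorProduct.basis ℂ b)
      (LinearMap.baseChange ℂ (adExp X)) =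
      (NormedSpace.exp (LinearMap.toMatrix b b (ad ℝ g X))).map (algebraMap ℝ ℂ) := by
    rw [LinearMap.toMatrix_baseChange, adExp, LinearMap.toMatrix_toLin]
  apply (Algebra.TensorProduct.basis ℂ b).repr.injective
  rw [← DFunLike.coe_fn_eq, ← LinearMap.toMatrix_mulVec_repr (Algebra.TensorProduct.basis ℂ b) (Algebra.TensorProduct.basis ℂ b),
    hexp, map_smul, Finsupp.coe_smul]
  apply exp_map_mulVec
  rw [← had, LinearMap.toMatrix_mulVec_repr, ← Finsupp.coe_smul, ← map_smul, ← h]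
  congr 1
  congr 1
  exact (LinearMap.congr_fun (LieModule.toEnd_baseChange (R := ℝ) (L := g) (M := g) ℂ X) v).symm

end Real

namespace RootFrame

variable {g : Type*} [LieRing g] [LieAlgebra ℝ g] [Module.Finite ℝ g] [IsCompactSimple g]
  {n : ℕ} (F : RootFrame g n)

/-! ### The compact real form -/

theorem one_tmul_mem {X : g} (hX : X ∈ F.t) : (1 : ℂ) ⊗ₜ[ℝ] X ∈ F.H := by
  have : (1 : ℂ) ⊗ₜ[ℝ] X ∈ F.H.toSubmodule := by
    rw [F.H_eq]; exact Submodule.tmul_mem_baseChange_of_mem _ hX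
  exact this

theorem ad_apply_of_mem {ψ : F.H → ℂ} {v : ℂ ⊗[ℝ] g} (hv : v ∈ rootSpace F.H ψ) (h : F.H) :
    ad ℂ (ℂ ⊗[ℝ] g) (h : ℂ ⊗[ℝ] g) v = ψ h • v :=
  lie_eq_smul_of_mem_rootSpace hv h

/-- The weights are purely imaginary on `t`. -/
theorem weight_conj (χ : Weight ℂ F.H (ℂ ⊗[ℝ] g)) {X : g} (hX : X ∈ F.t) :
    starRingEnd ℂ (χ ⟨_, F.one_tmul_mem hX⟩) = - χ ⟨_, F.one_tmul_mem hX⟩ := by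
  obtain ⟨v, hv, hv0⟩ := χ.exists_ne_zero
  set c := χ ⟨_, F.one_tmul_mem hX⟩
  have h1 : ad ℂ (ℂ ⊗[ℝ] g) ((1 : ℂ) ⊗ₜ[ℝ] X) v = c • v := F.ad_apply_of_mem hv ⟨_, F.one_tmul_mem hX⟩
  have h2 : ad ℂ (ℂ ⊗[ℝ] g) ((1 : ℂ) ⊗ₜ[ℝ] X) (conjMap v) = (starRingEnd ℂ c) • conjMap v := by
    rw [← conjMap_ad_one_tmul, h1, conjMap_smul]
  have h3 : killingForm ℂ (ℂ ⊗[ℝ] g) (ad ℂ (ℂ ⊗[ℝ] g) ((1 : ℂ) ⊗ₜ[ℝ] X) v) (conjMap v) =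
      - killingForm ℂ (ℂ ⊗[ℝ] g) v (ad ℂ (ℂ ⊗[ℝ] g) ((1 : ℂ) ⊗ₜ[ℝ] X) (conjMap v)) := by
    -- `ad X` is real and skew for the Killing form. Moving it across the definite hermitian pairing
    -- `B(v, v̄)` yields `c = -c̄`.
    rw [ad_apply, ad_apply, ← LieModule.traceForm_apply_lie_apply, ← lie_skew, map_neg,
      LinearMap.neg_apply]
  rw [h1, h2, map_smul, map_smul, LinearMap.smul_apply, smul_eq_mul, smul_eq_mul,
    ← neg_mul] at h3
  rw [← neg_eq_iff_eq_neg]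
  exact (mul_right_cancel₀ (killingForm_conjMap_ne_zero hv0) h3).symm

/-- Conjugation commutes with `ad X` for `X ∈ t` and negates the purely imaginary number `χ(X)`. The
eigenvalue equation is linear in the element of `H`, and `H` is spanned over `ℂ` by `t`. -/
theorem conjMap_mem_rootSpace {χ : Weight ℂ F.H (ℂ ⊗[ℝ] g)} {v : ℂ ⊗[ℝ] g}
    (hv : v ∈ rootSpace F.H (χ : F.H → ℂ)) :
    conjMap v ∈ rootSpace F.H (-(χ : F.H → ℂ)) := by
  refine weightSpace_le_genWeightSpace (ℂ ⊗[ℝ] g) _ ((mem_weightSpace _ _).mpr ?_)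
  rintro ⟨h, hh⟩
  have key : ∀ h ∈ F.H.toSubmodule, ∃ hh : h ∈ F.H,
      ad ℂ (ℂ ⊗[ℝ] g) h (conjMap v) = -(χ ⟨h, hh⟩) • conjMap v := by
    intro h hh
    rw [F.H_eq, Submodule.baseChange_eq_span] at hh
    induction hh using Submodule.span_induction with
    | mem h hh =>
      obtain ⟨X, hX, rfl⟩ := hh
      have e : ad ℂ (ℂ ⊗[ℝ] g) ((1 : ℂ) ⊗ₜ[ℝ] X) (conjMap v) =
          -(χ ⟨_, F.one_tmul_mem hX⟩) • conjMap v := by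
        rw [← F.weight_conj χ hX, ← conjMap_smul, ← F.ad_apply_of_mem hv, conjMap_ad_one_tmul]
      exact ⟨F.one_tmul_mem hX, e⟩
    | zero =>
      refine ⟨F.H.zero_mem, ?_⟩
      have : χ (⟨0, F.H.zero_mem⟩ : F.H) = 0 := map_zero (Weight.toLinear ℂ F.H _ χ)
      rw [this]; simp
    | add a b _ _ ha hb =>
      obtain ⟨ha, ha'⟩ := ha
      obtain ⟨hb, hb'⟩ := hb
      refine ⟨F.H.add_mem ha hb, ?_⟩
      have : χ (⟨a + b, F.H.add_mem ha hb⟩ : F.H) = χ ⟨a, ha⟩ + χ ⟨b, hb⟩ :=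
        map_add (Weight.toLinear ℂ F.H _ χ) ⟨a, ha⟩ ⟨b, hb⟩
      rw [this, map_add, LinearMap.add_apply, ha', hb', neg_add, add_smul]
    | smul c a _ ha =>
      obtain ⟨ha, ha'⟩ := ha
      refine ⟨F.H.smul_mem c ha, ?_⟩
      have : χ (⟨c • a, F.H.smul_mem c ha⟩ : F.H) = c * χ ⟨a, ha⟩ :=
        map_smul (Weight.toLinear ℂ F.H _ χ) c ⟨a, ha⟩
      rw [this, map_smul, LinearMap.smul_apply, ha', smul_smul, mul_neg]
  exact (key h hh).2

theorem rePart_mem_t {v : ℂ ⊗[ℝ] g} (hv : v ∈ F.H) : rePart v ∈ F.t := by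
  have hv' : v ∈ F.H.toSubmodule := hv
  rw [F.H_eq] at hv'
  obtain ⟨w, hw⟩ := Submodule.toBaseChange_surjective ℂ F.t.toSubmodule ⟨v, hv'⟩
  have : v = (F.t.toSubmodule.toBaseChange ℂ w : ℂ ⊗[ℝ] g) := by rw [hw]
  rw [this]
  clear hw this hv hv'
  induction w with
  | zero => simp
  | tmul z x =>
    rw [Submodule.coe_toBaseChange_tmul, rePart_tmul]
    exact F.t.smul_mem _ x.2
  | add a b ha hb =>
    rw [map_add, Submodule.coe_add, map_add]
    exact F.t.add_mem ha hb

theorem mem_H_of_mem_rootSpace_zero {v : ℂ ⊗[ℝ] g} (hv : v ∈ rootSpace F.H (0 : F.H → ℂ)) :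
    v ∈ F.H := by
  rw [← zeroRootSubalgebra_eq_of_is_cartan ℂ (ℂ ⊗[ℝ] g) F.H]
  exact hv

theorem mem_plane {α : F.Root} {x : g} : x ∈ F.plane α ↔ (1 : ℂ) ⊗ₜ[ℝ] x ∈
    (rootSpace F.H (α.1 : F.H → ℂ) ⊔ rootSpace F.H (-(α.1 : F.H → ℂ))) := Iff.rfl

theorem rePart_mem_plane {α : F.Root} {v : ℂ ⊗[ℝ] g}
    (hv : v ∈ rootSpace F.H (α.1 : F.H → ℂ) ∨ v ∈ rootSpace F.H (-(α.1 : F.H → ℂ))) :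
    rePart v ∈ F.plane α := by
  rw [mem_plane, one_tmul_rePart]
  refine Submodule.smul_mem _ _ ?_
  rcases hv with hv | hv
  · exact add_mem (LieSubmodule.mem_sup_left hv)
      (LieSubmodule.mem_sup_right (F.conjMap_mem_rootSpace hv))
  · have h2 := F.conjMap_mem_rootSpace (χ := -α.1) hv
    rw [Weight.coe_neg, neg_neg] at h2
    exact add_mem (LieSubmodule.mem_sup_right hv) (LieSubmodule.mem_sup_left h2)

theorem mem_of_one_tmul_mem_weightSum {p : (F.H → ℂ) → Prop} {V : Submodule ℝ g}
    (h : ∀ χ : Weight ℂ F.H (ℂ ⊗[ℝ] g), p χ → ∀ v ∈ rootSpace F.H (χ : F.H → ℂ), rePart v ∈ V)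
    {v : ℂ ⊗[ℝ] g} (hv : v ∈ weightSum F.H p) : rePart v ∈ V := by
  -- `V` is only a real subspace; quantifying over all scalars `c` produces a complex one, to which
  -- `weightSum_le` applies.
  let W : Submodule ℂ (ℂ ⊗[ℝ] g) :=
    { carrier := {v | ∀ c : ℂ, rePart (c • v) ∈ V}
      add_mem' := fun {a b} ha hb c => by
        rw [smul_add, map_add]; exact V.add_mem (ha c) (hb c)
      zero_mem' := fun c => by simp
      smul_mem' := fun d a ha c => by rw [smul_smul]; exact ha _ }
  have hW : weightSum F.H p ≤ W := weightSum_le fun χ hχ v hv c =>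
    h χ hχ _ (Submodule.smul_mem _ c hv)
  have := hW hv 1
  rwa [one_smul] at this

/-- The predicate `p` on weights describes the roots `±α`, for `α` positive with `P α`. -/
def Describes (P : F.Root → Prop) (p : (F.H → ℂ) → Prop) : Prop :=
  (∀ α : F.Root, F.base.IsPos α → P α → p α.1 ∧ p (-(α.1 : F.H → ℂ))) ∧
    ∀ χ : Weight ℂ F.H (ℂ ⊗[ℝ] g), p χ → ∃ α : F.Root, F.base.IsPos α ∧ P α ∧
      ((χ : F.H → ℂ) = α.1 ∨ (χ : F.H → ℂ) = -(α.1 : F.H → ℂ))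

variable {F} {P : F.Root → Prop} {p : (F.H → ℂ) → Prop}

theorem plane_le_planes {α : F.Root} (hα : F.base.IsPos α) (hP : P α) : F.plane α ≤ F.planes P :=
  le_iSup_of_le α (le_iSup_of_le ⟨hα, hP⟩ le_rfl)

theorem Describes.rePart_mem (h : F.Describes P p) {v : ℂ ⊗[ℝ] g} (hv : v ∈ weightSum F.H p) :
    rePart v ∈ F.planes P := by
  refine F.mem_of_one_tmul_mem_weightSum (fun χ hχ v hv => ?_) hv
  obtain ⟨α, hα, hP, h⟩ := h.2 χ hχ
  refine plane_le_planes hα hP (F.rePart_mem_plane ?_)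
  rcases h with h | h <;> rw [h] at hv
  · exact Or.inl hv
  · exact Or.inr hv

theorem Describes.one_tmul_mem (h : F.Describes P p) {x : g} (hx : x ∈ F.planes P) :
    (1 : ℂ) ⊗ₜ[ℝ] x ∈ weightSum F.H p := by
  have : F.planes P ≤ ((weightSum F.H p).restrictScalars ℝ).comap (TensorProduct.mk ℝ ℂ g 1) := by
    refine iSup_le fun α => iSup_le fun hα y hy => ?_
    have h1 : (rootSpace F.H (α.1 : F.H → ℂ) ⊔ rootSpace F.H (-(α.1 : F.H → ℂ))).toSubmodule ≤
        weightSum F.H p := by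
      rw [LieSubmodule.sup_toSubmodule]
      exact sup_le (rootSpace_le_weightSum (h.1 α hα.1 hα.2).1)
        (rootSpace_le_weightSum (h.1 α hα.1 hα.2).2)
    exact h1 hy
  exact this hx

theorem Describes.mem_planes_iff (h : F.Describes P p) {x : g} :
    x ∈ F.planes P ↔ (1 : ℂ) ⊗ₜ[ℝ] x ∈ weightSum F.H p :=
  ⟨h.one_tmul_mem, fun hx => by simpa using h.rePart_mem hx⟩

/-- The planes form a real form of the sum of root spaces, by `v = Re v + √-1 Re (-√-1 v)`. Real
dimensions thereby become numbers of roots. -/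
theorem Describes.baseChange_planes (h : F.Describes P p) :
    (F.planes P).baseChange ℂ = weightSum F.H p := by
  apply le_antisymm
  · rw [Submodule.baseChange_eq_span, Submodule.span_le]
    rintro _ ⟨x, hx, rfl⟩
    exact h.one_tmul_mem hx
  · intro v hv
    rw [eq_rePart_add v]
    exact Submodule.add_mem _ (Submodule.tmul_mem_baseChange_of_mem _ (h.rePart_mem hv))
      (Submodule.smul_mem _ _ (Submodule.tmul_mem_baseChange_of_mem _
        (h.rePart_mem (Submodule.smul_mem _ _ hv))))

open Classical in
theorem Describes.finrank_planes (h : F.Describes P p) (h0 : ¬ p 0) :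
    finrank ℝ (F.planes P) = Fintype.card {α : F.Root // p α.1} := by
  rw [← finrank_weightSum p h0, ← h.baseChange_planes,
    ← (Submodule.toBaseChange.toLinearEquiv ℂ (F.planes P)).finrank_eq, Module.finrank_baseChange]

end RootFrame

theorem repr_sum_smul {ι κ M : Type*} [Fintype ι] [AddCommGroup M] (b : Basis κ ℤ M) (e : ι ≃ κ)
    (c : ι → ℤ) (k : ι) : b.repr (∑ j, c j • b (e j)) (e k) = c k := by
  have := congrFun ((b.reindex e.symm).repr_sum_self c) k
  rw [Basis.repr_reindex_apply] at this
  simp only [Basis.reindex_apply, Equiv.symm_symm] at this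
  exact this

namespace RootFrame

variable {g : Type*} [LieRing g] [LieAlgebra ℝ g] [Module.Finite ℝ g] [IsCompactSimple g]
  {n : ℕ} (F : RootFrame g n)

/-! ### Coefficients of roots -/

/-- The root system of a frame. -/
abbrev rs := rootSystem F.H

/-- The Cartan integer `β(α^∨)`. -/
def pair (β α : F.Root) : ℤ := F.rs.pairingIn ℤ β α

/-- The reflection of the root `β` in the root `α`. -/
def reflect (α β : F.Root) : F.Root := F.rs.reflectionPerm α β

variable {F}

theorem pair_cast (β α : F.Root) : (F.pair β α : ℂ) = β.1 (coroot α.1) := by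
  have := F.rs.algebraMap_pairingIn ℤ β α
  rwa [rootSystem_pairing_apply] at this

theorem cartanMatrix_apply (p q : Fin n) :
    F.cartanMatrix p q = F.pair (F.simpleRoot p) (F.simpleRoot q) := rfl

theorem pair_self (α : F.Root) : F.pair α α = 2 := F.rs.pairingIn_same ℤ α

theorem root_reflect (α β : F.Root) :
    F.rs.root (F.reflect α β) = F.rs.root β - F.pair β α • F.rs.root α := by
  rw [reflect, RootPairing.root_reflectionPerm, RootPairing.reflection_apply_root' ℤ, pair]

theorem reflect_apply (α β : F.Root) (z : F.H) :
    (F.reflect α β).1 z = β.1 z - F.pair β α * α.1 z := by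
  have := congrArg (fun f : Dual ℂ F.H => f z) (root_reflect α β)
  simpa using this

theorem root_eq_sum (α : F.Root) :
    F.rs.root α = ∑ k, F.coeff α k • F.rs.root (F.simpleRoot k) := by
  have h := congrArg Subtype.val (F.base.toWeightBasisInt.sum_repr (F.rs.rootSpanMem ℤ α))
  rw [AddSubmonoidClass.coe_finsetSum] at h
  rw [show F.rs.root α = (F.rs.rootSpanMem ℤ α : Dual ℂ F.H) from rfl, ← h,
    ← Equiv.sum_comp F.simple]
  refine Finset.sum_congr rfl fun k _ => ?_
  rw [Submodule.coe_smul, RootPairing.Base.coe_toWeightBasisInt_apply]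
  rfl

theorem coeff_eq_of_root_eq {α : F.Root} {c : Fin n → ℤ}
    (h : F.rs.root α = ∑ k, c k • F.rs.root (F.simpleRoot k)) : F.coeff α = c := by
  have e : F.rs.rootSpanMem ℤ α = ∑ k, c k • F.base.toWeightBasisInt (F.simple k) := by
    apply Subtype.ext
    rw [AddSubmonoidClass.coe_finsetSum]
    refine h.trans (Finset.sum_congr rfl fun k _ => ?_)
    rw [Submodule.coe_smul, RootPairing.Base.coe_toWeightBasisInt_apply]
    rfl
  ext k
  rw [coeff, e]
  exact repr_sum_smul _ _ _ _

theorem apply_eq_sum (α : F.Root) (z : F.H) :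
    α.1 z = ∑ k, (F.coeff α k : ℂ) * (F.simpleRoot k).1 z := by
  have := congrArg (fun f : Dual ℂ F.H => f z) (root_eq_sum α)
  simpa [LinearMap.sum_apply] using this

theorem coeff_simpleRoot (k : Fin n) : F.coeff (F.simpleRoot k) = Pi.single k 1 := by
  apply coeff_eq_of_root_eq
  rw [Finset.sum_eq_single k]
  · simp
  · intro j _ hj
    simp [hj]
  · simp

theorem coeff_reflect (α β : F.Root) :
    F.coeff (F.reflect α β) = F.coeff β - F.pair β α • F.coeff α := by
  apply coeff_eq_of_root_eq
  rw [root_reflect, root_eq_sum β, root_eq_sum α, Finset.smul_sum, ← Finset.sum_sub_distrib]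
  refine Finset.sum_congr rfl fun k _ => ?_
  rw [Pi.sub_apply, Pi.smul_apply, sub_smul, smul_eq_mul, mul_smul]

theorem coeff_reflect_self (α : F.Root) : F.coeff (F.reflect α α) = - F.coeff α := by
  rw [coeff_reflect, pair_self, two_smul]; abel

/-- This is why the set of roots of a given grade is invariant under reflections in the remaining
simple roots. -/
theorem coeff_reflect_simpleRoot_of_ne {k i : Fin n} (h : i ≠ k) (β : F.Root) :
    F.coeff (F.reflect (F.simpleRoot k) β) i = F.coeff β i := by
  rw [coeff_reflect, coeff_simpleRoot]
  simp [h]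

theorem root_ext {α β : F.Root} (h : F.coeff α = F.coeff β) : α = β := by
  apply F.rs.root.injective
  rw [root_eq_sum α, root_eq_sum β, h]

theorem pair_eq_sum (α β : F.Root) :
    F.pair α β = ∑ k, F.coeff α k * F.pair (F.simpleRoot k) β := by
  have := apply_eq_sum α (coroot β.1)
  simp only [← pair_cast] at this
  exact_mod_cast this

theorem height_eq (α : F.Root) : F.base.height α = ∑ k, F.coeff α k := by
  classical
  -- The coefficients, extended by zero from the simple roots to all roots.
  let f : F.Root → ℤ := fun β => if h : β ∈ F.base.support then F.coeff α (F.simple.symm ⟨β, h⟩) else 0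
  have hf : ∀ k, f (F.simpleRoot k) = F.coeff α k := fun k => by
    have : F.simpleRoot k ∈ F.base.support := (F.simple k).2
    simp only [f, dif_pos this]
    congr 1
    exact F.simple.symm_apply_apply k
  rw [F.base.height_eq_sum (f := f), ← Finset.sum_coe_sort, ← Equiv.sum_comp F.simple]
  · exact Finset.sum_congr rfl fun k _ => hf k
  · rw [← Finset.sum_coe_sort, ← Equiv.sum_comp F.simple, root_eq_sum]
    refine Finset.sum_congr rfl fun k _ => ?_
    rw [← hf k]
    rfl

theorem coeff_nonneg_or_nonpos (α : F.Root) :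
    (∀ k, 0 ≤ F.coeff α k) ∨ (∀ k, F.coeff α k ≤ 0) := by
  obtain ⟨f, -, hf, h⟩ := F.base.exists_root_eq_sum_int α
  have : F.coeff α = fun k => f (F.simpleRoot k) := by
    apply coeff_eq_of_root_eq
    rw [h, ← Finset.sum_coe_sort, ← Equiv.sum_comp F.simple]
    rfl
  rw [this]
  exact hf.imp (fun h k => h.le _) (fun h k => h.le _)

theorem isPos_iff_coeff {α : F.Root} : F.base.IsPos α ↔ ∀ k, 0 ≤ F.coeff α k := by
  rw [RootPairing.Base.isPos_iff', height_eq]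
  refine ⟨fun h => ?_, fun h => Finset.sum_nonneg fun k _ => h k⟩
  rcases coeff_nonneg_or_nonpos α with h' | h'
  · exact h'
  · have := (Finset.sum_eq_zero_iff_of_nonpos (fun k _ => h' k)).mp
      (le_antisymm (Finset.sum_nonpos fun k _ => h' k) h)
    exact fun k => (this k (Finset.mem_univ k)).ge

theorem isPos_of_coeff_pos {α : F.Root} {k : Fin n} (h : 0 < F.coeff α k) : F.base.IsPos α := by
  rw [isPos_iff_coeff]
  rcases coeff_nonneg_or_nonpos α with h' | h'
  · exact h'
  · exact absurd (h' k) (not_le.mpr h)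

theorem isPos_reflect_self (α : F.Root) : F.base.IsPos (F.reflect α α) ↔ ¬ F.base.IsPos α :=
  RootPairing.Base.IsPos.neg_iff_not F.base α

theorem isPos_simpleRoot (k : Fin n) : F.base.IsPos (F.simpleRoot k) :=
  RootPairing.Base.isPos_of_mem_support (F.simple k).2

theorem IsHighest.neg_le {μ : F.Root} (hμ : F.IsHighest μ) (α : F.Root) (k : Fin n) :
    - F.coeff μ k ≤ F.coeff α k := by
  have := hμ (F.reflect α α) k
  rw [coeff_reflect_self, Pi.neg_apply] at this
  linarith

theorem IsHighest.one_le {μ : F.Root} (hμ : F.IsHighest μ) (k : Fin n) : 1 ≤ F.coeff μ k := by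
  have := hμ (F.simpleRoot k) k
  rwa [coeff_simpleRoot, Pi.single_eq_same] at this

/-! ### Lengths of coroots -/

variable (F) in
/-- The squared length `B(α^∨, α^∨)` of the coroot of `α`. -/
def Q (α : F.Root) : ℤ := ∑ β : F.Root, F.pair β α * F.pair β α

variable (F) in
/-- The Killing form on the Cartan subalgebra as a sum over the roots. -/
theorem killingForm_eq_sum (x y : F.H) :
    killingForm ℂ (ℂ ⊗[ℝ] g) x y = ∑ β : F.Root, β.1 x * β.1 y := by
  have := congrArg (fun f => f x y) (restrict_killingForm_eq_sum (K := ℂ) (L := ℂ ⊗[ℝ] g) (H := F.H))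
  rw [← Finset.sum_coe_sort] at this
  simp only [LinearMap.sum_apply] at this
  exact this

theorem Q_cast (α : F.Root) : (F.Q α : ℂ) = ∑ β : F.Root, β.1 (coroot α.1) * β.1 (coroot α.1) := by
  simp_rw [Q, ← pair_cast]; push_cast; rfl

theorem Q_pos (α : F.Root) : 0 < F.Q α := by
  refine Finset.sum_pos' (fun β _ => mul_self_nonneg _) ⟨α, Finset.mem_univ _, ?_⟩
  rw [pair_self]; norm_num

/-- `B(α^∨, ·) = 2α/⟨α, α⟩`, and evaluation at `α^∨` gives `Q α = 4/⟨α, α⟩`, which eliminates `⟨α,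
α⟩` in favour of an integer. -/
theorem sum_apply_coroot (α : F.Root) (z : F.H) :
    ∑ β : F.Root, β.1 (coroot α.1) * β.1 z = F.Q α / 2 * α.1 z := by
  rw [← killingForm_eq_sum]
  have h : ∀ z : F.H, killingForm ℂ (ℂ ⊗[ℝ] g) (coroot α.1 : F.H) z =
      2 * (α.1 ((cartanEquivDual F.H).symm (Weight.toLinear ℂ F.H _ α.1)))⁻¹ * α.1 z := by
    intro z
    have := traceForm_coroot α.1 z
    rw [nsmul_eq_mul, smul_eq_mul, ← mul_assoc] at this
    exact_mod_cast this
  have h2 := h (coroot α.1)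
  rw [killingForm_eq_sum, ← Q_cast, ← pair_cast, pair_self] at h2
  rw [h, h2]
  push_cast
  ring

theorem cartanEquivDual_symm_apply_coroot (α : F.Root) (β : Weight ℂ F.H (ℂ ⊗[ℝ] g)) :
    β ((cartanEquivDual F.H).symm (Weight.toLinear ℂ F.H _ α.1)) =
      2 / F.Q α * β (coroot α.1) := by
  have hQ : (F.Q α : ℂ) ≠ 0 := by exact_mod_cast (Q_pos α).ne'
  have e : (coroot α.1 : F.H) =
      ((F.Q α : ℂ) / 2) • (cartanEquivDual F.H).symm (Weight.toLinear ℂ F.H _ α.1) := by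
    apply (cartanEquivDual F.H).injective
    rw [map_smul, LinearEquiv.apply_symm_apply]
    ext z
    have := sum_apply_coroot α z
    rw [← killingForm_eq_sum] at this
    exact this
  have : β (coroot α.1) = (F.Q α : ℂ) / 2 *
      β ((cartanEquivDual F.H).symm (Weight.toLinear ℂ F.H _ α.1)) := by
    rw [e]
    exact map_smul (Weight.toLinear ℂ F.H _ β) _ _
  rw [this]
  field_simp

theorem kappa_eq (μ : F.Root) : F.kappa μ = 4 / (F.Q μ : ℝ) := by
  have hQ : (F.Q μ : ℂ) ≠ 0 := by exact_mod_cast (Q_pos μ).ne'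
  have : killingForm ℂ (ℂ ⊗[ℝ] g)
      ((cartanEquivDual F.H).symm (Weight.toLinear ℂ F.H _ μ.1))
      ((cartanEquivDual F.H).symm (Weight.toLinear ℂ F.H _ μ.1)) = ((4 / (F.Q μ : ℝ) : ℝ) : ℂ) := by
    rw [killingForm_eq_sum]
    simp_rw [cartanEquivDual_symm_apply_coroot]
    have : ∀ β : F.Root, 2 / (F.Q μ : ℂ) * β.1 (coroot μ.1) * (2 / F.Q μ * β.1 (coroot μ.1)) =
      (4 / (F.Q μ * F.Q μ)) * (β.1 (coroot μ.1) * β.1 (coroot μ.1)) := fun β => by ring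
    simp_rw [this]
    rw [← Finset.mul_sum, ← Q_cast]
    push_cast
    field_simp
  rw [kappa, this, Complex.ofReal_re]

/-- Both sides equal `2B(α^∨, β^∨)`. A larger `Q` means a shorter root. -/
theorem pair_mul_Q (α β : F.Root) : F.pair β α * F.Q β = F.pair α β * F.Q α := by
  have h1 := sum_apply_coroot α (coroot β.1)
  have h2 := sum_apply_coroot β (coroot α.1)
  rw [← pair_cast] at h1 h2
  have : (F.Q α : ℂ) / 2 * F.pair α β = F.Q β / 2 * F.pair β α := by
    rw [← h1, ← h2]
    exact Finset.sum_congr rfl fun _ _ => mul_comm _ _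
  have h3 : (F.pair β α * F.Q β : ℂ) = F.pair α β * F.Q α := by
    linear_combination -2 * this
  exact_mod_cast h3

end RootFrame

namespace RootFrame

variable {g : Type*} [LieRing g] [LieAlgebra ℝ g] [Module.Finite ℝ g] [IsCompactSimple g]
  {n : ℕ} {F : RootFrame g n}

/-! ### Invariance under reflections -/

theorem reflect_reflect (α β : F.Root) : F.reflect α (F.reflect α β) = β :=
  F.rs.reflectionPerm_self α β

theorem sum_reflect {M : Type*} [AddCommMonoid M] (α : F.Root) (a : F.Root → M) :
    ∑ β, a (F.reflect α β) = ∑ β, a β := Equiv.sum_comp (F.rs.reflectionPerm α) a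

theorem pair_reflect_right (α β γ : F.Root) :
    F.pair β (F.reflect α γ) = F.pair (F.reflect α β) γ :=
  F.rs.pairingIn_reflectionPerm ℤ α β γ

theorem pair_reflect_left_self (α β : F.Root) : F.pair (F.reflect α β) α = - F.pair β α := by
  have h : F.pair (F.reflect α β) α = F.pair β (F.reflect α α) := (pair_reflect_right α β α).symm
  rw [h]
  exact F.rs.pairingIn_reflectionPerm_self_right ℤ β α

theorem Q_reflect (α β : F.Root) : F.Q (F.reflect α β) = F.Q β := by
  simp_rw [Q, pair_reflect_right]
  exact sum_reflect α fun γ => F.pair γ β * F.pair γ β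

/-- Every root is conjugate to a simple one under reflections, and these preserve `Q`. -/
theorem exists_Q_simpleRoot_eq (α : F.Root) : ∃ k, F.Q (F.simpleRoot k) = F.Q α := by
  refine F.base.induction_reflect α (p := fun α => ∃ k, F.Q (F.simpleRoot k) = F.Q α) ?_ ?_ ?_
  · rintro α ⟨k, hk⟩
    exact ⟨k, hk.trans (Q_reflect α α).symm⟩
  · intro α hα
    refine ⟨F.simple.symm ⟨α, hα⟩, ?_⟩
    rw [simpleRoot, Equiv.apply_symm_apply]
  · rintro α β ⟨k, hk⟩ -
    exact ⟨k, hk.trans (Q_reflect β α).symm⟩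

open Classical in
theorem isPos_reflect_simpleRoot (k : Fin n) (β : F.Root) :
    (F.base.IsPos (F.reflect (F.simpleRoot k) β) ∧
      F.reflect (F.simpleRoot k) β ≠ F.simpleRoot k) ↔ F.base.IsPos β ∧ β ≠ F.simpleRoot k := by
  have key : ∀ β : F.Root, F.base.IsPos β ∧ β ≠ F.simpleRoot k →
      F.base.IsPos (F.reflect (F.simpleRoot k) β) ∧
        F.reflect (F.simpleRoot k) β ≠ F.simpleRoot k := by
    rintro β ⟨h1, h2⟩
    refine ⟨h1.reflectionPerm (F.simple k).2 h2, fun h3 => ?_⟩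
    have h4 := congrArg (F.reflect (F.simpleRoot k)) h3
    rw [reflect_reflect] at h4
    rw [h4, isPos_reflect_self] at h1
    exact h1 (isPos_simpleRoot k)
  refine ⟨fun h => ?_, key β⟩
  have := key _ h
  rwa [reflect_reflect] at this

open Classical in
/-- The sum of the positive roots takes the value `2` on every simple coroot. -/
theorem sum_pos_pair_simpleRoot (k : Fin n) :
    ∑ β : F.Root, (if F.base.IsPos β then F.pair β (F.simpleRoot k) else 0) = 2 := by
  -- The reflection in `αₖ` permutes the positive roots other than `αₖ` and negates their pairing
  -- with its coroot, so these cancel and only `αₖ` contributes.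
  have h1 : ∑ β : F.Root, (if F.base.IsPos β ∧ β ≠ F.simpleRoot k then
      F.pair β (F.simpleRoot k) else 0) = 0 := by
    have h := sum_reflect (F.simpleRoot k) fun β : F.Root =>
      if F.base.IsPos β ∧ β ≠ F.simpleRoot k then F.pair β (F.simpleRoot k) else 0
    simp only [isPos_reflect_simpleRoot, pair_reflect_left_self] at h
    have h2 : ∀ β : F.Root, (if F.base.IsPos β ∧ β ≠ F.simpleRoot k then
      -F.pair β (F.simpleRoot k) else 0) = -(if F.base.IsPos β ∧ β ≠ F.simpleRoot k then
      F.pair β (F.simpleRoot k) else 0) := fun β => by split_ifs <;> simp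
    simp_rw [h2, Finset.sum_neg_distrib] at h
    linarith
  have h3 : ∀ β : F.Root, (if F.base.IsPos β then F.pair β (F.simpleRoot k) else 0) =
      (if F.base.IsPos β ∧ β ≠ F.simpleRoot k then F.pair β (F.simpleRoot k) else 0) +
      if β = F.simpleRoot k then 2 else 0 := fun β => by
    by_cases h : β = F.simpleRoot k
    · rw [h, if_pos (isPos_simpleRoot k), pair_self]; simp
    · simp [h]
  simp_rw [h3, Finset.sum_add_distrib, h1]
  simp

open Classical in
theorem sum_eq_two_mul_sum_pos (a : F.Root → ℤ) (ha : ∀ β, a (F.reflect β β) = a β) :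
    ∑ β, a β = 2 * ∑ β, if F.base.IsPos β then a β else 0 := by
  let e : F.Root ≃ F.Root := Function.Involutive.toPerm (fun β => F.reflect β β) fun β =>
    root_ext (by rw [coeff_reflect_self, coeff_reflect_self, neg_neg])
  have h1 : ∑ β, (if F.base.IsPos β then a β else 0) =
      ∑ β, (if ¬ F.base.IsPos β then a β else 0) := by
    rw [← Equiv.sum_comp e]
    refine Finset.sum_congr rfl fun β _ => ?_
    change (if F.base.IsPos (F.reflect β β) then a (F.reflect β β) else 0) = _
    simp only [ha, isPos_reflect_self]
  rw [two_mul]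
  nth_rw 2 [h1]
  rw [← Finset.sum_add_distrib]
  refine Finset.sum_congr rfl fun β _ => ?_
  by_cases h : F.base.IsPos β <;> simp [h]

theorem pair_reflect_self_left (α β : F.Root) : F.pair (F.reflect β β) α = - F.pair β α :=
  F.rs.pairingIn_reflectionPerm_self_left ℤ β α

/-! ### Weighted sums of Cartan integers -/

/-- The sum `∑ a(β) ⟨β, α⟩` over the roots `β`. -/
def pairSum (a : F.Root → ℤ) (α : F.Root) : ℚ := ∑ β, a β * (2 * (F.pair β α : ℚ) / F.Q α)

theorem rootSum_eq_pairSum {f : (F.H → ℂ) → ℂ} {a : F.Root → ℤ} (h : ∀ β : F.Root, f β.1 = a β)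
    (α : F.Root) : rootSum f α.1 = (pairSum a α : ℚ) := by
  rw [rootSum, pairSum]
  push_cast
  refine Finset.sum_congr rfl fun β _ => ?_
  rw [h, cartanEquivDual_symm_apply_coroot, ← pair_cast]
  ring

theorem Q_ne_zero (α : F.Root) : (F.Q α : ℚ) ≠ 0 := by exact_mod_cast (Q_pos α).ne'

theorem pair_div_Q_comm (α β : F.Root) : (F.pair β α : ℚ) / F.Q α = F.pair α β / F.Q β := by
  have h : (F.pair β α * F.Q β : ℚ) = F.pair α β * F.Q α := by exact_mod_cast pair_mul_Q α β
  rw [div_eq_div_iff (Q_ne_zero α) (Q_ne_zero β), h]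

/-- The quotient is `⟨β, α⟩/2`, hence symmetric and additive in `α`, unlike the Cartan integer
itself. -/
theorem pair_div_Q (α β : F.Root) : (F.pair β α : ℚ) / F.Q α =
    ∑ k, F.coeff α k * ((F.pair β (F.simpleRoot k) : ℚ) / F.Q (F.simpleRoot k)) := by
  rw [pair_div_Q_comm, pair_eq_sum]
  push_cast
  rw [Finset.sum_div]
  refine Finset.sum_congr rfl fun k _ => ?_
  rw [pair_div_Q_comm, mul_div_assoc]

theorem pairSum_eq_sum (a : F.Root → ℤ) (α : F.Root) :
    pairSum a α = ∑ k, F.coeff α k * pairSum a (F.simpleRoot k) := by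
  simp_rw [pairSum, mul_div_assoc, pair_div_Q α, Finset.mul_sum]
  rw [Finset.sum_comm]
  exact Finset.sum_congr rfl fun k _ => Finset.sum_congr rfl fun β _ => by ring

/-- The reflection preserves the weights `a` and negates every pairing with `αₖ`, so the sum equals
its own negative. -/
theorem pairSum_simpleRoot_eq_zero {a : F.Root → ℤ} {k : Fin n}
    (ha : ∀ β, a (F.reflect (F.simpleRoot k) β) = a β) : pairSum a (F.simpleRoot k) = 0 := by
  have h := sum_reflect (F.simpleRoot k) fun β : F.Root =>
    (a β : ℚ) * (2 * (F.pair β (F.simpleRoot k) : ℚ) / F.Q (F.simpleRoot k))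
  simp only [ha, pair_reflect_left_self] at h
  have h2 : pairSum a (F.simpleRoot k) = - pairSum a (F.simpleRoot k) := by
    nth_rw 1 [pairSum, ← h, pairSum, ← Finset.sum_neg_distrib]
    exact Finset.sum_congr rfl fun β _ => by push_cast; ring
  linarith

/-! ### Fundamental coweights -/

variable (F) in
/-- `x / d` are the coordinates of the fundamental coweight of `αᵢ` in the simple coroots. -/
def IsCoweight (i : Fin n) (x : Fin n → ℤ) (d : ℤ) : Prop :=
  ∀ k, ∑ j, F.cartanMatrix k j * x j = if k = i then d else 0

theorem IsCoweight.sum_pair {i : Fin n} {x : Fin n → ℤ} {d : ℤ} (hx : F.IsCoweight i x d)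
    (β : F.Root) : ∑ j, x j * F.pair β (F.simpleRoot j) = d * F.coeff β i := by
  simp_rw [pair_eq_sum β, Finset.mul_sum]
  rw [Finset.sum_comm]
  have : ∀ k, ∑ j, x j * (F.coeff β k * F.pair (F.simpleRoot k) (F.simpleRoot j)) =
      F.coeff β k * if k = i then d else 0 := fun k => by
    rw [← hx k, Finset.mul_sum]
    exact Finset.sum_congr rfl fun j _ => by rw [cartanMatrix_apply]; ring
  simp_rw [this]
  simp [mul_comm]

/-- Twice the functional `∑ a(β) β`, evaluated at `∑ xⱼ αⱼ^∨ = d ωᵢ` in two ways. -/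
theorem IsCoweight.sum_pairSum {i : Fin n} {x : Fin n → ℤ} {d : ℤ} (hx : F.IsCoweight i x d)
    (a : F.Root → ℤ) : 2 * d * ∑ β, (a β : ℚ) * F.coeff β i =
      ∑ j, x j * F.Q (F.simpleRoot j) * pairSum a (F.simpleRoot j) := by
  have h : ∀ β : F.Root, 2 * d * ((a β : ℚ) * F.coeff β i) =
      ∑ j, 2 * (a β : ℚ) * ((x j : ℚ) * F.pair β (F.simpleRoot j)) := fun β => by
    have : (∑ j, (x j : ℚ) * F.pair β (F.simpleRoot j)) = d * F.coeff β i := by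
      exact_mod_cast hx.sum_pair β
    rw [← Finset.mul_sum, this]; ring
  simp_rw [Finset.mul_sum, h]
  rw [Finset.sum_comm]
  refine Finset.sum_congr rfl fun j _ => ?_
  rw [pairSum, Finset.mul_sum]
  refine Finset.sum_congr rfl fun β _ => ?_
  have := Q_ne_zero (F.simpleRoot j)
  field_simp

-- The sum of the positive roots evaluated at `d ωᵢ = ∑ xⱼ αⱼ^∨`; each simple coroot contributes
-- `2`.
open Classical in
theorem IsCoweight.sum_pos_coeff {i : Fin n} {x : Fin n → ℤ} {d : ℤ} (hx : F.IsCoweight i x d) :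
    d * ∑ β : F.Root, (if F.base.IsPos β then F.coeff β i else 0) = 2 * ∑ j, x j := by
  have h : ∀ β : F.Root, d * (if F.base.IsPos β then F.coeff β i else 0) =
      ∑ j, x j * if F.base.IsPos β then F.pair β (F.simpleRoot j) else 0 := fun β => by
    split_ifs
    · exact (hx.sum_pair β).symm
    · simp
  simp_rw [Finset.mul_sum, h]
  rw [Finset.sum_comm]
  refine Finset.sum_congr rfl fun j _ => ?_
  rw [← Finset.mul_sum, sum_pos_pair_simpleRoot, mul_comm]

variable (F) in
/-- `h` is the fundamental coweight of `αᵢ`. -/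
def IsFundamental (i : Fin n) (h : F.H) : Prop :=
  ∀ k, (F.simpleRoot k).1 h = if k = i then 1 else 0

theorem IsFundamental.apply {i : Fin n} {h : F.H} (hh : F.IsFundamental i h) (β : F.Root) :
    β.1 h = F.coeff β i := by
  rw [apply_eq_sum]
  simp [hh _]

/-- Both sides are `2B(d ωᵢ, ωⱼ)`: on the left `B` is a sum over roots, on the right `d ωᵢ` is
expanded in simple coroots and `B(αₖ^∨, ωⱼ)` is `Q(αₖ)/2` for `k = j` and zero otherwise. -/
theorem IsCoweight.sum_coeff_mul_coeff {i j : Fin n} {x : Fin n → ℤ} {d : ℤ}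
    (hx : F.IsCoweight i x d) {h : F.H} (hh : F.IsFundamental j h) :
    2 * d * ∑ β : F.Root, F.coeff β i * F.coeff β j = x j * F.Q (F.simpleRoot j) := by
  have h1 : ∀ k, 2 * ∑ β : F.Root, F.pair β (F.simpleRoot k) * F.coeff β j =
      F.Q (F.simpleRoot k) * if k = j then 1 else 0 := fun k => by
    have := sum_apply_coroot (F.simpleRoot k) h
    simp only [← pair_cast, hh.apply, coeff_simpleRoot, Pi.single_apply] at this
    have h2 : (2 : ℂ) * ∑ β : F.Root, (F.pair β (F.simpleRoot k) : ℂ) * F.coeff β j =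
        F.Q (F.simpleRoot k) * if k = j then 1 else 0 := by
      rw [this]
      simp only [eq_comm (a := j)]
      push_cast
      ring
    exact_mod_cast h2
  have h2 : ∀ β : F.Root, 2 * d * (F.coeff β i * F.coeff β j) =
      ∑ k, x k * (2 * (F.pair β (F.simpleRoot k) * F.coeff β j)) := fun β => by
    rw [show 2 * d * (F.coeff β i * F.coeff β j) = 2 * F.coeff β j * (d * F.coeff β i) by ring,
      ← hx.sum_pair β, Finset.mul_sum]
    exact Finset.sum_congr rfl fun k _ => by ring
  simp_rw [Finset.mul_sum, h2]
  rw [Finset.sum_comm]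
  simp_rw [← Finset.mul_sum, h1]
  simp

end RootFrame

/-- Reflection of a coefficient vector in the simple root `k`. -/
def reflectVec {n : ℕ} (C : Matrix (Fin n) (Fin n) ℤ) (k : Fin n) (c : Fin n → ℤ) : Fin n → ℤ :=
  c - (∑ j, c j * C j k) • Pi.single k 1

/-- `c` is obtained from `e` by simple reflections. -/
def Reaches {n : ℕ} (C : Matrix (Fin n) (Fin n) ℤ) (e c : Fin n → ℤ) : Prop :=
  Relation.ReflTransGen (fun c c' => ∃ k, c' = reflectVec C k c) e c

/-- The data attached to a connected Cartan matrix `C`: `s` are the squared lengths of the simple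
coroots (`1` for the long roots), `m` is the highest root and `c` the highest root as a combination
of coroots. -/
structure IsHighestData {n : ℕ} (C : Matrix (Fin n) (Fin n) ℤ) (s m c : Fin n → ℕ) : Prop where
  symm : ∀ k l, C k l * s k = C l k * s l
  one_le : ∀ k, 1 ≤ s k
  marks : ∀ k, m k = s k * c k
  dominant : ∀ k, 0 ≤ ∑ j, m j * C j k
  exists_root : ∃ r, s r = 1 ∧ (∀ k, Relation.ReflTransGen (fun a b => C a b ≠ 0) r k) ∧
    Reaches C (Pi.single r 1) fun k => (m k : ℤ)

/-! ### Identification of the highest root from the Cartan matrix -/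

namespace RootFrame

variable {g : Type*} [LieRing g] [LieAlgebra ℝ g] [Module.Finite ℝ g] [IsCompactSimple g]
  {n : ℕ} {F : RootFrame g n} {μ : F.Root}

theorem coeff_reflect_simpleRoot (k : Fin n) (β : F.Root) :
    F.coeff (F.reflect (F.simpleRoot k) β) = reflectVec F.cartanMatrix k (F.coeff β) := by
  rw [coeff_reflect, coeff_simpleRoot, pair_eq_sum, reflectVec]
  rfl

theorem exists_root_of_reaches {α : F.Root} {c : Fin n → ℤ}
    (h : Reaches F.cartanMatrix (F.coeff α) c) : ∃ θ, F.coeff θ = c ∧ F.Q θ = F.Q α := by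
  induction h with
  | refl => exact ⟨α, rfl, rfl⟩
  | tail _ h ih =>
    obtain ⟨θ, rfl, h2⟩ := ih
    obtain ⟨k, rfl⟩ := h
    exact ⟨F.reflect (F.simpleRoot k) θ, coeff_reflect_simpleRoot k θ,
      (Q_reflect _ _).trans h2⟩

/-- Across an edge of the Dynkin diagram the symmetrising property of `s` fixes the ratio of the two
values of `Q`; a path from `r` propagates this. -/
theorem Q_simpleRoot_eq {s : Fin n → ℕ}
    (hs : ∀ k l, F.cartanMatrix k l * s k = F.cartanMatrix l k * s l) {r k : Fin n}
    (hr : s r = 1)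
    (h : Relation.ReflTransGen (fun a b => F.cartanMatrix a b ≠ 0) r k) :
    F.Q (F.simpleRoot k) = s k * F.Q (F.simpleRoot r) := by
  induction h with
  | refl => simp [hr]
  | @tail a b _ h ih =>
    have h1 := pair_mul_Q (F.simpleRoot a) (F.simpleRoot b)
    have h2 := hs a b
    rw [cartanMatrix_apply, cartanMatrix_apply] at h2
    rw [cartanMatrix_apply] at h
    have h3 : F.pair (F.simpleRoot b) (F.simpleRoot a) ≠ 0 := fun h3 => by
      rw [h3, zero_mul] at h1
      rcases mul_eq_zero.mp h1.symm with h4 | h4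
      · exact h h4
      · exact (Q_pos _).ne' h4
    apply mul_left_cancel₀ h3
    rw [h1, ih]
    linear_combination F.Q (F.simpleRoot r) * h2

/-- With `p = β(μ^∨)`, the reflected root `β - pμ` has coefficients between those of `-μ` and `μ`. A
negative `p` would force `β = 0`, and `p ≥ 2` would force `β = μ`. -/
theorem IsHighest.pair_of_isPos (hμ : F.IsHighest μ) {β : F.Root} (hβ : F.base.IsPos β)
    (hne : β ≠ μ) : F.pair β μ = 0 ∨ F.pair β μ = 1 := by
  have h0 := isPos_iff_coeff.mp hβ
  have h1 : ∀ k, - F.coeff μ k ≤ F.coeff β k - F.pair β μ * F.coeff μ k := fun k => by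
    have := hμ.neg_le (F.reflect μ β) k
    rwa [coeff_reflect] at this
  have h2 : ∀ k, F.coeff β k - F.pair β μ * F.coeff μ k ≤ F.coeff μ k := fun k => by
    have := hμ (F.reflect μ β) k
    rwa [coeff_reflect] at this
  have h3 : 0 ≤ F.pair β μ := by
    by_contra! h
    have : F.coeff β = 0 := funext fun k => by
      refine le_antisymm ?_ (h0 k)
      have := hμ.one_le k
      have := h2 k
      change _ ≤ (0 : ℤ)
      nlinarith
    have h4 := pair_eq_sum β β
    rw [pair_self, this] at h4
    simp at h4
  have h4 : F.pair β μ ≤ 1 := by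
    by_contra! h
    refine hne (root_ext (funext fun k => le_antisymm (hμ β k) ?_))
    have := hμ.one_le k
    have := h1 k
    nlinarith
  omega

/-- Suppose `θ ≠ μ`. Since `μ - θ` is a nonnegative combination of simple roots and `θ` is dominant,
`μ(θ^∨) ≥ θ(θ^∨) = 2`, while `θ(μ^∨) ≤ 1`. Then `μ` would be strictly longer than `θ`, against `hQ`.
-/
theorem IsHighest.coeff_eq (hμ : F.IsHighest μ) {θ : F.Root} (h0 : ∀ k, 0 ≤ F.coeff θ k)
    (hd : ∀ k, 0 ≤ F.pair θ (F.simpleRoot k)) (hQ : F.Q θ ≤ F.Q μ) : μ = θ := by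
  by_contra hne
  have h1 : ∀ k, 0 ≤ F.pair (F.simpleRoot k) θ := fun k => by
    have := pair_mul_Q θ (F.simpleRoot k)
    have h2 := Q_pos θ
    have h3 := Q_pos (F.simpleRoot k)
    have := mul_nonneg (hd k) h2.le
    by_contra! h
    have := mul_neg_of_neg_of_pos h h3
    have := pair_mul_Q θ (F.simpleRoot k)
    linarith
  have h2 : 2 ≤ F.pair μ θ := by
    rw [← pair_self θ, pair_eq_sum μ, pair_eq_sum θ]
    exact Finset.sum_le_sum fun k _ => mul_le_mul_of_nonneg_right (hμ θ k) (h1 k)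
  have h3 : F.pair θ μ ≤ 1 := by
    rcases hμ.pair_of_isPos (isPos_iff_coeff.mpr h0) (Ne.symm hne) with h | h <;> omega
  have h4 := pair_mul_Q θ μ
  have := Q_pos θ
  have := Q_pos μ
  nlinarith

variable {s m c : Fin n → ℕ}

/-- The chain of reflections realises `m` as a genuine root, conjugate to the long simple root `r`
and dominant by assumption, so it must be `μ`. -/
theorem IsHighest.coeff_eq_and_Q (hμ : F.IsHighest μ) (hd : IsHighestData F.cartanMatrix s m c) :
    (∀ k, F.coeff μ k = m k) ∧ ∀ k, F.Q (F.simpleRoot k) = s k * F.Q μ := by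
  obtain ⟨r, hr, hc, hm⟩ := hd.exists_root
  have hQ : ∀ k, F.Q (F.simpleRoot k) = s k * F.Q (F.simpleRoot r) := fun k =>
    Q_simpleRoot_eq hd.symm hr (hc k)
  rw [← coeff_simpleRoot (F := F)] at hm
  obtain ⟨θ, h1, h2⟩ := exists_root_of_reaches hm
  obtain rfl : μ = θ := by
    refine hμ.coeff_eq (fun k => ?_) (fun k => ?_) ?_
    · rw [h1]; exact Int.natCast_nonneg _
    · rw [pair_eq_sum, h1]
      exact hd.dominant k
    · obtain ⟨k, hk⟩ := exists_Q_simpleRoot_eq μ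
      rw [h2, ← hk, hQ k]
      have := Q_pos (F.simpleRoot r)
      have : (1 : ℤ) ≤ s k := by exact_mod_cast hd.one_le k
      nlinarith
  exact ⟨fun k => by rw [h1], fun k => by rw [hQ, h2]⟩

/-- This is `μ^∨ = ∑ cₖ αₖ^∨`: passing from roots to coroots divides `mₖ` by the length ratio `sₖ`.
-/
theorem IsHighest.pair_eq_sum (hμ : F.IsHighest μ) (hd : IsHighestData F.cartanMatrix s m c)
    (β : F.Root) : F.pair β μ = ∑ k, c k * F.pair β (F.simpleRoot k) := by
  obtain ⟨h1, h2⟩ := hμ.coeff_eq_and_Q hd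
  have h3 := pair_div_Q μ β
  have hQ := Q_ne_zero μ
  have h4 : ∀ k, (F.coeff μ k : ℚ) * (F.pair β (F.simpleRoot k) / F.Q (F.simpleRoot k)) =
      c k * F.pair β (F.simpleRoot k) / F.Q μ := fun k => by
    have : (s k : ℚ) ≠ 0 := by exact_mod_cast Nat.one_le_iff_ne_zero.mp (hd.one_le k)
    rw [h1, h2, hd.marks]
    push_cast
    field_simp
  simp_rw [h4, ← Finset.sum_div] at h3
  have h5 := (div_left_inj' hQ).mp h3
  exact_mod_cast h5

open Classical in
/-- `B(μ^∨, μ^∨)` is four times the dual Coxeter number. -/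
theorem IsHighest.Q_eq (hμ : F.IsHighest μ) (hd : IsHighestData F.cartanMatrix s m c) :
    F.Q μ = 4 * (1 + ∑ k, (c k : ℤ)) := by
  have h1 : ∑ β : F.Root, (if F.base.IsPos β then F.pair β μ else 0) = 2 * ∑ k, (c k : ℤ) := by
    have : ∀ β : F.Root, (if F.base.IsPos β then F.pair β μ else 0) =
        ∑ k, c k * (if F.base.IsPos β then F.pair β (F.simpleRoot k) else 0) := fun β => by
      split_ifs
      · exact hμ.pair_eq_sum hd β
      · simp
    simp_rw [this]
    rw [Finset.sum_comm, Finset.mul_sum]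
    refine Finset.sum_congr rfl fun k _ => ?_
    rw [← Finset.mul_sum, sum_pos_pair_simpleRoot, mul_comm]
  have hpos : F.base.IsPos μ := isPos_iff_coeff.mpr fun k => by linarith [hμ.one_le k]
  -- On positive roots `β(μ^∨)` is `0` or `1`, hence equal to its square, except at `μ`, where `4 =
  -- 2 + 2`.
  have h2 : ∀ β : F.Root, (if F.base.IsPos β then F.pair β μ * F.pair β μ else 0) =
      (if F.base.IsPos β then F.pair β μ else 0) + if β = μ then 2 else 0 := fun β => by
    by_cases h : β = μ
    · simp [h, hpos, pair_self]
    · by_cases h' : F.base.IsPos β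
      · rcases hμ.pair_of_isPos h' h with h'' | h'' <;> simp [h, h', h'']
      · simp [h, h']
  rw [Q, sum_eq_two_mul_sum_pos]
  · simp_rw [h2]
    rw [Finset.sum_add_distrib, h1]
    simp
    ring
  · intro β
    rw [pair_reflect_self_left]; ring

end RootFrame

/-! ### Counting the roots of each grade -/

namespace RootFrame

variable {g : Type*} [LieRing g] [LieAlgebra ℝ g] [Module.Finite ℝ g] [IsCompactSimple g]
  {n : ℕ} {F : RootFrame g n} {μ : F.Root} {s m c : Fin n → ℕ} {i j : Fin n} {x y : Fin n → ℤ}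
  {d : ℤ} {h h' : F.H}

open Classical in
variable (F) in
/-- The number of roots satisfying `p`. -/
def count (p : F.Root → Prop) : ℕ := Fintype.card {β : F.Root // p β}

open Classical in
/-- The indicator function of a set of roots. -/
def rootInd (p : F.Root → Prop) (β : F.Root) : ℤ := if p β then 1 else 0

theorem rootInd_congr {p q : F.Root → Prop} {β γ : F.Root} (h : p β ↔ q γ) :
    rootInd p β = rootInd q γ := by
  by_cases hp : p β
  · rw [rootInd, rootInd, if_pos hp, if_pos (h.mp hp)]
  · rw [rootInd, rootInd, if_neg hp, if_neg fun hq => hp (h.mpr hq)]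

theorem sum_rootInd (p : F.Root → Prop) : ∑ β, rootInd p β = F.count p := by
  classical
  simp only [rootInd, count, Finset.sum_boole, Fintype.card_subtype]

theorem sum_rootInd_mul {p : F.Root → Prop} {a : F.Root → ℤ} {v : ℤ} (hv : ∀ β, p β → a β = v) :
    ∑ β, rootInd p β * a β = v * F.count p := by
  rw [← sum_rootInd, Finset.mul_sum]
  refine Finset.sum_congr rfl fun β _ => ?_
  by_cases hp : p β
  · simp [rootInd, hp, hv β hp]
  · simp [rootInd, hp]

/-! ### Gradings by one coefficient -/

theorem rootInd_reflect {v : ℤ} {k : Fin n} (hk : k ≠ i) (β : F.Root) :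
    rootInd (fun β => F.coeff β i = v) (F.reflect (F.simpleRoot k) β) =
      rootInd (fun β => F.coeff β i = v) β :=
  rootInd_congr (by rw [coeff_reflect_simpleRoot_of_ne hk.symm])

theorem pairSum_rootInd (v : ℤ) (α : F.Root) : pairSum (rootInd fun β : F.Root => F.coeff β i = v) α =
    F.coeff α i * pairSum (rootInd fun β : F.Root => F.coeff β i = v) (F.simpleRoot i) := by
  rw [pairSum_eq_sum, Finset.sum_eq_single i]
  · intro k _ hk
    rw [pairSum_simpleRoot_eq_zero (rootInd_reflect hk), mul_zero]
  · simp

/-- Only the value at `αᵢ` is unknown. Evaluation on the fundamental coweight determines it from the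
number of roots of grade `v`. -/
theorem IsHighest.pairSum_rootInd (hμ : F.IsHighest μ) (hd : IsHighestData F.cartanMatrix s m c)
    (hx : F.IsCoweight i x d) {v l : ℤ} (h0 : x i ≠ 0)
    (hl : 2 * d * (v * F.count fun β => F.coeff β i = v) = x i * s i * l) (α : F.Root) :
    pairSum (rootInd fun β : F.Root => F.coeff β i = v) α = F.coeff α i * (l / F.Q μ : ℚ) := by
  have h1 := hx.sum_pairSum (rootInd fun β : F.Root => F.coeff β i = v)
  have h2 : ∑ β, (rootInd (fun β : F.Root => F.coeff β i = v) β : ℚ) * F.coeff β i =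
      v * F.count fun β => F.coeff β i = v := by
    exact_mod_cast sum_rootInd_mul (a := fun β => F.coeff β i)
      (p := fun β : F.Root => F.coeff β i = v) (fun β hβ => hβ)
  have hl' : 2 * d * (v * F.count fun β => F.coeff β i = v) = (x i * s i * l : ℚ) := by
    exact_mod_cast hl
  rw [h2, hl', Finset.sum_eq_single i, (hμ.coeff_eq_and_Q hd).2] at h1
  · rw [RootFrame.pairSum_rootInd]
    congr 1
    have hQ := Q_ne_zero μ
    have hx0 : (x i : ℚ) ≠ 0 := by exact_mod_cast h0
    have hs : (s i : ℚ) ≠ 0 := by exact_mod_cast Nat.one_le_iff_ne_zero.mp (hd.one_le i)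
    rw [eq_div_iff hQ]
    apply mul_left_cancel₀ (mul_ne_zero hx0 hs)
    rw [h1]
    push_cast
    ring
  · intro k _ hk
    rw [pairSum_simpleRoot_eq_zero (rootInd_reflect hk), mul_zero]
  · simp

-- Positive roots have grade `0`, `1` or `2`, so the sums of `nᵢ²` and of `nᵢ` over them are two
-- independent linear forms in the two unknown numbers.
open Classical in
theorem IsHighest.count_grading (hμ : F.IsHighest μ) (hd : IsHighestData F.cartanMatrix s m c)
    (hx : F.IsCoweight i x d) (hh : F.IsFundamental i h) (hi : m i = 2) :
    d * ((F.count fun β => F.coeff β i = 1) + 4 * F.count fun β => F.coeff β i = 2) =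
      x i * s i * (1 + ∑ k, (c k : ℤ)) ∧
    d * ((F.count fun β => F.coeff β i = 1) + 2 * F.count fun β => F.coeff β i = 2) =
      2 * ∑ j, x j := by
  have hm : F.coeff μ i = 2 := by rw [(hμ.coeff_eq_and_Q hd).1, hi]; rfl
  have key : ∀ (f : ℤ → ℤ), f 0 = 0 →
      ∑ β : F.Root, (if F.base.IsPos β then f (F.coeff β i) else 0) =
      f 1 * (F.count fun β => F.coeff β i = 1) + f 2 * (F.count fun β => F.coeff β i = 2) := by
    intro f hf
    rw [← sum_rootInd, ← sum_rootInd, Finset.mul_sum, Finset.mul_sum, ← Finset.sum_add_distrib]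
    refine Finset.sum_congr rfl fun β _ => ?_
    by_cases hβ : F.base.IsPos β
    · have h1 := isPos_iff_coeff.mp hβ i
      have h2 := hm ▸ hμ β i
      have : F.coeff β i = 0 ∨ F.coeff β i = 1 ∨ F.coeff β i = 2 := by omega
      rcases this with h | h | h <;> simp [rootInd, hβ, h, hf]
    · have h1 : ¬ 0 < F.coeff β i := fun h => hβ (isPos_of_coeff_pos h)
      have h2 : F.coeff β i ≠ 1 := by omega
      have h3 : F.coeff β i ≠ 2 := by omega
      simp [rootInd, hβ, h2, h3]
  refine ⟨?_, ?_⟩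
  · have h1 := hx.sum_coeff_mul_coeff hh
    rw [sum_eq_two_mul_sum_pos _ (fun β => by rw [coeff_reflect_self]; simp),
      key (fun t => t * t) (by simp), (hμ.coeff_eq_and_Q hd).2, hμ.Q_eq hd] at h1
    linarith
  · have h1 := hx.sum_pos_coeff
    rw [key (fun t => t) rfl] at h1
    linarith

/-! ### Gradings by two coefficients -/

theorem pairSum_eq_of_invariant {a : F.Root → ℤ} (hij : i ≠ j)
    (ha : ∀ k, k ≠ i → k ≠ j → ∀ β, a (F.reflect (F.simpleRoot k) β) = a β) (α : F.Root) :
    pairSum a α = F.coeff α i * pairSum a (F.simpleRoot i) +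
      F.coeff α j * pairSum a (F.simpleRoot j) := by
  rw [pairSum_eq_sum]
  refine Fintype.sum_eq_add i j hij fun k hk => ?_
  rw [pairSum_simpleRoot_eq_zero (ha k hk.1 hk.2), mul_zero]

/-- Cramer's rule: evaluation on the two coweights gives a `2 × 2` system for the values at `αᵢ` and
`αⱼ`, with determinant `xᵢ yⱼ - xⱼ yᵢ`. -/
theorem IsHighest.pairSum_of_invariant (hμ : F.IsHighest μ)
    (hd : IsHighestData F.cartanMatrix s m c) (hij : i ≠ j) (hsi : s i = 1) (hsj : s j = 1)
    (hx : F.IsCoweight i x d) (hy : F.IsCoweight j y d) {a : F.Root → ℤ}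
    (ha : ∀ k, k ≠ i → k ≠ j → ∀ β, a (F.reflect (F.simpleRoot k) β) = a β)
    {A B : ℤ} (hA : ∑ β, a β * F.coeff β i = A) (hB : ∑ β, a β * F.coeff β j = B) (α : F.Root) :
    (x i * y j - x j * y i) * (pairSum a α * F.Q μ) =
      2 * d * (F.coeff α i * (A * y j - B * x j) + F.coeff α j * (B * x i - A * y i)) := by
  have h1 : ∀ {i' : Fin n} {z : Fin n → ℤ}, F.IsCoweight i' z d →
      2 * d * ∑ β, (a β : ℚ) * F.coeff β i' =
        (z i * pairSum a (F.simpleRoot i) + z j * pairSum a (F.simpleRoot j)) * F.Q μ := by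
    intro i' z hz
    rw [hz.sum_pairSum, Fintype.sum_eq_add i j hij, (hμ.coeff_eq_and_Q hd).2,
      (hμ.coeff_eq_and_Q hd).2, hsi, hsj]
    · push_cast
      ring
    · intro k hk
      rw [pairSum_simpleRoot_eq_zero (ha k hk.1 hk.2), mul_zero]
  have h2 := h1 hx
  have h3 := h1 hy
  rw [show ∑ β, (a β : ℚ) * F.coeff β i = A by exact_mod_cast hA] at h2
  rw [show ∑ β, (a β : ℚ) * F.coeff β j = B by exact_mod_cast hB] at h3
  rw [pairSum_eq_of_invariant hij ha]
  linear_combination -(F.coeff α i * y j - F.coeff α j * y i) * h2 +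
    (F.coeff α i * x j - F.coeff α j * x i) * h3

variable (F) in
/-- The number of roots with coefficients `p` and `q` at `αᵢ` and `αⱼ`. -/
def count₂ (i j : Fin n) (p q : ℤ) : ℕ := F.count fun β => F.coeff β i = p ∧ F.coeff β j = q

theorem IsHighest.sum_coeff_mul_coeff (hμ : F.IsHighest μ) (hi : F.coeff μ i = 1)
    (hj : F.coeff μ j = 1) :
    (∑ β : F.Root, F.coeff β i * F.coeff β i = 2 * (F.count₂ i j 1 1 + F.count₂ i j 1 0) ∧
    ∑ β : F.Root, F.coeff β i * F.coeff β j = 2 * F.count₂ i j 1 1) ∧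
    ∑ β : F.Root, F.coeff β j * F.coeff β j = 2 * (F.count₂ i j 1 1 + F.count₂ i j 0 1) := by
  classical
  have key : ∀ (f : ℤ → ℤ → ℤ), f 0 0 = 0 →
      ∑ β : F.Root, (if F.base.IsPos β then f (F.coeff β i) (F.coeff β j) else 0) =
      f 1 1 * F.count₂ i j 1 1 + f 1 0 * F.count₂ i j 1 0 + f 0 1 * F.count₂ i j 0 1 := by
    intro f hf
    simp only [count₂, ← sum_rootInd]
    rw [Finset.mul_sum, Finset.mul_sum, Finset.mul_sum,
      ← Finset.sum_add_distrib, ← Finset.sum_add_distrib]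
    refine Finset.sum_congr rfl fun β _ => ?_
    by_cases hβ : F.base.IsPos β
    · have h1 := isPos_iff_coeff.mp hβ i
      have h2 := hi ▸ hμ β i
      have h3 := isPos_iff_coeff.mp hβ j
      have h4 := hj ▸ hμ β j
      have h5 : F.coeff β i = 0 ∨ F.coeff β i = 1 := by omega
      have h6 : F.coeff β j = 0 ∨ F.coeff β j = 1 := by omega
      rcases h5 with h | h <;> rcases h6 with h' | h' <;> simp [rootInd, hβ, h, h', hf]
    · have h1 : ¬ 0 < F.coeff β i := fun h => hβ (isPos_of_coeff_pos h)
      have h2 : ¬ 0 < F.coeff β j := fun h => hβ (isPos_of_coeff_pos h)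
      have h3 : F.coeff β i ≠ 1 := by omega
      have h4 : F.coeff β j ≠ 1 := by omega
      simp [rootInd, hβ, h3, h4]
  refine ⟨⟨?_, ?_⟩, ?_⟩
  · rw [sum_eq_two_mul_sum_pos _ (fun β => by rw [coeff_reflect_self]; simp),
      key (fun a _ => a * a) (by simp)]
    simp
  · rw [sum_eq_two_mul_sum_pos _ (fun β => by rw [coeff_reflect_self]; simp),
      key (fun a b => a * b) (by simp)]
    simp
  · rw [sum_eq_two_mul_sum_pos _ (fun β => by rw [coeff_reflect_self]; simp),
      key (fun _ b => b * b) (by simp)]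
    simp

/-- Three unknown numbers and three equations, from `B(ωᵢ, ωᵢ)`, `B(ωᵢ, ωⱼ)` and `B(ωⱼ, ωⱼ)`. -/
theorem IsHighest.count_bigrading (hμ : F.IsHighest μ) (hd : IsHighestData F.cartanMatrix s m c)
    (hi : m i = 1) (hj : m j = 1) (hx : F.IsCoweight i x d) (hy : F.IsCoweight j y d)
    (hsi : s i = 1) (hsj : s j = 1) (hh : F.IsFundamental i h) (hh' : F.IsFundamental j h') :
    (d * (F.count₂ i j 1 1 + F.count₂ i j 1 0) = x i * (1 + ∑ k, (c k : ℤ)) ∧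
    d * F.count₂ i j 1 1 = x j * (1 + ∑ k, (c k : ℤ))) ∧
    d * (F.count₂ i j 1 1 + F.count₂ i j 0 1) = y j * (1 + ∑ k, (c k : ℤ)) := by
  have hmi : F.coeff μ i = 1 := by rw [(hμ.coeff_eq_and_Q hd).1, hi]; rfl
  have hmj : F.coeff μ j = 1 := by rw [(hμ.coeff_eq_and_Q hd).1, hj]; rfl
  obtain ⟨⟨h1, h2⟩, h3⟩ := hμ.sum_coeff_mul_coeff hmi hmj
  have h4 := hx.sum_coeff_mul_coeff hh
  have h5 := hx.sum_coeff_mul_coeff hh'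
  have h6 := hy.sum_coeff_mul_coeff hh'
  rw [h1, (hμ.coeff_eq_and_Q hd).2, hμ.Q_eq hd, hsi] at h4
  rw [h2, (hμ.coeff_eq_and_Q hd).2, hμ.Q_eq hd, hsj] at h5
  rw [h3, (hμ.coeff_eq_and_Q hd).2, hμ.Q_eq hd, hsj] at h6
  push_cast at h4 h5 h6
  refine ⟨⟨?_, ?_⟩, ?_⟩ <;> linarith

end RootFrame

/-- Submodules with a complete system of projections form an internal direct sum. -/
theorem isInternal_of_projections {R M ι : Type*} [Ring R] [AddCommGroup M] [Module R M] [Fintype ι]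
    [DecidableEq ι] (V : ι → Submodule R M) (p : ι → M →ₗ[R] M) (h1 : ∀ k x, p k x ∈ V k)
    (h2 : ∀ k, ∀ x ∈ V k, p k x = x) (h3 : ∀ k l, k ≠ l → ∀ x ∈ V l, p k x = 0)
    (h4 : ∀ x, ∑ k, p k x = x) : DirectSum.IsInternal V := by
  rw [DirectSum.isInternal_submodule_iff_iSupIndep_and_iSup_eq_top]
  refine ⟨?_, ?_⟩
  · rw [iSupIndep_def]
    intro k
    rw [Submodule.disjoint_def]
    intro x hx hx'
    have h5 : ⨆ l, ⨆ (_ : l ≠ k), V l ≤ LinearMap.ker (p k) :=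
      iSup_le fun l => iSup_le fun hl y hy => h3 k l hl.symm y hy
    rw [← h2 k x hx]
    exact h5 hx'
  · rw [eq_top_iff]
    intro x _
    rw [← h4 x]
    exact Submodule.sum_mem _ fun k _ => Submodule.mem_iSup_of_mem k (h1 k x)

theorem one_add_add_sq_eq_zero {w : ℂ} (h1 : w ≠ 1) (h3 : w ^ 3 = 1) : 1 + w + w ^ 2 = 0 := by
  have : (w - 1) * (1 + w + w ^ 2) = 0 := by linear_combination h3
  exact (mul_eq_zero.mp this).resolve_left (sub_ne_zero.mpr h1)

/-! ### The automorphism of order three on root spaces -/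

namespace RootFrame

variable {g : Type*} [LieRing g] [LieAlgebra ℝ g] [Module.Finite ℝ g] [IsCompactSimple g]
  {n : ℕ} {F : RootFrame g n} {S : Triple g} {h : F.H} {δ : (F.H → ℂ) → ℂ}

theorem IsAdExp.baseChange_apply (hS : F.IsAdExp S h) {χ : F.H → ℂ} {v : ℂ ⊗[ℝ] g}
    (hv : v ∈ rootSpace F.H χ) :
    S.σl.baseChange ℂ v = Complex.exp (2 * Real.pi * Complex.I * χ h) • v := by
  obtain ⟨X, -, hX, hσ⟩ := hS
  have : S.σl = adExp X := LinearMap.ext hσ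
  rw [this]
  apply adExp_baseChange_apply
  rw [hX, map_smul, LinearMap.smul_apply, F.ad_apply_of_mem hv, smul_smul]

/-- The values of `δ` on the weights are integers, and `σ` is `exp (2π√-1 δ / 3)`. -/
def IsExponent (δ : (F.H → ℂ) → ℂ) (h : F.H) : Prop :=
  ∀ χ : Weight ℂ F.H (ℂ ⊗[ℝ] g), ∃ k : ℤ, δ χ = k ∧ 3 * χ h = k

/-- On the weight `χ` the automorphism is a cube root of unity `w`, and `1 - (1 + w + w²)/3` is `0`
if `w = 1` and `1` otherwise. -/
theorem IsAdExp.baseChange_id_sub_projK (hS : F.IsAdExp S h) (hδ : IsExponent δ h) :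
    (LinearMap.id - S.projK).baseChange ℂ = weightDiag F.H fun χ => notThree (δ χ) := by
  refine ext_rootSpace (H := F.H) fun χ v hv => ?_
  obtain ⟨k, hk, hk'⟩ := hδ χ
  have h1 := hS.baseChange_apply hv
  set w := Complex.exp (2 * Real.pi * Complex.I * χ h) with hw
  have h2 : (LinearMap.id - S.projK).baseChange ℂ v =
      v - (3⁻¹ : ℂ) • (v + w • v + (w ^ 2) • v) := by
    have h3 : (S.σl ∘ₗ S.σl).baseChange ℂ v = (w ^ 2) • v := by
      rw [LinearMap.baseChange_comp, LinearMap.comp_apply, h1, map_smul, h1, smul_smul, pow_two]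
    have h4 : (3⁻¹ : ℝ) • v = (3⁻¹ : ℂ) • v := by
      rw [← algebraMap_smul ℂ (3⁻¹ : ℝ) v]; simp
    rw [LinearMap.baseChange_sub, LinearMap.sub_apply, LinearMap.baseChange_id,
      Triple.projK, LinearMap.baseChange_smul, LinearMap.smul_apply, LinearMap.baseChange_add,
      LinearMap.baseChange_add, LinearMap.add_apply, LinearMap.add_apply, h1, h3,
      LinearMap.baseChange_id, LinearMap.id_apply]
    rw [← algebraMap_smul ℂ (3⁻¹ : ℝ) (v + w • v + w ^ 2 • v)]
    simp
  have hw3 : w ^ 3 = 1 := by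
    rw [hw, ← Complex.exp_nat_mul, Complex.exp_eq_one_iff]
    refine ⟨k, ?_⟩
    push_cast
    linear_combination (2 * Real.pi * Complex.I) * hk'
  rw [h2, weightDiag_apply hv, hk, notThree_intCast]
  split_ifs with hdvd
  · obtain ⟨l, rfl⟩ := hdvd
    have : w = 1 := by
      rw [hw, Complex.exp_eq_one_iff]
      refine ⟨l, ?_⟩
      push_cast at hk'
      linear_combination (2 * Real.pi * Complex.I / 3) * hk'
    rw [this, one_pow]
    module
  · have hw1 : w ≠ 1 := fun hw1 => by
      rw [hw, Complex.exp_eq_one_iff] at hw1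
      obtain ⟨l, hl⟩ := hw1
      refine hdvd ⟨l, ?_⟩
      have h5 : χ h = l := by
        apply mul_left_cancel₀ Complex.two_pi_I_ne_zero
        rw [hl, mul_comm]
      rw [h5] at hk'
      exact_mod_cast hk'.symm
    rw [show v + w • v + w ^ 2 • v = (1 + w + w ^ 2) • v by module,
      one_add_add_sq_eq_zero hw1 hw3]
    simp

theorem isotropy_iff {x : g} : x ∈ S.isotropy ↔ (LinearMap.id - S.projK : g →ₗ[ℝ] g) x = 0 := by
  rw [LinearMap.sub_apply, LinearMap.id_apply, sub_eq_zero]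
  constructor
  · intro hx
    have hx' : S.σ x = x := sub_eq_zero.mp hx
    rw [Triple.projK_apply, hx', hx']
    module
  · intro hx
    have : S.σ x = x := by
      rw [hx, Triple.projK_apply, map_smul, map_add, map_add, S.order_three]
      module
    exact sub_eq_zero.mpr this

theorem tangent_iff {x : g} : x ∈ S.tangent ↔ (LinearMap.id - S.projK : g →ₗ[ℝ] g) x = x := by
  rw [LinearMap.sub_apply, LinearMap.id_apply, sub_eq_self, Triple.mem_tangent, Triple.projK_apply,
    smul_eq_zero_iff_right (by norm_num)]

theorem IsAdExp.apply_iff (hS : F.IsAdExp S h) (hδ : IsExponent δ h) {x : g} (c : ℝ) :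
    (LinearMap.id - S.projK : g →ₗ[ℝ] g) x = c • x ↔
      (1 : ℂ) ⊗ₜ[ℝ] x ∈ weightSum F.H fun χ => notThree (δ χ) = c := by
  have key : (1 : ℂ) ⊗ₜ[ℝ] (LinearMap.id - S.projK : g →ₗ[ℝ] g) x =
      weightDiag F.H (fun χ => notThree (δ χ)) ((1 : ℂ) ⊗ₜ[ℝ] x) := by
    rw [← hS.baseChange_id_sub_projK hδ, LinearMap.baseChange_tmul]
  have key2 : (1 : ℂ) ⊗ₜ[ℝ] (c • x) = (c : ℂ) • ((1 : ℂ) ⊗ₜ[ℝ] x) := by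
    rw [TensorProduct.tmul_smul, ← algebraMap_smul ℂ c]; rfl
  constructor
  · intro hx
    apply mem_weightSum_of_weightDiag_eq
    rw [← key, hx, key2]
  · intro hx
    apply one_tmul_injective
    change (1 : ℂ) ⊗ₜ[ℝ] (LinearMap.id - S.projK : g →ₗ[ℝ] g) x = (1 : ℂ) ⊗ₜ[ℝ] (c • x)
    rw [key, weightDiag_of_mem_weightSum hx, key2]

theorem IsAdExp.mem_isotropy_iff (hS : F.IsAdExp S h) (hδ : IsExponent δ h) {x : g} :
    x ∈ S.isotropy ↔ (1 : ℂ) ⊗ₜ[ℝ] x ∈ weightSum F.H fun χ => notThree (δ χ) = 0 := by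
  rw [isotropy_iff]
  simpa using hS.apply_iff hδ (x := x) 0

theorem IsAdExp.mem_tangent_iff (hS : F.IsAdExp S h) (hδ : IsExponent δ h) {x : g} :
    x ∈ S.tangent ↔ (1 : ℂ) ⊗ₜ[ℝ] x ∈ weightSum F.H fun χ => notThree (δ χ) = 1 := by
  rw [tangent_iff]
  simpa using hS.apply_iff hδ (x := x) 1

variable {P : F.Root → Prop} {p : (F.H → ℂ) → Prop}

theorem IsAdExp.isotropy_eq (hS : F.IsAdExp S h) (hδ : IsExponent δ h) (hP : F.Describes P p)
    (hp : ∀ χ : Weight ℂ F.H (ℂ ⊗[ℝ] g), notThree (δ χ) = 0 ↔ (χ : F.H → ℂ) = 0 ∨ p χ) :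
    S.isotropy = F.t.toSubmodule ⊔ F.planes P := by
  apply le_antisymm
  · intro x hx
    rw [hS.mem_isotropy_iff hδ] at hx
    rw [show x = rePart ((1 : ℂ) ⊗ₜ[ℝ] x) by simp]
    refine F.mem_of_one_tmul_mem_weightSum (fun χ hχ v hv => ?_) hx
    rcases (hp χ).mp hχ with h0 | h0
    · rw [h0] at hv
      exact Submodule.mem_sup_left (F.rePart_mem_t (F.mem_H_of_mem_rootSpace_zero hv))
    · exact Submodule.mem_sup_right (hP.rePart_mem (mem_weightSum_of_mem h0 hv))
  · refine sup_le (fun x hx => ?_) (fun x hx => ?_)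
    · rw [hS.mem_isotropy_iff hδ]
      have h0 : (1 : ℂ) ⊗ₜ[ℝ] x ∈ rootSpace F.H (0 : F.H → ℂ) :=
        (zeroRootSubalgebra_eq_of_is_cartan ℂ (ℂ ⊗[ℝ] g) F.H).ge (F.one_tmul_mem hx)
      refine weightSum_mono (p := fun χ => χ = 0) (fun χ hχ => (hp χ).mpr (Or.inl hχ)) ?_
      exact mem_weightSum_of_mem (p := fun χ => χ = 0) rfl h0
    · rw [hS.mem_isotropy_iff hδ]
      exact weightSum_mono (fun χ hχ => (hp χ).mpr (Or.inr hχ)) (hP.one_tmul_mem hx)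

/-- The trace identity on opposite root spaces extends to the complexified bundle through
`compressedTrace_eq_killingForm`; restricted to real vectors, it is the hypothesis of `r_apply_eq`.
-/
theorem IsAdExp.isEigenbundle (hS : F.IsAdExp S h) (hδ : IsExponent δ h) (hP : F.Describes P p)
    (hp0 : ¬ p 0) (hp : ∀ χ : Weight ℂ F.H (ℂ ⊗[ℝ] g), p χ → notThree (δ χ) = 1)
    (hinv : ∀ χ ψ : Weight ℂ F.H (ℂ ⊗[ℝ] g), notThree (δ χ) = 0 → p ψ → p (χ + ψ))
    {c : ℝ} (hc : ∀ α : F.Root, p α.1 → ∀ x ∈ rootSpace F.H (α.1 : F.H → ℂ),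
      ∀ y ∈ rootSpace F.H (-(α.1 : F.H → ℂ)),
      compressedTrace (fun χ => notThree (δ χ)) x y = (c / 2 : ℂ) * killingForm ℂ (ℂ ⊗[ℝ] g) x y)
    {d : ℕ} (hd : F.count (fun α => p α.1) = d) :
    IsEigenbundle S (F.planes P) c d where
  le x hx := (hS.mem_tangent_iff hδ).mpr (weightSum_mono hp (hP.one_tmul_mem hx))
  invariant A hA X hX := by
    rw [hS.mem_isotropy_iff hδ] at hA
    rw [hP.mem_planes_iff] at hX ⊢
    have e : (1 : ℂ) ⊗ₜ[ℝ] ⁅A, X⁆ = ad ℂ (ℂ ⊗[ℝ] g) ((1 : ℂ) ⊗ₜ[ℝ] A) ((1 : ℂ) ⊗ₜ[ℝ] X) := by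
      rw [ad_apply, LieAlgebra.ExtendScalars.bracket_tmul, one_mul]
    rw [e]
    exact lie_mem_weightSum hinv hA hX
  apply_eq X hX := by
    apply S.r_apply_eq
    intro Y
    have hX' := hP.one_tmul_mem hX
    have key : weightSum F.H p ≤ LinearMap.ker
        (compressedTrace (fun χ => notThree (δ χ)) -
          (c / 2 : ℂ) • killingForm ℂ (ℂ ⊗[ℝ] g)) := by
      refine weightSum_le fun χ hχ x hx => ?_
      have hχ0 : χ ∈ F.H.root := by
        simp only [LieSubalgebra.root, Finset.mem_filter, Finset.mem_univ, true_and]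
        intro h0
        apply hp0
        have h1 : (χ : F.H → ℂ) = 0 := h0
        rwa [h1] at hχ
      rw [LinearMap.mem_ker]
      refine LinearMap.ext fun y => ?_
      rw [LinearMap.sub_apply, LinearMap.sub_apply, LinearMap.smul_apply, LinearMap.smul_apply,
        compressedTrace_eq_killingForm hx (hc ⟨χ, hχ0⟩ hχ x hx) y, smul_eq_mul, sub_self,
        LinearMap.zero_apply]
    have h1 := congrArg (fun φ => φ ((1 : ℂ) ⊗ₜ[ℝ] (Y : g))) (LinearMap.mem_ker.mp (key hX'))
    have h2 : compressedTrace (fun χ => notThree (δ χ)) ((1 : ℂ) ⊗ₜ[ℝ] (X : g))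
        ((1 : ℂ) ⊗ₜ[ℝ] (Y : g)) = (c / 2 : ℂ) * killingForm ℂ (ℂ ⊗[ℝ] g)
          ((1 : ℂ) ⊗ₜ[ℝ] (X : g)) ((1 : ℂ) ⊗ₜ[ℝ] (Y : g)) := sub_eq_zero.mp h1
    rw [killingForm_one_tmul, compressedTrace, LinearMap.mk₂_apply,
      ← hS.baseChange_id_sub_projK hδ, ← trace_compressed_ofReal] at h2
    exact_mod_cast h2
  finrank_eq := by
    classical
    rw [hP.finrank_planes hp0, ← hd, count]

theorem IsAdExp.isInternal (hS : F.IsAdExp S h) (hδ : IsExponent δ h) {N : ℕ}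
    {P : Fin N → F.Root → Prop} {p : Fin N → (F.H → ℂ) → Prop}
    (hP : ∀ k, F.Describes (P k) (p k))
    (hp : ∀ χ : Weight ℂ F.H (ℂ ⊗[ℝ] g), notThree (δ χ) = 1 → ∃ k, p k χ)
    (hp' : ∀ k, ∀ χ : Weight ℂ F.H (ℂ ⊗[ℝ] g), p k χ → notThree (δ χ) = 1)
    (hdisj : ∀ k l, k ≠ l → ∀ χ : Weight ℂ F.H (ℂ ⊗[ℝ] g), p k χ → ¬ p l χ) :
    DirectSum.IsInternal fun k => (F.planes (P k)).comap S.tangent.subtype := by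
  classical
  -- Complexify, project onto the weights satisfying `p k`, and take the real part. Complementarity
  -- of these maps is then a statement about `0`-`1` valued functions on weights.
  let q (k : Fin N) : g →ₗ[ℝ] g :=
    rePart ∘ₗ (weightDiag F.H (fun χ => if p k χ then 1 else 0)).restrictScalars ℝ ∘ₗ
      TensorProduct.mk ℝ ℂ g 1
  have hq : ∀ k x, q k x = rePart (weightDiag F.H (fun χ => if p k χ then (1 : ℂ) else 0)
    ((1 : ℂ) ⊗ₜ[ℝ] x)) := fun k x => rfl
  have hle : ∀ k, F.planes (P k) ≤ S.tangent := fun k x hx =>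
    (hS.mem_tangent_iff hδ).mpr (weightSum_mono (hp' k) ((hP k).one_tmul_mem hx))
  have h1 : ∀ k x, q k x ∈ F.planes (P k) := fun k x => by
    rw [hq]
    refine (hP k).rePart_mem ?_
    rw [mem_weightSum_iff_weightDiag, ← LinearMap.comp_apply]
    congr 1
    refine ext_rootSpace (H := F.H) fun χ v hv => ?_
    rw [LinearMap.comp_apply, weightDiag_apply hv, map_smul, weightDiag_apply hv, smul_smul]
    split_ifs <;> simp
  refine isInternal_of_projections _
    (fun k => (q k).restrict (p := S.tangent) (q := S.tangent) fun x _ => hle k (h1 k x))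
    (fun k x => h1 k x) (fun k x hx => ?_) (fun k l hkl x hx => ?_) fun x => ?_
  · apply Subtype.ext
    have h2 := mem_weightSum_iff_weightDiag.mp ((hP k).one_tmul_mem hx)
    rw [Submodule.subtype_apply] at h2
    rw [LinearMap.coe_restrict_apply, hq, h2]
    simp
  · apply Subtype.ext
    rw [LinearMap.coe_restrict_apply, hq]
    have h2 : (1 : ℂ) ⊗ₜ[ℝ] (x : g) ∈
        weightSum F.H fun χ => (if p k χ then (1 : ℂ) else 0) = 0 :=
      weightSum_mono (fun χ hχ => if_neg (hdisj l k hkl.symm χ hχ)) ((hP l).one_tmul_mem hx)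
    rw [weightDiag_of_mem_weightSum h2]
    simp
  · apply Subtype.ext
    rw [AddSubmonoidClass.coe_finsetSum]
    simp only [LinearMap.coe_restrict_apply, hq]
    rw [← map_sum, ← LinearMap.sum_apply]
    have h2 : ∑ k, weightDiag F.H (fun χ => if p k χ then (1 : ℂ) else 0) =
        weightDiag F.H fun χ => if notThree (δ χ) = 1 then (1 : ℂ) else 0 := by
      refine ext_rootSpace (H := F.H) fun χ v hv => ?_
      simp only [LinearMap.sum_apply, weightDiag_apply hv]
      rw [← Finset.sum_smul]
      congr 1
      split_ifs with hχ
      · obtain ⟨k, hk⟩ := hp χ hχ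
        rw [Finset.sum_eq_single k, if_pos hk]
        · intro l _ hl
          exact if_neg (hdisj k l hl.symm χ hk)
        · simp
      · exact Finset.sum_eq_zero fun k _ => if_neg fun hk => hχ (hp' k χ hk)
    rw [h2, mem_weightSum_iff_weightDiag.mp ((hS.mem_tangent_iff hδ).mp x.2)]
    simp

end RootFrame

theorem compressedTrace_comm {L : Type*} [LieRing L] [LieAlgebra ℂ L] [Module.Finite ℂ L]
    [IsKilling ℂ L] {H : LieSubalgebra ℂ L} [H.IsCartanSubalgebra] (f : (H → ℂ) → ℂ) (x y : L) :
    compressedTrace f x y = compressedTrace f y x := by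
  rw [compressedTrace, LinearMap.mk₂_apply, LinearMap.mk₂_apply, ← LinearMap.comp_assoc,
    LinearMap.trace_comp_comm']
  rfl

namespace RootFrame

variable {g : Type*} [LieRing g] [LieAlgebra ℝ g] [Module.Finite ℝ g] [IsCompactSimple g]
  {n : ℕ} {F : RootFrame g n} {S : Triple g} {h h' : F.H} {δ : (F.H → ℂ) → ℂ}
  {P P' : F.Root → Prop} {p : (F.H → ℂ) → Prop}

theorem root_neg_apply (α : F.Root) :
    ((F.reflect α α).1 : F.H → ℂ) = -(α.1 : F.H → ℂ) := by
  funext z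
  rw [reflect_apply, pair_self, Pi.neg_apply]
  push_cast
  ring

theorem eq_zero_or_root (χ : Weight ℂ F.H (ℂ ⊗[ℝ] g)) :
    (χ : F.H → ℂ) = 0 ∨ ∃ β : F.Root, β.1 = χ := by
  by_cases hχ : (χ : F.H → ℂ) = 0
  · exact Or.inl hχ
  · refine Or.inr ⟨⟨χ, ?_⟩, rfl⟩
    simp only [LieSubalgebra.root, Finset.mem_filter, Finset.mem_univ, true_and]
    exact hχ

theorem describes_of (h0 : ¬ p 0) (hneg : ∀ χ, p χ → p (-χ))
    (hP : ∀ α : F.Root, F.base.IsPos α → (P α ↔ p α.1)) : F.Describes P p := by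
  refine ⟨fun α hα hPα => ⟨(hP α hα).mp hPα, hneg _ ((hP α hα).mp hPα)⟩, fun χ hχ => ?_⟩
  rcases eq_zero_or_root χ with h | ⟨β, rfl⟩
  · rw [h] at hχ
    exact absurd hχ h0
  · by_cases hβ : F.base.IsPos β
    · exact ⟨β, hβ, (hP β hβ).mpr hχ, Or.inl rfl⟩
    · have h1 := (isPos_reflect_self β).mpr hβ
      refine ⟨F.reflect β β, h1, (hP _ h1).mpr ?_, Or.inr ?_⟩
      · rw [root_neg_apply]
        exact hneg _ hχ
      · rw [root_neg_apply, neg_neg]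

-- Negative roots follow from positive ones because the compressed trace is symmetric by cyclicity.
-- The roots come in pairs `±α`, hence the rank `2 * d`.
open Classical in
theorem IsAdExp.isEigenbundle_of_isPos (hS : F.IsAdExp S h) (hδ : IsExponent δ h)
    (hP : F.Describes P p) (hp0 : ¬ p 0)
    (hp : ∀ χ : Weight ℂ F.H (ℂ ⊗[ℝ] g), p χ → notThree (δ χ) = 1)
    (hinv : ∀ χ ψ : Weight ℂ F.H (ℂ ⊗[ℝ] g), notThree (δ χ) = 0 → p ψ → p (χ + ψ))
    {c : ℝ} (hc : ∀ α : F.Root, F.base.IsPos α → P α → ∀ x ∈ rootSpace F.H (α.1 : F.H → ℂ),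
      ∀ y ∈ rootSpace F.H (-(α.1 : F.H → ℂ)),
      compressedTrace (fun χ => notThree (δ χ)) x y = (c / 2 : ℂ) * killingForm ℂ (ℂ ⊗[ℝ] g) x y)
    {d : ℕ} (hd : F.count P' = d) (hP' : ∀ α : F.Root, P' α ↔ F.base.IsPos α ∧ P α) :
    IsEigenbundle S (F.planes P) c (2 * d) := by
  refine hS.isEigenbundle hδ hP hp0 hp hinv (fun α hα x hx y hy => ?_) ?_
  · obtain ⟨β, hβ, hPβ, h⟩ := hP.2 α.1 hα
    rcases h with h | h
    · rw [h] at hx hy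
      exact hc β hβ hPβ x hx y hy
    · rw [h] at hx hy
      rw [neg_neg] at hy
      rw [compressedTrace_comm, hc β hβ hPβ y hy x hx, LieModule.traceForm_comm]
  · have h1 := sum_eq_two_mul_sum_pos (rootInd fun α : F.Root => p α.1) fun β => by
      refine rootInd_congr ?_
      rw [root_neg_apply]
      have key : ∀ β : F.Root, p β.1 → p (-(β.1 : F.H → ℂ)) := fun β hβ => by
        obtain ⟨γ, hγ, hPγ, h⟩ := hP.2 β.1 hβ
        rcases h with h | h <;> rw [h]
        · exact (hP.1 γ hγ hPγ).2
        · rw [neg_neg]; exact (hP.1 γ hγ hPγ).1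
      refine ⟨fun h => ?_, key β⟩
      have := key (F.reflect β β) (by rwa [root_neg_apply])
      rwa [root_neg_apply, neg_neg] at this
    have h2 : ∀ β : F.Root, (if F.base.IsPos β then rootInd (fun α : F.Root => p α.1) β else 0) =
        rootInd P' β := fun β => by
      by_cases hβ : F.base.IsPos β
      · rw [if_pos hβ]
        refine rootInd_congr ?_
        rw [hP']
        refine ⟨fun h => ⟨hβ, ?_⟩, fun h => (hP.1 β h.1 h.2).1⟩
        obtain ⟨γ, hγ, hPγ, h'⟩ := hP.2 β.1 h
        rcases h' with h' | h'
        · have : β = γ := Subtype.ext (DFunLike.coe_injective h')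
          rwa [this]
        · rw [← root_neg_apply] at h'
          have : β = F.reflect γ γ := Subtype.ext (DFunLike.coe_injective h')
          rw [this, isPos_reflect_self] at hβ
          exact absurd hγ hβ
      · rw [if_neg hβ, rootInd, if_neg]
        rw [hP']
        exact fun h => hβ h.1
    simp_rw [h2] at h1
    rw [sum_rootInd, sum_rootInd, hd] at h1
    exact_mod_cast h1

end RootFrame

/-! ### Type `A₃III` from Cartan matrix data -/

namespace RootFrame

variable {g : Type*} [LieRing g] [LieAlgebra ℝ g] [Module.Finite ℝ g] [IsCompactSimple g]
  {n : ℕ} {F : RootFrame g n} {S : Triple g} {μ : F.Root} {s m c : Fin n → ℕ} {i j : Fin n}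
  {x y : Fin n → ℤ} {d : ℤ} {h h' : F.H}

theorem weight_smul (χ : Weight ℂ F.H (ℂ ⊗[ℝ] g)) (z : ℂ) (h : F.H) : χ (z • h) = z * χ h :=
  map_smul (Weight.toLinear ℂ F.H _ χ) z h

theorem weight_add (χ : Weight ℂ F.H (ℂ ⊗[ℝ] g)) (h h' : F.H) : χ (h + h') = χ h + χ h' :=
  map_add (Weight.toLinear ℂ F.H _ χ) h h'

theorem IsFundamental.ind_eq (hh : F.IsFundamental i h) (v : ℤ) (β : F.Root) :
    ind (fun χ => χ h = v) (β.1 : F.H → ℂ) = rootInd (fun β : F.Root => F.coeff β i = v) β := by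
  have e : (β.1 : F.H → ℂ) h = v ↔ F.coeff β i = v := by
    rw [hh.apply]
    exact Int.cast_inj
  by_cases hv : F.coeff β i = v
  · rw [ind, rootInd, if_pos hv, if_pos (e.mpr hv)]; simp
  · rw [ind, rootInd, if_neg hv, if_neg (mt e.mp hv)]; simp

theorem IsHighest.isGrading (hμ : F.IsHighest μ) (hi : F.coeff μ i = 2) (hh : F.IsFundamental i h) :
    IsGrading (L := ℂ ⊗[ℝ] g) h := fun χ => by
  rcases eq_zero_or_root χ with h0 | ⟨β, rfl⟩
  · exact ⟨0, by rw [h0]; simp, by norm_num, by norm_num⟩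
  · have h1 := hμ β i
    have h2 := hμ.neg_le β i
    rw [hi] at h1 h2
    exact ⟨F.coeff β i, hh.apply β, h2, h1⟩

theorem kappa_half (l : ℕ) : ((l * F.kappa μ : ℝ) / 2 : ℂ) = 2 * ((l / F.Q μ : ℚ) : ℂ) := by
  rw [kappa_eq]
  push_cast
  ring

theorem describes_coeff (hh : F.IsFundamental i h) {v : ℤ} (hv : v ≠ 0) (hv0 : 0 ≤ v) :
    F.Describes (fun α => F.coeff α i = v) fun χ => χ h = v ∨ χ h = -v := by
  have hv' : (v : ℂ) ≠ 0 := by exact_mod_cast hv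
  refine describes_of ?_ ?_ fun α hα => ?_
  · rintro (h | h)
    · exact hv' h.symm
    · exact hv' (by rw [Pi.zero_apply] at h; linear_combination h)
  · rintro χ (h | h)
    · right; rw [Pi.neg_apply, h]
    · left; rw [Pi.neg_apply, h, neg_neg]
  · have h1 := isPos_iff_coeff.mp hα i
    rw [hh.apply]
    norm_cast
    omega

open Classical in
theorem IsHighest.typeIII (hμ : F.IsHighest μ) (hd : IsHighestData F.cartanMatrix s m c)
    (hx : F.IsCoweight i x d) (hd0 : d ≠ 0) (hx0 : x i ≠ 0) {a₁ a₂ l k : ℕ}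
    (e1 : d * (a₁ + 4 * a₂) = x i * s i * (1 + ∑ k, (c k : ℤ)))
    (e2 : d * (a₁ + 2 * a₂) = 2 * ∑ j, x j)
    (hl : 2 * d * a₁ = x i * s i * l) (hk : 2 * d * (2 * a₂) = x i * s i * k)
    (hT : F.IsTypeIII μ i S) :
    S.isotropy = F.t.toSubmodule ⊔ F.planes (fun α => F.coeff α i = 0) ∧
    DirectSum.IsInternal
      ![(F.planes fun α => F.coeff α i = 2).comap S.tangent.subtype,
        (F.planes fun α => F.coeff α i = 1).comap S.tangent.subtype] ∧
    IsEigenbundle S (F.planes fun α => F.coeff α i = 2) (l * F.kappa μ) (2 * a₂) ∧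
    IsEigenbundle S (F.planes fun α => F.coeff α i = 1) (k * F.kappa μ) (2 * a₁) := by
  obtain ⟨hi, Hi, hHi, hS⟩ := hT
  have hm : m i = 2 := by
    have := (hμ.coeff_eq_and_Q hd).1 i
    rw [hi] at this
    exact_mod_cast this.symm
  -- Since `mᵢ = 2`, the vector `2Hᵢ` is the fundamental coweight, and `σ` acts on `g_α` by `exp
  -- (2π√-1 nᵢ(α) / 3)`.
  set h : F.H := (2 : ℂ) • Hi
  have hh : F.IsFundamental i h := fun k => by
    rw [weight_smul, hHi, hi]
    split_ifs <;> norm_num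
  obtain ⟨f1, f2⟩ := hμ.count_grading hd hx hh hm
  -- The true numbers of roots satisfy the same nonsingular system as `a₁` and `a₂`.
  have hN2 : (F.count fun β => F.coeff β i = 2) = a₂ := by
    have h1 := mul_left_cancel₀ hd0 (f1.trans e1.symm)
    have h2 := mul_left_cancel₀ hd0 (f2.trans e2.symm)
    omega
  have hN1 : (F.count fun β => F.coeff β i = 1) = a₁ := by
    have h2 := mul_left_cancel₀ hd0 (f2.trans e2.symm)
    omega
  have hgr := hμ.isGrading hi hh
  have hδ : IsExponent (fun χ => χ h) ((2 / 3 : ℂ) • Hi) := fun χ => by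
    obtain ⟨k, hk, -⟩ := hgr χ
    refine ⟨k, hk, ?_⟩
    rw [← hk, weight_smul, weight_smul]
    ring
  have hnt : ∀ χ : Weight ℂ F.H (ℂ ⊗[ℝ] g), (notThree (χ h) = 0 ∧ χ h = 0) ∨
      (notThree (χ h) = 1 ∧ (χ h = 1 ∨ χ h = -1 ∨ χ h = 2 ∨ χ h = -2)) := fun χ => by
    obtain ⟨k, hk, h1, h2⟩ := hgr χ
    rw [hk, notThree_intCast]
    clear hk
    interval_cases k <;> norm_num
  have hd1 := describes_coeff hh (v := 1) (by norm_num) (by norm_num)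
  have hd2 := describes_coeff hh (v := 2) (by norm_num) (by norm_num)
  have hnz : ∀ χ : Weight ℂ F.H (ℂ ⊗[ℝ] g), notThree (χ h) = 0 → χ h = 0 := fun χ h0 => by
    rcases hnt χ with h | h
    · exact h.2
    · rw [h.1] at h0; exact absurd h0 one_ne_zero
  have hn1 : ∀ χ : Weight ℂ F.H (ℂ ⊗[ℝ] g), χ h ≠ 0 → notThree (χ h) = 1 := fun χ h0 => by
    rcases hnt χ with h | h
    · exact absurd h.2 h0
    · exact h.1
  have hp1 : ∀ χ : Weight ℂ F.H (ℂ ⊗[ℝ] g), (χ h = (1 : ℤ) ∨ χ h = -(1 : ℤ)) →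
      notThree (χ h) = 1 := fun χ h0 => hn1 χ (by rcases h0 with h0 | h0 <;> rw [h0] <;> norm_num)
  have hp2 : ∀ χ : Weight ℂ F.H (ℂ ⊗[ℝ] g), (χ h = (2 : ℤ) ∨ χ h = -(2 : ℤ)) →
      notThree (χ h) = 1 := fun χ h0 => hn1 χ (by rcases h0 with h0 | h0 <;> rw [h0] <;> norm_num)
  have hinv : ∀ v : ℤ, ∀ χ ψ : Weight ℂ F.H (ℂ ⊗[ℝ] g), notThree (χ h) = 0 →
      (ψ h = v ∨ ψ h = -v) → ((χ + ψ : F.H → ℂ) h = v ∨ (χ + ψ : F.H → ℂ) h = -v) := by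
    intro v χ ψ h0 h1
    rw [Pi.add_apply, hnz χ h0, zero_add]
    exact h1
  refine ⟨?_, ?_, ?_, ?_⟩
  · refine hS.isotropy_eq hδ (p := fun χ => χ ≠ 0 ∧ χ h = 0) (describes_of ?_ ?_ ?_) ?_
    · exact fun h => h.1 rfl
    · rintro χ ⟨h1, h2⟩
      exact ⟨neg_ne_zero.mpr h1, by rw [Pi.neg_apply, h2, neg_zero]⟩
    · intro α hα
      have h0 : (α.1 : F.H → ℂ) ≠ 0 := by
        have := α.2
        simp only [LieSubalgebra.root, Finset.mem_filter, Finset.mem_univ, true_and] at this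
        exact this
      rw [hh.apply]
      simp [h0]
    · intro χ
      constructor
      · intro h0
        by_cases hχ : (χ : F.H → ℂ) = 0
        · exact Or.inl hχ
        · exact Or.inr ⟨hχ, hnz χ h0⟩
      · rintro (h0 | h0)
        · rw [h0, Pi.zero_apply]
          simpa using notThree_intCast 0
        · rw [h0.2]
          simpa using notThree_intCast 0
  · have h1 := hS.isInternal hδ (N := 2) (P := ![fun α => F.coeff α i = 2, fun α => F.coeff α i = 1])
      (p := ![fun χ => χ h = (2 : ℤ) ∨ χ h = -(2 : ℤ), fun χ => χ h = (1 : ℤ) ∨ χ h = -(1 : ℤ)])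
      (by rw [Fin.forall_fin_two]; exact ⟨hd2, hd1⟩)
      (fun χ hχ => by
        rw [Fin.exists_fin_two]
        rcases hnt χ with h0 | h0
        · rw [h0.1] at hχ; exact absurd hχ zero_ne_one
        · simpa using by tauto)
      (by rw [Fin.forall_fin_two]; exact ⟨hp2, hp1⟩)
      (by
        intro k l hkl χ
        fin_cases k <;> fin_cases l
        · exact absurd rfl hkl
        · change (χ h = (2 : ℤ) ∨ χ h = -(2 : ℤ)) → ¬ (χ h = (1 : ℤ) ∨ χ h = -(1 : ℤ))
          rintro (h0 | h0) <;> rw [h0] <;> norm_num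
        · change (χ h = (1 : ℤ) ∨ χ h = -(1 : ℤ)) → ¬ (χ h = (2 : ℤ) ∨ χ h = -(2 : ℤ))
          rintro (h0 | h0) <;> rw [h0] <;> norm_num
        · exact absurd rfl hkl)
    convert h1 using 1
    funext k
    fin_cases k <;> rfl
  · refine hS.isEigenbundle_of_isPos hδ hd2 ?_ hp2 (hinv 2) ?_ hN2 (fun α => ?_)
    · norm_num
    · intro α hα hα2 x' hx' y' hy'
      have hα' : α.1 h = 2 := by rw [hh.apply, hα2]; norm_num
      rw [compressedTrace_of_grading_two hgr hα' hx' hy', kappa_half]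
      have h1 := rootSum_eq_pairSum (hh.ind_eq 1) α
      rw [Int.cast_one] at h1
      rw [h1, hμ.pairSum_rootInd hd hx (l := l) hx0 (by rw [hN1, one_mul]; exact_mod_cast hl), hα2]
      push_cast
      ring
    · exact ⟨fun h => ⟨isPos_of_coeff_pos (k := i) (by omega), h⟩, fun h => h.2⟩
  · refine hS.isEigenbundle_of_isPos hδ hd1 ?_ hp1 (hinv 1) ?_ hN1 (fun α => ?_)
    · norm_num
    · intro α hα hα1 x' hx' y' hy'
      have hα' : α.1 h = 1 := by rw [hh.apply, hα1]; norm_num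
      rw [compressedTrace_of_grading_one hgr hα' hx' hy', kappa_half]
      have h1 := rootSum_eq_pairSum (hh.ind_eq 2) α
      rw [Int.cast_two] at h1
      rw [h1, hμ.pairSum_rootInd hd hx (l := k) hx0 (by rw [hN2]; exact_mod_cast hk), hα1]
      push_cast
      ring
    · exact ⟨fun h => ⟨isPos_of_coeff_pos (k := i) (by omega), h⟩, fun h => h.2⟩

end RootFrame

/-! ### Type `A₃II` from Cartan matrix data -/

namespace RootFrame

variable {g : Type*} [LieRing g] [LieAlgebra ℝ g] [Module.Finite ℝ g] [IsCompactSimple g]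
  {n : ℕ} {F : RootFrame g n} {S : Triple g} {μ : F.Root} {s m c : Fin n → ℕ} {i j : Fin n}
  {x y : Fin n → ℤ} {d : ℤ} {h h' : F.H}

theorem ind_eq_rootInd (hh : F.IsFundamental i h) (hh' : F.IsFundamental j h') (v w : ℤ)
    (β : F.Root) : ind (fun χ => χ h = v ∧ χ h' = w) (β.1 : F.H → ℂ) =
      rootInd (fun β : F.Root => F.coeff β i = v ∧ F.coeff β j = w) β := by
  have e : ((β.1 : F.H → ℂ) h = v ∧ (β.1 : F.H → ℂ) h' = w) ↔
      F.coeff β i = v ∧ F.coeff β j = w := by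
    rw [hh.apply, hh'.apply, Int.cast_inj, Int.cast_inj]
  by_cases hv : F.coeff β i = v ∧ F.coeff β j = w
  · rw [ind, rootInd, if_pos hv, if_pos (e.mpr hv)]; simp
  · rw [ind, rootInd, if_neg hv, if_neg (mt e.mp hv)]; simp

/-- The coefficients of a root never have opposite signs, which excludes the bidegrees `±(1, -1)`.
-/
theorem IsHighest.isBigrading (hμ : F.IsHighest μ) (hi : F.coeff μ i = 1) (hj : F.coeff μ j = 1)
    (hh : F.IsFundamental i h) (hh' : F.IsFundamental j h') :
    IsBigrading (L := ℂ ⊗[ℝ] g) h h' := fun χ => by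
  rcases eq_zero_or_root χ with h0 | ⟨β, rfl⟩
  · exact ⟨0, 0, by rw [h0]; simp, by rw [h0]; simp, by norm_num⟩
  · have h1 := hμ β i
    have h2 := hμ.neg_le β i
    have h3 := hμ β j
    have h4 := hμ.neg_le β j
    rw [hi] at h1 h2
    rw [hj] at h3 h4
    refine ⟨F.coeff β i, F.coeff β j, hh.apply β, hh'.apply β, ?_⟩
    rcases coeff_nonneg_or_nonpos β with h | h
    · have := h i
      have := h j
      omega
    · have := h i
      have := h j
      omega

/-- The weights with values `±(v, w)` at `(h, h')`. -/
def pm (h h' : F.H) (v w : ℤ) (χ : F.H → ℂ) : Prop :=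
  (χ h = v ∧ χ h' = w) ∨ (χ h = -v ∧ χ h' = -w)

theorem pm_iff {χ : F.H → ℂ} {a b v w : ℤ} (ha : χ h = a) (hb : χ h' = b) :
    pm h h' v w χ ↔ (a = v ∧ b = w) ∨ (a = -v ∧ b = -w) := by
  rw [pm, ha, hb]
  norm_cast

theorem describes_coeff₂ (hh : F.IsFundamental i h) (hh' : F.IsFundamental j h') {v w : ℤ}
    (h0 : ¬ (v = 0 ∧ w = 0)) (hv0 : 0 ≤ v) (hw0 : 0 ≤ w) :
    F.Describes (fun α => F.coeff α i = v ∧ F.coeff α j = w) (pm h h' v w) := by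
  refine describes_of ?_ ?_ fun α hα => ?_
  · rw [pm_iff (a := 0) (b := 0) (by simp) (by simp)]
    omega
  · rintro χ (⟨h, h'⟩ | ⟨h, h'⟩)
    · right; rw [Pi.neg_apply, Pi.neg_apply, h, h']; exact ⟨rfl, rfl⟩
    · left; rw [Pi.neg_apply, Pi.neg_apply, h, h', neg_neg, neg_neg]; exact ⟨rfl, rfl⟩
  · have h1 := isPos_iff_coeff.mp hα i
    have h2 := isPos_iff_coeff.mp hα j
    rw [pm_iff (hh.apply α) (hh'.apply α)]
    omega

theorem rootInd_reflect₂ {v w : ℤ} {k : Fin n} (hi : k ≠ i) (hj : k ≠ j) (β : F.Root) :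
    rootInd (fun β => F.coeff β i = v ∧ F.coeff β j = w) (F.reflect (F.simpleRoot k) β) =
      rootInd (fun β => F.coeff β i = v ∧ F.coeff β j = w) β :=
  rootInd_congr (by rw [coeff_reflect_simpleRoot_of_ne hi.symm,
    coeff_reflect_simpleRoot_of_ne hj.symm])

theorem sum_rootInd_coeff (v w : ℤ) :
    (∑ β : F.Root, rootInd (fun β => F.coeff β i = v ∧ F.coeff β j = w) β * F.coeff β i =
      v * F.count₂ i j v w) ∧
    ∑ β : F.Root, rootInd (fun β => F.coeff β i = v ∧ F.coeff β j = w) β * F.coeff β j =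
      w * F.count₂ i j v w :=
  ⟨sum_rootInd_mul fun _ h => h.1, sum_rootInd_mul fun _ h => h.2⟩

open Classical in
theorem IsHighest.typeII (hμ : F.IsHighest μ) (hd : IsHighestData F.cartanMatrix s m c)
    (hsi : s i = 1) (hsj : s j = 1) (hx : F.IsCoweight i x d) (hy : F.IsCoweight j y d)
    (hd0 : d ≠ 0) (hD : x i * y j - x j * y i ≠ 0) {a₁ a₂ a₃ l k r : ℕ}
    (e1 : d * (a₁ + a₂) = x i * (1 + ∑ k, (c k : ℤ)))
    (e2 : d * a₁ = x j * (1 + ∑ k, (c k : ℤ)))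
    (e3 : d * (a₁ + a₃) = y j * (1 + ∑ k, (c k : ℤ)))
    (hl : d * (a₂ * (y j - y i) + a₃ * (x i - x j)) = (x i * y j - x j * y i) * l)
    (hk : 2 * d * (a₁ * (y j - x j)) = (x i * y j - x j * y i) * k)
    (hr : 2 * d * (a₁ * (x i - y i)) = (x i * y j - x j * y i) * r)
    (hT : F.IsTypeII μ i j S) :
    S.isotropy = F.t.toSubmodule ⊔ F.planes (fun α => F.coeff α i = 0 ∧ F.coeff α j = 0) ∧
    DirectSum.IsInternal
      ![(F.planes fun α => F.coeff α i = 1 ∧ F.coeff α j = 1).comap S.tangent.subtype,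
        (F.planes fun α => F.coeff α i = 1 ∧ F.coeff α j = 0).comap S.tangent.subtype,
        (F.planes fun α => F.coeff α i = 0 ∧ F.coeff α j = 1).comap S.tangent.subtype] ∧
    IsEigenbundle S (F.planes fun α => F.coeff α i = 1 ∧ F.coeff α j = 1)
      (l * F.kappa μ) (2 * a₁) ∧
    IsEigenbundle S (F.planes fun α => F.coeff α i = 1 ∧ F.coeff α j = 0)
      (k * F.kappa μ) (2 * a₂) ∧
    IsEigenbundle S (F.planes fun α => F.coeff α i = 0 ∧ F.coeff α j = 1)
      (r * F.kappa μ) (2 * a₃) := by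
  obtain ⟨hij, hi, hj, h, h', hHi, hHj, hS⟩ := hT
  have hmi : m i = 1 := by
    have := (hμ.coeff_eq_and_Q hd).1 i
    rw [hi] at this
    exact_mod_cast this.symm
  have hmj : m j = 1 := by
    have := (hμ.coeff_eq_and_Q hd).1 j
    rw [hj] at this
    exact_mod_cast this.symm
  have hh : F.IsFundamental i h := fun k => by
    rw [hHi, hi]
    split_ifs <;> norm_num
  have hh' : F.IsFundamental j h' := fun k => by
    rw [hHj, hj]
    split_ifs <;> norm_num
  obtain ⟨⟨f1, f2⟩, f3⟩ := hμ.count_bigrading hd hmi hmj hx hy hsi hsj hh hh'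
  have hN1 : F.count₂ i j 1 1 = a₁ := by
    have h1 := mul_left_cancel₀ hd0 (f2.trans e2.symm)
    omega
  have hN2 : F.count₂ i j 1 0 = a₂ := by
    have h1 := mul_left_cancel₀ hd0 (f1.trans e1.symm)
    omega
  have hN3 : F.count₂ i j 0 1 = a₃ := by
    have h1 := mul_left_cancel₀ hd0 (f3.trans e3.symm)
    omega
  have hgr := hμ.isBigrading hi hj hh hh'
  have hδ : IsExponent (fun χ => χ h + χ h') ((1 / 3 : ℂ) • (h + h')) := fun χ => by
    obtain ⟨a, b, ha, hb, -⟩ := hgr χ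
    refine ⟨a + b, by simp only [ha, hb, Int.cast_add], ?_⟩
    push_cast
    rw [← ha, ← hb, weight_smul, weight_add]
    ring
  have hnt : ∀ χ : Weight ℂ F.H (ℂ ⊗[ℝ] g),
      (notThree (χ h + χ h') = 0 ∧ χ h = 0 ∧ χ h' = 0) ∨ (notThree (χ h + χ h') = 1 ∧
        (pm h h' 1 1 χ ∨ pm h h' 1 0 χ ∨ pm h h' 0 1 χ)) := fun χ => by
    obtain ⟨a, b, ha, hb, h1, h2, h3, h4, h5, h6⟩ := hgr χ
    have e : notThree (χ h + χ h') = if (3 : ℤ) ∣ a + b then 0 else 1 := by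
      rw [← notThree_intCast, ha, hb]; push_cast; rfl
    rw [e, pm_iff ha hb, pm_iff ha hb, pm_iff ha hb, ha, hb]
    clear ha hb e
    interval_cases a <;> interval_cases b <;> first | omega | norm_num
  have hn1 : ∀ v w : ℤ, ¬ (v = 0 ∧ w = 0) → ∀ χ : Weight ℂ F.H (ℂ ⊗[ℝ] g), pm h h' v w χ →
      notThree (χ h + χ h') = 1 := fun v w hvw χ hχ => by
    rcases hnt χ with h0 | h0
    · rw [pm_iff (a := 0) (b := 0) (by simpa using h0.2.1) (by simpa using h0.2.2)] at hχ
      omega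
    · exact h0.1
  have hnz : ∀ χ : Weight ℂ F.H (ℂ ⊗[ℝ] g), notThree (χ h + χ h') = 0 → χ h = 0 ∧ χ h' = 0 :=
    fun χ h0 => by
      rcases hnt χ with h1 | h1
      · exact h1.2
      · rw [h1.1] at h0; exact absurd h0 one_ne_zero
  have hinv : ∀ v w : ℤ, ∀ χ ψ : Weight ℂ F.H (ℂ ⊗[ℝ] g), notThree (χ h + χ h') = 0 →
      pm h h' v w ψ → pm h h' v w (χ + ψ) := by
    intro v w χ ψ h0 h1
    rw [pm, Pi.add_apply, Pi.add_apply, (hnz χ h0).1, (hnz χ h0).2, zero_add, zero_add]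
    exact h1
  have hp0 : ∀ v w : ℤ, ¬ (v = 0 ∧ w = 0) → ¬ pm h h' v w 0 := fun v w hvw => by
    rw [pm_iff (a := 0) (b := 0) (by simp) (by simp)]
    omega
  have hd11 := describes_coeff₂ hh hh' (v := 1) (w := 1) (by norm_num) (by norm_num) (by norm_num)
  have hd10 := describes_coeff₂ hh hh' (v := 1) (w := 0) (by norm_num) (by norm_num) (by norm_num)
  have hd01 := describes_coeff₂ hh hh' (v := 0) (w := 1) (by norm_num) (by norm_num) (by norm_num)
  have hD' : (x i * y j - x j * y i : ℚ) ≠ 0 := by exact_mod_cast hD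
  have hQ := Q_ne_zero μ
  -- One formula serves two bundles: bidegree `(1, 0)` of `α` selects `k`, and `(0, 1)` selects `r`.
  have hPS : ∀ α : F.Root, pairSum (rootInd fun β : F.Root => F.coeff β i = 1 ∧ F.coeff β j = 1) α =
      (F.coeff α i * k + F.coeff α j * r) / F.Q μ := fun α => by
    rw [eq_div_iff hQ]
    apply mul_left_cancel₀ hD'
    rw [hμ.pairSum_of_invariant hd hij.ne hsi hsj hx hy (fun k => rootInd_reflect₂)
      (sum_rootInd_coeff 1 1).1 (sum_rootInd_coeff 1 1).2, hN1]
    have hk' : 2 * d * (a₁ * (y j - x j)) = ((x i * y j - x j * y i) * k : ℚ) := by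
      exact_mod_cast hk
    have hr' : 2 * d * (a₁ * (x i - y i)) = ((x i * y j - x j * y i) * r : ℚ) := by
      exact_mod_cast hr
    push_cast
    linear_combination F.coeff α i * hk' + F.coeff α j * hr'
  refine ⟨?_, ?_, ?_, ?_, ?_⟩
  · refine hS.isotropy_eq hδ (p := fun χ => χ ≠ 0 ∧ χ h = 0 ∧ χ h' = 0) (describes_of ?_ ?_ ?_) ?_
    · exact fun h => h.1 rfl
    · rintro χ ⟨h1, h2, h3⟩
      exact ⟨neg_ne_zero.mpr h1, by rw [Pi.neg_apply, h2, neg_zero],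
        by rw [Pi.neg_apply, h3, neg_zero]⟩
    · intro α hα
      have h0 : (α.1 : F.H → ℂ) ≠ 0 := by
        have := α.2
        simp only [LieSubalgebra.root, Finset.mem_filter, Finset.mem_univ, true_and] at this
        exact this
      rw [hh.apply, hh'.apply]
      simp [h0]
    · intro χ
      constructor
      · intro h0
        by_cases hχ : (χ : F.H → ℂ) = 0
        · exact Or.inl hχ
        · exact Or.inr ⟨hχ, hnz χ h0⟩
      · rintro (h0 | h0)
        · rw [h0, Pi.zero_apply, Pi.zero_apply, add_zero]
          simpa using notThree_intCast 0
        · rw [h0.2.1, h0.2.2, add_zero]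
          simpa using notThree_intCast 0
  · have h1 := hS.isInternal hδ (N := 3)
      (P := ![fun α => F.coeff α i = 1 ∧ F.coeff α j = 1, fun α => F.coeff α i = 1 ∧ F.coeff α j = 0,
        fun α => F.coeff α i = 0 ∧ F.coeff α j = 1])
      (p := ![pm h h' 1 1, pm h h' 1 0, pm h h' 0 1])
      (by
        intro k
        fin_cases k
        exacts [hd11, hd10, hd01])
      (fun χ hχ => by
        rcases hnt χ with h0 | ⟨-, h0 | h0 | h0⟩
        · rw [h0.1] at hχ; exact absurd hχ zero_ne_one
        · exact ⟨0, h0⟩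
        · exact ⟨1, h0⟩
        · exact ⟨2, h0⟩)
      (by
        intro k
        fin_cases k
        exacts [hn1 1 1 (by norm_num), hn1 1 0 (by norm_num), hn1 0 1 (by norm_num)])
      (by
        have key : ∀ v w v' w' : ℤ, ¬ (v = v' ∧ w = w') → ¬ (v = -v' ∧ w = -w') →
            ∀ χ : Weight ℂ F.H (ℂ ⊗[ℝ] g), pm h h' v w χ → ¬ pm h h' v' w' χ := by
          intro v w v' w' h1 h2 χ hχ
          obtain ⟨a, b, ha, hb, -⟩ := hgr χ
          rw [pm_iff ha hb] at hχ ⊢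
          omega
        intro k l hkl
        fin_cases k <;> fin_cases l <;>
          first
          | exact absurd rfl hkl
          | exact key _ _ _ _ (by norm_num) (by norm_num))
    convert h1 using 1
    funext k
    fin_cases k <;> rfl
  · refine hS.isEigenbundle_of_isPos hδ hd11 (hp0 1 1 (by norm_num)) (hn1 1 1 (by norm_num))
      (hinv 1 1) ?_ hN1 (fun α => ?_)
    · intro α hα hα1 x' hx' y' hy'
      have hαi : α.1 h = 1 := by rw [hh.apply, hα1.1]; norm_num
      have hαj : α.1 h' = 1 := by rw [hh'.apply, hα1.2]; norm_num
      rw [compressedTrace_of_bigrading_two hgr hαi hαj hx' hy', kappa_half]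
      have h1 := rootSum_eq_pairSum (ind_eq_rootInd hh hh' 1 0) α
      have h2 := rootSum_eq_pairSum (ind_eq_rootInd hh hh' 0 1) α
      rw [Int.cast_one, Int.cast_zero] at h1 h2
      have h3 := hμ.pairSum_of_invariant hd hij.ne hsi hsj hx hy (fun k => rootInd_reflect₂)
        (sum_rootInd_coeff 1 0).1 (sum_rootInd_coeff 1 0).2 α
      have h4 := hμ.pairSum_of_invariant hd hij.ne hsi hsj hx hy (fun k => rootInd_reflect₂)
        (sum_rootInd_coeff 0 1).1 (sum_rootInd_coeff 0 1).2 α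
      have h5 : pairSum (rootInd fun β : F.Root => F.coeff β i = 1 ∧ F.coeff β j = 0) α +
          pairSum (rootInd fun β : F.Root => F.coeff β i = 0 ∧ F.coeff β j = 1) α =
            2 * (l / F.Q μ : ℚ) := by
        have hl' : d * (a₂ * (y j - y i) + a₃ * (x i - x j)) =
          ((x i * y j - x j * y i) * l : ℚ) := by exact_mod_cast hl
        rw [hN2] at h3
        rw [hN3] at h4
        rw [hα1.1, hα1.2] at h3 h4
        push_cast at h3 h4
        rw [← mul_div_assoc, eq_div_iff hQ]
        apply mul_left_cancel₀ hD'
        linear_combination h3 + h4 + 2 * hl'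
      rw [h1, h2, ← Rat.cast_add, h5]
      push_cast
      ring
    · exact ⟨fun h => ⟨isPos_of_coeff_pos (k := i) (by omega), h⟩, fun h => h.2⟩
  · refine hS.isEigenbundle_of_isPos hδ hd10 (hp0 1 0 (by norm_num)) (hn1 1 0 (by norm_num))
      (hinv 1 0) ?_ hN2 (fun α => ?_)
    · intro α hα hα1 x' hx' y' hy'
      have hαi : α.1 h = 1 := by rw [hh.apply, hα1.1]; norm_num
      have hαj : α.1 h' = 0 := by rw [hh'.apply, hα1.2]; norm_num
      rw [compressedTrace_of_bigrading_one hgr hαi hαj hx' hy', kappa_half]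
      have h1 := rootSum_eq_pairSum (ind_eq_rootInd hh hh' 1 1) α
      rw [Int.cast_one] at h1
      rw [h1, hPS, hα1.1, hα1.2]
      push_cast
      ring
    · exact ⟨fun h => ⟨isPos_of_coeff_pos (k := i) (by omega), h⟩, fun h => h.2⟩
  · refine hS.isEigenbundle_of_isPos hδ hd01 (hp0 0 1 (by norm_num)) (hn1 0 1 (by norm_num))
      (hinv 0 1) ?_ hN3 (fun α => ?_)
    · intro α hα hα1 x' hx' y' hy'
      have hαi : α.1 h = 0 := by rw [hh.apply, hα1.1]; norm_num
      have hαj : α.1 h' = 1 := by rw [hh'.apply, hα1.2]; norm_num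
      -- Exchanging the two coweights reduces bidegree `(0, 1)` to `(1, 0)`.
      have e1 : (fun χ : F.H → ℂ => notThree (χ h + χ h')) = fun χ => notThree (χ h' + χ h) :=
        funext fun χ => by rw [add_comm]
      have e2 : (ind fun χ : F.H → ℂ => χ h' = 1 ∧ χ h = 1) = ind fun χ => χ h = 1 ∧ χ h' = 1 :=
        funext fun χ => ind_congr and_comm
      rw [e1, compressedTrace_of_bigrading_one hgr.swap hαj hαi hx' hy', kappa_half, e2]
      have h1 := rootSum_eq_pairSum (ind_eq_rootInd hh hh' 1 1) α
      rw [Int.cast_one] at h1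
      rw [h1, hPS, hα1.1, hα1.2]
      push_cast
      ring
    · exact ⟨fun h => ⟨isPos_of_coeff_pos (k := j) (by omega), h⟩, fun h => h.2⟩

end RootFrame

/-! ### Combinatorial data of the Dynkin types -/

section Data

variable {n : ℕ} {C : Matrix (Fin n) (Fin n) ℤ} {s m c : Fin n → ℕ}

theorem reaches_foldl (C : Matrix (Fin n) (Fin n) ℤ) (l : List (Fin n)) (e : Fin n → ℤ) :
    Reaches C e (l.foldl (fun c k => reflectVec C k c) e) := by
  induction l generalizing e with
  | nil => exact Relation.ReflTransGen.refl
  | cons k l ih => exact Relation.ReflTransGen.head ⟨k, rfl⟩ (ih _)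

theorem connected_of_measure (r : Fin n) (φ : Fin n → ℕ)
    (h : ∀ k, k = r ∨ ∃ j, φ j < φ k ∧ C j k ≠ 0) (k : Fin n) :
    Relation.ReflTransGen (fun a b => C a b ≠ 0) r k := by
  induction hN : φ k using Nat.strong_induction_on generalizing k with
  | _ N ih =>
    rcases h k with rfl | ⟨j, h1, h2⟩
    · exact Relation.ReflTransGen.refl
    · exact (ih (φ j) (hN ▸ h1) j rfl).tail h2

/-- For a concrete matrix all hypotheses are decidable. The list `l` is an explicit chain of simple
reflections, and `φ`, such as the distance from `r` in the diagram, certifies connectedness. -/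
theorem isHighestData_of_foldl (r : Fin n) (φ : Fin n → ℕ) (l : List (Fin n))
    (h1 : ∀ k l, C k l * s k = C l k * s l) (h2 : ∀ k, 1 ≤ s k) (h3 : ∀ k, m k = s k * c k)
    (h4 : ∀ k, 0 ≤ ∑ j, m j * C j k) (h5 : s r = 1)
    (h6 : ∀ k, k = r ∨ ∃ j, φ j < φ k ∧ C j k ≠ 0)
    (h7 : l.foldl (fun c k => reflectVec C k c) (Pi.single r 1) = fun k => (m k : ℤ)) :
    IsHighestData C s m c :=
  ⟨h1, h2, h3, h4, r, h5, connected_of_measure r φ h6, h7 ▸ reaches_foldl C l _⟩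

/-- The coordinates of a fundamental coweight, and the numbers of roots and eigenvalues which they
determine, for a grading with `mᵢ = 2`. -/
def IsDataIII (C : Matrix (Fin n) (Fin n) ℤ) (s c : Fin n → ℕ) (i : Fin n) (l k a₂ a₁ : ℕ)
    (d : ℤ) (x : Fin n → ℤ) : Prop :=
  ((∀ k, ∑ j, C k j * x j = if k = i then d else 0) ∧ d ≠ 0 ∧ x i ≠ 0) ∧
    (d * (a₁ + 4 * a₂) = x i * s i * (1 + ∑ k, (c k : ℤ)) ∧ d * (a₁ + 2 * a₂) = 2 * ∑ j, x j) ∧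
    2 * d * a₁ = x i * s i * l ∧ 2 * d * (2 * a₂) = x i * s i * k

instance (C : Matrix (Fin n) (Fin n) ℤ) (s c : Fin n → ℕ) (i : Fin n) (l k a₂ a₁ : ℕ)
    (d : ℤ) (x : Fin n → ℤ) : Decidable (IsDataIII C s c i l k a₂ a₁ d x) := by
  unfold IsDataIII; infer_instance

/-- The coordinates of two fundamental coweights, and the numbers of roots and eigenvalues which
they determine, for a bigrading with `mᵢ = mⱼ = 1`. -/
def IsDataII (C : Matrix (Fin n) (Fin n) ℤ) (s c : Fin n → ℕ) (i j : Fin n)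
    (l k r a₁ a₂ a₃ : ℕ) (d : ℤ) (x y : Fin n → ℤ) : Prop :=
  ((∀ k, ∑ j, C k j * x j = if k = i then d else 0) ∧
    (∀ k, ∑ j, C k j * y j = if k = j then d else 0)) ∧
    (s i = 1 ∧ s j = 1 ∧ d ≠ 0 ∧ x i * y j - x j * y i ≠ 0) ∧
    (d * (a₁ + a₂) = x i * (1 + ∑ k, (c k : ℤ)) ∧ d * a₁ = x j * (1 + ∑ k, (c k : ℤ)) ∧
      d * (a₁ + a₃) = y j * (1 + ∑ k, (c k : ℤ))) ∧
    d * (a₂ * (y j - y i) + a₃ * (x i - x j)) = (x i * y j - x j * y i) * l ∧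
    2 * d * (a₁ * (y j - x j)) = (x i * y j - x j * y i) * k ∧
    2 * d * (a₁ * (x i - y i)) = (x i * y j - x j * y i) * r

instance (C : Matrix (Fin n) (Fin n) ℤ) (s c : Fin n → ℕ) (i j : Fin n) (l k r a₁ a₂ a₃ : ℕ)
    (d : ℤ) (x y : Fin n → ℤ) : Decidable (IsDataII C s c i j l k r a₁ a₂ a₃ d x y) := by
  unfold IsDataII; infer_instance

/-- The highest root of the type `X`, and the tables for `X`. -/
structure IsTypeData (X : DynkinType) (s m c : Fin X.rank → ℕ) : Prop where
  highest : IsHighestData X.cartan s m c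
  tableII : ∀ i j, i < j → m i = 1 → m j = 1 → ∃ l k r a₁ a₂ a₃ : ℕ,
    TableII X (i + 1) (j + 1) l k r (2 * a₁) (2 * a₂) (2 * a₃) ∧
      ∃ d x y, IsDataII X.cartan s c i j l k r a₁ a₂ a₃ d x y
  tableIII : ∀ i, m i = 2 → ∃ l k a₂ a₁ : ℕ, TableIII X (i + 1) l k (2 * a₂) (2 * a₁) ∧
    ∃ d x, IsDataIII X.cartan s c i l k a₂ a₁ d x

end Data

/-! ### The exceptional types -/

theorem isTypeData_E6 : IsTypeData .E6 (fun _ => 1) ![1, 2, 2, 3, 2, 1] ![1, 2, 2, 3, 2, 1] where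
  highest := by
    change IsHighestData CartanMatrix.E₆ _ _ _
    -- Each of the ten reflections raises the height by one, from `1` to the height `11` of the
    -- highest root.
    exact isHighestData_of_foldl 0 ![0, 3, 1, 2, 3, 4] [2, 3, 1, 4, 3, 2, 5, 4, 3, 1]
      (by decide +kernel) (by decide +kernel) (by decide +kernel) (by decide +kernel) rfl
      (by decide +kernel) (by decide +kernel)
  tableII := by
    change ∀ i j : Fin 6, _
    intro i j hij hi hj
    have key : ∀ i j : Fin 6, i < j → (![1, 2, 2, 3, 2, 1] : Fin 6 → ℕ) i = 1 →
        (![1, 2, 2, 3, 2, 1] : Fin 6 → ℕ) j = 1 → i = 0 ∧ j = 5 := by decide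
    obtain ⟨rfl, rfl⟩ := key i j hij hi hj
    -- The two vectors are three times the fundamental coweights at the end nodes, written in simple
    -- coroots; `d = 3` clears denominators.
    have key : IsDataII CartanMatrix.E₆ (fun _ => 1) ![1, 2, 2, 3, 2, 1] 0 5 8 8 8 8 8 8 3
      ![4, 3, 5, 6, 4, 2] ![2, 3, 4, 6, 5, 4] := by decide +kernel
    exact ⟨8, 8, 8, 8, 8, 8, .e6, _, _, _, key⟩
  tableIII := by
    change ∀ i : Fin 6, _
    intro i hi
    have : i = 1 ∨ i = 2 ∨ i = 4 := by revert i; decide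
    rcases this with rfl | rfl | rfl
    · have key : IsDataIII CartanMatrix.E₆ (fun _ => 1) ![1, 2, 2, 3, 2, 1] 1 20 2 1 20 1
          ![1, 2, 2, 3, 2, 1] := by decide +kernel
      exact ⟨20, 2, 1, 20, .e6_su6, _, _, key⟩
    · have key : IsDataIII CartanMatrix.E₆ (fun _ => 1) ![1, 2, 2, 3, 2, 1] 2 12 6 5 20 3
          ![5, 6, 10, 12, 8, 4] := by decide +kernel
      exact ⟨12, 6, 5, 20, .e6_su5 3 (Or.inl rfl), _, _, key⟩
    · have key : IsDataIII CartanMatrix.E₆ (fun _ => 1) ![1, 2, 2, 3, 2, 1] 4 12 6 5 20 3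
          ![4, 6, 8, 12, 10, 5] := by decide +kernel
      exact ⟨12, 6, 5, 20, .e6_su5 5 (Or.inr rfl), _, _, key⟩

theorem isTypeData_E7 :
    IsTypeData .E7 (fun _ => 1) ![2, 2, 3, 4, 3, 2, 1] ![2, 2, 3, 4, 3, 2, 1] where
  highest := by
    change IsHighestData CartanMatrix.E₇ _ _ _
    exact isHighestData_of_foldl 0 ![0, 3, 1, 2, 3, 4, 5]
      [2, 3, 1, 4, 3, 2, 5, 4, 3, 1, 6, 5, 4, 3, 2, 0]
      (by decide +kernel) (by decide +kernel) (by decide +kernel) (by decide +kernel) rfl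
      (by decide +kernel) (by decide +kernel)
  tableII := by
    change ∀ i j : Fin 7, _
    intro i j hij hi hj
    have key : ∀ i j : Fin 7, i < j → (![2, 2, 3, 4, 3, 2, 1] : Fin 7 → ℕ) i = 1 →
        (![2, 2, 3, 4, 3, 2, 1] : Fin 7 → ℕ) j ≠ 1 := by decide
    exact absurd hj (key i j hij hi)
  tableIII := by
    change ∀ i : Fin 7, _
    intro i hi
    have : i = 0 ∨ i = 1 ∨ i = 5 := by revert i; decide
    rcases this with rfl | rfl | rfl
    · have key : IsDataIII CartanMatrix.E₇ (fun _ => 1) ![2, 2, 3, 4, 3, 2, 1] 0 32 2 1 32 1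
          ![2, 2, 3, 4, 3, 2, 1] := by decide +kernel
      exact ⟨32, 2, 1, 32, .e7_so12, _, _, key⟩
    · have key : IsDataIII CartanMatrix.E₇ (fun _ => 1) ![2, 2, 3, 4, 3, 2, 1] 1 20 8 7 35 2
          ![4, 7, 8, 12, 9, 6, 3] := by decide +kernel
      exact ⟨20, 8, 7, 35, .e7_su7, _, _, key⟩
    · have key : IsDataIII CartanMatrix.E₇ (fun _ => 1) ![2, 2, 3, 4, 3, 2, 1] 5 16 10 10 32 1
          ![2, 3, 4, 6, 5, 4, 2] := by decide +kernel
      exact ⟨16, 10, 10, 32, .e7_so10, _, _, key⟩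

theorem isTypeData_E8 :
    IsTypeData .E8 (fun _ => 1) ![2, 3, 4, 6, 5, 4, 3, 2] ![2, 3, 4, 6, 5, 4, 3, 2] where
  highest := by
    change IsHighestData CartanMatrix.E₈ _ _ _
    exact isHighestData_of_foldl 0 ![0, 3, 1, 2, 3, 4, 5, 6]
      [2, 3, 1, 4, 3, 2, 5, 4, 3, 1, 6, 5, 4, 3, 2, 0, 7, 6, 5, 4, 3, 1, 2, 3, 4, 5, 6, 7]
      (by decide +kernel) (by decide +kernel) (by decide +kernel) (by decide +kernel) rfl
      (by decide +kernel) (by decide +kernel)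
  tableII := by
    change ∀ i j : Fin 8, _
    intro i j hij hi hj
    have key : ∀ i j : Fin 8, i < j → (![2, 3, 4, 6, 5, 4, 3, 2] : Fin 8 → ℕ) i = 1 →
        (![2, 3, 4, 6, 5, 4, 3, 2] : Fin 8 → ℕ) j ≠ 1 := by decide
    exact absurd hj (key i j hij hi)
  tableIII := by
    change ∀ i : Fin 8, _
    intro i hi
    have : i = 0 ∨ i = 7 := by revert i; decide
    rcases this with rfl | rfl
    · have key : IsDataIII CartanMatrix.E₈ (fun _ => 1) ![2, 3, 4, 6, 5, 4, 3, 2] 0 32 14 14 64 1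
          ![4, 5, 7, 10, 8, 6, 4, 2] := by decide +kernel
      exact ⟨32, 14, 14, 64, .e8_so14, _, _, key⟩
    · have key : IsDataIII CartanMatrix.E₈ (fun _ => 1) ![2, 3, 4, 6, 5, 4, 3, 2] 7 56 2 1 56 1
          ![2, 3, 4, 6, 5, 4, 3, 2] := by decide +kernel
      exact ⟨56, 2, 1, 56, .e8_e7, _, _, key⟩

theorem isTypeData_F4 : IsTypeData .F4 ![1, 1, 2, 2] ![2, 3, 4, 2] ![2, 3, 2, 1] where
  highest := by
    change IsHighestData CartanMatrix.F₄ _ _ _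
    exact isHighestData_of_foldl 0 ![0, 1, 2, 3] [1, 2, 1, 3, 2, 1, 0]
      (by decide +kernel) (by decide +kernel) (by decide +kernel) (by decide +kernel) rfl
      (by decide +kernel) (by decide +kernel)
  tableII := by
    change ∀ i j : Fin 4, _
    intro i j hij hi hj
    have key : ∀ i j : Fin 4, i < j → (![2, 3, 4, 2] : Fin 4 → ℕ) i = 1 →
        (![2, 3, 4, 2] : Fin 4 → ℕ) j ≠ 1 := by decide
    exact absurd hj (key i j hij hi)
  tableIII := by
    change ∀ i : Fin 4, _
    intro i hi
    have : i = 0 ∨ i = 3 := by revert i; decide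
    rcases this with rfl | rfl
    · have key : IsDataIII CartanMatrix.F₄ ![1, 1, 2, 2] ![2, 3, 2, 1] 0 14 2 1 14 1
          ![2, 3, 2, 1] := by decide +kernel
      exact ⟨14, 2, 1, 14, .f4_sp3, _, _, key⟩
    · have key : IsDataIII CartanMatrix.F₄ ![1, 1, 2, 2] ![2, 3, 2, 1] 3 4 7 7 8 1
          ![2, 4, 3, 2] := by decide +kernel
      exact ⟨4, 7, 7, 8, .f4_spin7, _, _, key⟩

theorem isTypeData_G2 : IsTypeData .G2 ![3, 1] ![3, 2] ![1, 2] where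
  highest := by
    change IsHighestData CartanMatrix.G₂ᵀ _ _ _
    -- The chain starts at node `1`, which is the long root in this numbering.
    exact isHighestData_of_foldl 1 ![1, 0] [0, 1]
      (by decide +kernel) (by decide +kernel) (by decide +kernel) (by decide +kernel) rfl
      (by decide +kernel) (by decide +kernel)
  tableII := by
    change ∀ i j : Fin 2, _
    intro i j hij hi hj
    have key : ∀ i j : Fin 2, i < j → (![3, 2] : Fin 2 → ℕ) i = 1 →
        (![3, 2] : Fin 2 → ℕ) j ≠ 1 := by decide
    exact absurd hj (key i j hij hi)
  tableIII := by
    change ∀ i : Fin 2, _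
    intro i hi
    have : i = 1 := by revert i; decide
    subst this
    have key : IsDataIII CartanMatrix.G₂ᵀ ![3, 1] ![1, 2] 1 4 2 1 4 1
        ![1, 2] := by decide +kernel
    exact ⟨4, 2, 1, 4, .g2, _, _, key⟩

/-! ### Rows of the classical Cartan matrices -/

theorem sum_ite_val {n : ℕ} (t : ℕ) (a : ℤ) (f : ℕ → ℤ) :
    ∑ j : Fin n, (if (j : ℕ) = t then a else 0) * f j = if t < n then a * f t else 0 := by
  rw [Fin.sum_univ_eq_sum_range (fun j => (if j = t then a else 0) * f j) n]
  simp [ite_mul]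

/-- A row of a classical Cartan matrix has at most four nonzero entries. A spare slot gets the
coefficient `0` or the position `n`, outside the range. -/
theorem sum_row {n : ℕ} {row : Fin n → ℤ} {t₀ t₁ t₂ t₃ : ℕ} {a₀ a₁ a₂ a₃ : ℤ}
    (h : ∀ j : Fin n, row j = (if (j : ℕ) = t₀ then a₀ else 0) + (if (j : ℕ) = t₁ then a₁ else 0) +
      (if (j : ℕ) = t₂ then a₂ else 0) + (if (j : ℕ) = t₃ then a₃ else 0)) (f : ℕ → ℤ) :
    ∑ j, row j * f j = (if t₀ < n then a₀ * f t₀ else 0) + (if t₁ < n then a₁ * f t₁ else 0) +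
      (if t₂ < n then a₂ * f t₂ else 0) + (if t₃ < n then a₃ * f t₃ else 0) := by
  simp_rw [h, add_mul, Finset.sum_add_distrib, sum_ite_val]

theorem A_row {n : ℕ} (k : Fin n) (f : ℕ → ℤ) : ∑ j, CartanMatrix.A n k j * f j =
    2 * f k - (if (k : ℕ) + 1 < n then f (k + 1) else 0) - if (k : ℕ) = 0 then 0 else f (k - 1) := by
  have hk := k.2
  -- At `k = 0` truncated subtraction places `k - 1` on the diagonal, so that coefficient must then
  -- be `0`.
  rw [sum_row (t₀ := k) (t₁ := k + 1) (t₂ := k - 1) (t₃ := n) (a₀ := 2) (a₁ := -1)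
    (a₂ := if (k : ℕ) = 0 then 0 else -1) (a₃ := 0)]
  · rw [if_pos hk, if_neg (lt_irrefl n), if_pos (show (k : ℕ) - 1 < n by omega)]
    split_ifs <;> ring
  · intro j
    simp only [CartanMatrix.A, Matrix.of_apply, Fin.ext_iff]
    split_ifs <;> omega

theorem B_row {n : ℕ} (k : Fin n) (f : ℕ → ℤ) : ∑ j, CartanMatrix.B n k j * f j =
    2 * f k - (if (k : ℕ) + 1 < n then (if (k : ℕ) + 2 = n then 2 else 1) * f (k + 1) else 0) -
      if (k : ℕ) = 0 then 0 else f (k - 1) := by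
  have hk := k.2
  rw [sum_row (t₀ := k) (t₁ := k + 1) (t₂ := k - 1) (t₃ := n) (a₀ := 2)
    (a₁ := if (k : ℕ) + 2 = n then -2 else -1) (a₂ := if (k : ℕ) = 0 then 0 else -1) (a₃ := 0)]
  · rw [if_pos hk, if_neg (lt_irrefl n), if_pos (show (k : ℕ) - 1 < n by omega)]
    split_ifs <;> ring
  · intro j
    simp only [CartanMatrix.B, Matrix.of_apply, Fin.ext_iff]
    split_ifs <;> omega

theorem C_row {n : ℕ} (k : Fin n) (f : ℕ → ℤ) : ∑ j, CartanMatrix.C n k j * f j =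
    2 * f k - (if (k : ℕ) + 1 < n then f (k + 1) else 0) -
      if (k : ℕ) = 0 then 0 else (if (k : ℕ) + 1 = n then 2 else 1) * f (k - 1) := by
  have hk := k.2
  rw [sum_row (t₀ := k) (t₁ := k + 1) (t₂ := k - 1) (t₃ := n) (a₀ := 2) (a₁ := -1)
    (a₂ := if (k : ℕ) = 0 then 0 else if (k : ℕ) + 1 = n then -2 else -1) (a₃ := 0)]
  · rw [if_pos hk, if_neg (lt_irrefl n), if_pos (show (k : ℕ) - 1 < n by omega)]
    split_ifs <;> ring
  · intro j
    simp only [CartanMatrix.C, Matrix.of_apply, Fin.ext_iff]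
    split_ifs <;> omega

theorem D_row {n : ℕ} (hn : 4 ≤ n) (k : Fin n) (f : ℕ → ℤ) : ∑ j, CartanMatrix.D n k j * f j =
    2 * f k - (if (k : ℕ) = 0 then 0 else if (k : ℕ) + 1 = n then f (n - 3) else f (k - 1)) -
      (if (k : ℕ) + 3 ≤ n then f (k + 1) else 0) - if (k : ℕ) + 3 = n then f (n - 1) else 0 := by
  have hk := k.2
  -- Counting from `0`, the last node hangs on the branch node `n - 3`, which therefore has the
  -- additional neighbour `n - 1`.
  rw [sum_row (t₀ := k) (t₁ := if (k : ℕ) + 1 = n then n - 3 else k - 1) (t₂ := k + 1) (t₃ := n - 1)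
    (a₀ := 2) (a₁ := if (k : ℕ) = 0 then 0 else -1) (a₂ := if (k : ℕ) + 3 ≤ n then -1 else 0)
    (a₃ := if (k : ℕ) + 3 = n then -1 else 0)]
  · rw [if_pos hk, if_pos (show n - 1 < n by omega)]
    have h1 : (if (k : ℕ) + 1 = n then n - 3 else k - 1) < n := by split_ifs <;> omega
    rw [if_pos h1]
    rcases Nat.eq_zero_or_pos (k : ℕ) with h0 | h0
    · rw [if_pos h0, if_pos h0, if_pos (show (k : ℕ) + 3 ≤ n by omega),
        if_pos (show (k : ℕ) + 1 < n by omega),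
        if_neg (show ¬ (k : ℕ) + 3 = n by omega), if_neg (show ¬ (k : ℕ) + 3 = n by omega),
        if_pos (show (k : ℕ) + 3 ≤ n by omega)]
      ring
    rw [if_neg h0.ne', if_neg h0.ne']
    by_cases hl : (k : ℕ) + 1 = n
    · rw [if_pos hl, if_pos hl, if_neg (show ¬ (k : ℕ) + 1 < n by omega),
        if_neg (show ¬ (k : ℕ) + 3 = n by omega), if_neg (show ¬ (k : ℕ) + 3 = n by omega),
        if_neg (show ¬ (k : ℕ) + 3 ≤ n by omega)]
      ring
    · rw [if_neg hl, if_neg hl, if_pos (show (k : ℕ) + 1 < n by omega)]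
      by_cases h3 : (k : ℕ) + 3 ≤ n
      · rw [if_pos h3, if_pos h3]
        by_cases h4 : (k : ℕ) + 3 = n
        · rw [if_pos h4, if_pos h4]; ring
        · rw [if_neg h4, if_neg h4]; ring
      · rw [if_neg h3, if_neg h3, if_neg (show ¬ (k : ℕ) + 3 = n by omega),
          if_neg (show ¬ (k : ℕ) + 3 = n by omega)]
        ring
  · intro j
    have hj := j.2
    simp only [CartanMatrix.D, Matrix.of_apply, Fin.ext_iff]
    rcases Nat.eq_zero_or_pos (k : ℕ) with h0 | h0
    · simp only [h0, if_true, if_neg (show ¬ 0 + 1 = n by omega), if_neg (show ¬ 0 + 3 = n by omega),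
        if_pos (show 0 + 3 ≤ n by omega)]
      split_ifs <;> first | omega | tauto
    simp only [if_neg h0.ne']
    by_cases hl : (k : ℕ) + 1 = n
    · simp only [if_pos hl, if_neg (show ¬ (k : ℕ) + 3 = n by omega),
        if_neg (show ¬ (k : ℕ) + 3 ≤ n by omega)]
      split_ifs <;> omega
    simp only [if_neg hl]
    by_cases h4 : (k : ℕ) + 3 = n
    · simp only [if_pos h4, if_pos h4.le]
      split_ifs <;> omega
    simp only [if_neg h4]
    by_cases h3 : (k : ℕ) + 3 ≤ n
    · simp only [if_pos h3]
      split_ifs <;> omega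
    · simp only [if_neg h3]
      split_ifs <;> omega

theorem A_col {n : ℕ} (k : Fin n) (f : ℕ → ℤ) : ∑ j : Fin n, f j * CartanMatrix.A n j k =
    2 * f k - (if (k : ℕ) + 1 < n then f (k + 1) else 0) - if (k : ℕ) = 0 then 0 else f (k - 1) := by
  rw [← A_row]
  refine Finset.sum_congr rfl fun j _ => ?_
  rw [mul_comm, ← Matrix.transpose_apply (CartanMatrix.A n), CartanMatrix.A_transpose]

theorem B_col {n : ℕ} (k : Fin n) (f : ℕ → ℤ) : ∑ j : Fin n, f j * CartanMatrix.B n j k =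
    2 * f k - (if (k : ℕ) + 1 < n then f (k + 1) else 0) -
      if (k : ℕ) = 0 then 0 else (if (k : ℕ) + 1 = n then 2 else 1) * f (k - 1) := by
  rw [← C_row]
  refine Finset.sum_congr rfl fun j _ => ?_
  rw [mul_comm, ← Matrix.transpose_apply (CartanMatrix.B n), CartanMatrix.B_transpose]

theorem C_col {n : ℕ} (k : Fin n) (f : ℕ → ℤ) : ∑ j : Fin n, f j * CartanMatrix.C n j k =
    2 * f k - (if (k : ℕ) + 1 < n then (if (k : ℕ) + 2 = n then 2 else 1) * f (k + 1) else 0) -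
      if (k : ℕ) = 0 then 0 else f (k - 1) := by
  rw [← B_row]
  refine Finset.sum_congr rfl fun j _ => ?_
  rw [mul_comm, ← Matrix.transpose_apply (CartanMatrix.C n), CartanMatrix.C_transpose]

theorem D_col {n : ℕ} (hn : 4 ≤ n) (k : Fin n) (f : ℕ → ℤ) :
    ∑ j : Fin n, f j * CartanMatrix.D n j k =
    2 * f k - (if (k : ℕ) = 0 then 0 else if (k : ℕ) + 1 = n then f (n - 3) else f (k - 1)) -
      (if (k : ℕ) + 3 ≤ n then f (k + 1) else 0) - if (k : ℕ) + 3 = n then f (n - 1) else 0 := by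
  rw [← D_row hn]
  refine Finset.sum_congr rfl fun j _ => ?_
  rw [mul_comm, ← Matrix.transpose_apply (CartanMatrix.D n), CartanMatrix.D_transpose]

theorem two_mul_sum_min (I N : ℕ) : 2 * ∑ j ∈ Finset.range N, (min I (j + 1) : ℤ) =
    if N ≤ I then (N * (N + 1) : ℤ) else I * (2 * N - I + 1) := by
  induction N with
  | zero => simp
  | succ N ih =>
    rw [Finset.sum_range_succ, mul_add, ih]
    rcases lt_trichotomy N I with h | rfl | h
    · rw [if_pos h.le, if_pos (show N + 1 ≤ I by omega), min_eq_right (by omega)]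
      push_cast; ring
    · rw [if_pos le_rfl, if_neg (by omega), min_eq_left (by omega)]
      push_cast; ring
    · rw [if_neg (by omega), if_neg (by omega), min_eq_left (by omega)]
      push_cast; ring

/-- One step from `f` to `f'`, for coefficient vectors given by functions on `ℕ`. -/
theorem Reaches.step {n : ℕ} {C : Matrix (Fin n) (Fin n) ℤ} {e : Fin n → ℤ} {f f' : ℕ → ℤ}
    (h : Reaches C e fun j => f j) (k : Fin n) {p : ℤ} (hp : ∑ j : Fin n, f j * C j k = p)
    (hf : ∀ j : ℕ, j < n → f' j = if j = k then f j - p else f j) :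
    Reaches C e fun j => f' j := by
  refine Relation.ReflTransGen.tail h ⟨k, ?_⟩
  rw [reflectVec, hp]
  funext j
  simp only [Pi.sub_apply, Pi.smul_apply, Pi.single_apply, hf j j.2, Fin.ext_iff]
  split_ifs <;> simp

/-- Climbs through `α₁ + ⋯ + α_{t+1}` along the straight part of the diagram. The bound `T` allows
stopping before an end where the pairing is no longer `-1`. -/
theorem reaches_ones {n : ℕ} {C : Matrix (Fin n) (Fin n) ℤ} (hn : 0 < n) (T : ℕ)
    (h : ∀ t (ht : t + 1 < n), t + 1 ≤ T →
      ∑ j : Fin n, (if (j : ℕ) ≤ t then 1 else 0) * C j ⟨t + 1, ht⟩ = -1)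
    (t : ℕ) (ht : t < n) (hT : t ≤ T) :
    Reaches C (Pi.single ⟨0, hn⟩ 1) fun j => if (j : ℕ) ≤ t then 1 else 0 := by
  induction t with
  | zero =>
    have : (fun j : Fin n => if (j : ℕ) ≤ 0 then (1 : ℤ) else 0) = Pi.single ⟨0, hn⟩ 1 := by
      funext j
      simp only [Pi.single_apply, Fin.ext_iff, Nat.le_zero]
    rw [this]
    exact Relation.ReflTransGen.refl
  | succ t ih =>
    refine Reaches.step (f := fun j => if j ≤ t then 1 else 0)
      (f' := fun j => if j ≤ t + 1 then 1 else 0) (ih (by omega) (by omega)) ⟨t + 1, ht⟩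
      (h t ht hT) fun j hj => ?_
    simp only
    split_ifs <;> omega

/-! ### Type `A` -/

theorem isHighestData_A {n : ℕ} (hn : 0 < n) :
    IsHighestData (CartanMatrix.A n) (fun _ => 1) (fun _ => 1) (fun _ => 1) where
  symm k l := by rw [← Matrix.transpose_apply (CartanMatrix.A n), CartanMatrix.A_transpose]
  one_le _ := le_rfl
  marks _ := rfl
  dominant k := by
    have := A_col k fun _ => 1
    rw [Nat.cast_one, this]
    split_ifs <;> norm_num
  exists_root := by
    refine ⟨⟨0, hn⟩, rfl, connected_of_measure _ (fun k => k) fun k => ?_, ?_⟩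
    · have := k.2
      rcases Nat.eq_zero_or_pos (k : ℕ) with h | h
      · exact Or.inl (Fin.ext h)
      · refine Or.inr ⟨⟨k - 1, by omega⟩, by simp only; omega, ?_⟩
        simp only [CartanMatrix.A, Matrix.of_apply, Fin.ext_iff]
        split_ifs <;> omega
    · have h := reaches_ones (C := CartanMatrix.A n) hn n (fun t ht _ => by
        rw [A_col ⟨t + 1, ht⟩ fun j => if j ≤ t then 1 else 0]
        simp) (n - 1) (by omega) (by omega)
      convert h using 1
      funext j
      rw [if_pos (by omega)]
      norm_num

/-- With nodes numbered from `1`, these are the entries `min(i, j) (n + 1 - max(i, j))` of `n + 1`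
times the inverse Cartan matrix. -/
theorem A_coweight {n : ℕ} (i k : Fin n) : ∑ j : Fin n, CartanMatrix.A n k j *
    (if (j : ℕ) ≤ i then ((j : ℕ) + 1 : ℤ) * (n - i) else (i + 1) * (n - (j : ℕ))) =
      if k = i then (n + 1 : ℤ) else 0 := by
  rw [A_row k fun j => if j ≤ (i : ℕ) then (j + 1 : ℤ) * (n - i) else (i + 1) * (n - j)]
  have hk := k.2
  have hi := i.2
  -- The formula extends by zero to the positions `n` and `-1`, so the boundary guards can be
  -- dropped.
  have h1 : (if (k : ℕ) + 1 < n then (if (k : ℕ) + 1 ≤ i then (((k : ℕ) + 1 : ℕ) + 1 : ℤ) * (n - i)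
      else (i + 1) * (n - ((k : ℕ) + 1 : ℕ))) else 0) =
      if (k : ℕ) + 1 ≤ i then ((k : ℕ) + 2 : ℤ) * (n - i) else (i + 1) * (n - (k : ℕ) - 1) := by
    by_cases h : (k : ℕ) + 1 < n
    · rw [if_pos h]; push_cast; split_ifs <;> ring
    · have : (n : ℤ) = k + 1 := by omega
      rw [if_neg h, if_neg (by omega), this]; ring
  have h2 : (if (k : ℕ) = 0 then (0 : ℤ) else (if (k : ℕ) - 1 ≤ i then
      (((k : ℕ) - 1 : ℕ) + 1 : ℤ) * (n - i) else (i + 1) * (n - ((k : ℕ) - 1 : ℕ)))) =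
      if (k : ℕ) ≤ i + 1 then ((k : ℕ) : ℤ) * (n - i) else (i + 1) * (n - (k : ℕ) + 1) := by
    by_cases h : (k : ℕ) = 0
    · rw [if_pos h, if_pos (by omega), h]; simp
    · have : (((k : ℕ) - 1 : ℕ) : ℤ) = k - 1 := by omega
      rw [if_neg h, this]
      by_cases h' : (k : ℕ) ≤ i + 1
      · rw [if_pos h', if_pos (by omega)]; ring
      · rw [if_neg h', if_neg (by omega)]; ring
  rw [h1, h2]
  rcases lt_trichotomy (k : ℕ) i with h | h | h
  · rw [if_pos h.le, if_pos (by omega), if_pos (by omega), if_neg (by rw [Fin.ext_iff]; omega)]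
    ring
  · rw [if_pos h.le, if_neg (by omega), if_pos (by omega), if_pos (Fin.ext h), h]
    ring
  · rw [if_neg (show ¬ (k : ℕ) ≤ i by omega), if_neg (show ¬ (k : ℕ) + 1 ≤ i by omega),
      if_neg (show ¬ k = i by rw [Fin.ext_iff]; omega)]
    by_cases h' : (k : ℕ) ≤ i + 1
    · rw [if_pos h']
      have : ((k : ℕ) : ℤ) = i + 1 := by omega
      rw [this]; ring
    · rw [if_neg h']; ring

theorem tableII_su {n : ℕ} (hn : 1 ≤ n) {r₁ r₂ r₃ : ℕ} (h : r₁ + r₂ + r₃ = n + 1) (h₁ : 1 ≤ r₁)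
    (h₂ : 1 ≤ r₂) (h₃ : 1 ≤ r₃) : TableII (.A n hn) r₁ (r₁ + r₂)
      (2 * r₂) (2 * r₃) (2 * r₁) (2 * (r₁ * r₃)) (2 * (r₁ * r₂)) (2 * (r₂ * r₃)) := by
  obtain rfl : n = r₁ + r₂ + r₃ - 1 := by omega
  simp only [← mul_assoc]
  exact .su r₁ r₂ r₃ h₁ h₂ h₃

/-- The nodes `i` and `j` cut the coordinates into blocks of sizes `r₁`, `r₂`, `r₃`; a product of
two sizes counts the roots `e_p - e_q` joining those blocks. -/
theorem isDataII_A {n : ℕ} {i j : Fin n} {r₁ r₂ r₃ : ℕ} (hi : (i : ℕ) + 1 = r₁)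
    (hj : (j : ℕ) + 1 = r₁ + r₂) (h : r₁ + r₂ + r₃ = n + 1) (h₂ : 1 ≤ r₂) (h₃ : 1 ≤ r₃) :
    IsDataII (CartanMatrix.A n) (fun _ => 1) (fun _ => 1) i j (2 * r₂) (2 * r₃) (2 * r₁)
      (r₁ * r₃) (r₁ * r₂) (r₂ * r₃) (n + 1)
      (fun j => if (j : ℕ) ≤ i then ((j : ℕ) + 1 : ℤ) * (n - i) else (i + 1) * (n - (j : ℕ)))
      (fun k => if (k : ℕ) ≤ j then ((k : ℕ) + 1 : ℤ) * (n - j) else (j + 1) * (n - (k : ℕ))) := by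
  have hn : (n : ℤ) = r₁ + r₂ + r₃ - 1 := by omega
  have hi' : ((i : ℕ) : ℤ) = r₁ - 1 := by omega
  have hj' : ((j : ℕ) : ℤ) = r₁ + r₂ - 1 := by omega
  have hij : ¬ (j : ℕ) ≤ i := by omega
  have hij' : (i : ℕ) ≤ j := by omega
  have hr : (r₁ : ℤ) * r₂ * r₃ * (r₁ + r₂ + r₃) ≠ 0 := by
    have : 0 < r₁ := by omega
    positivity
  refine ⟨⟨A_coweight i, A_coweight j⟩, ⟨rfl, rfl, by omega, ?_⟩, ⟨?_, ?_, ?_⟩, ?_, ?_, ?_⟩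
  · simp only [le_refl, if_true, if_neg hij, if_pos hij', hn, hi', hj']
    intro h0
    exact hr (by linear_combination h0)
  all_goals
    simp only [le_refl, if_true, if_neg hij, if_pos hij', hn, hi', hj', Nat.cast_one,
      Finset.sum_const, Finset.card_univ, Fintype.card_fin, nsmul_eq_mul, mul_one]
    push_cast
    ring

theorem isTypeData_A (n : ℕ) (hn : 1 ≤ n) :
    IsTypeData (.A n hn) (fun _ => 1) (fun _ => 1) (fun _ => 1) where
  highest := isHighestData_A hn
  tableII := by
    change ∀ i j : Fin n, _
    intro i j hij _ _
    have hij' : (i : ℕ) < j := hij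
    have hj := j.2
    have h := tableII_su hn (r₁ := i + 1) (r₂ := j - i) (r₃ := n - j) (by omega) (by omega)
      (by omega) (by omega)
    have h' := isDataII_A (i := i) (j := j) (r₁ := i + 1) (r₂ := j - i) (r₃ := n - j) rfl (by omega)
      (by omega) (by omega) (by omega)
    rw [show (i : ℕ) + 1 + (j - i) = j + 1 by omega] at h
    exact ⟨_, _, _, _, _, _, h, _, _, _, h'⟩
  tableIII := by
    intro i hi
    exact absurd hi (by norm_num)

theorem sum_add_ite {n t₀ t₁ : ℕ} {f : Fin n → ℤ} (g : ℕ → ℤ) {a₀ a₁ : ℤ} (h₀ : t₀ < n) (h₁ : t₁ < n)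
    (h : ∀ j : Fin n, f j = g j + (if (j : ℕ) = t₀ then a₀ else 0) +
      (if (j : ℕ) = t₁ then a₁ else 0)) :
    ∑ j, f j = ∑ j ∈ Finset.range n, g j + a₀ + a₁ := by
  simp_rw [h, Finset.sum_add_distrib]
  rw [Fin.sum_univ_eq_sum_range g n, Fin.sum_univ_eq_sum_range (fun j => if j = t₀ then a₀ else 0) n,
    Fin.sum_univ_eq_sum_range (fun j => if j = t₁ then a₁ else 0) n]
  simp [h₀, h₁]

theorem exists_two_mul_eq (I : ℕ) : ∃ a, 2 * a = I * (I - 1) := by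
  have h := Nat.even_mul_pred_self I
  exact ⟨I * (I - 1) / 2, Nat.mul_div_cancel' h.two_dvd⟩

theorem two_mul_sum_min_of_le {I N : ℕ} (h : I ≤ N) :
    ∑ j ∈ Finset.range N, 2 * (min I (j + 1) : ℤ) = I * (2 * N - I + 1) := by
  rw [← Finset.mul_sum, two_mul_sum_min]
  split_ifs with h'
  · obtain rfl := le_antisymm h h'
    ring
  · rfl

/-! ### Type `B` -/

/-- From `α₁ + ⋯ + α_{n-1}` the last reflection adds `2αₙ`; the next `s` reflections, moving back
along the diagram, raise coefficients from `1` to `2`. -/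
theorem reaches_B {n : ℕ} (hn : 3 ≤ n) (s : ℕ) (hs : s + 2 ≤ n) :
    Reaches (CartanMatrix.B n) (Pi.single ⟨0, by omega⟩ 1)
      fun j => if (j : ℕ) + s + 1 < n then 1 else 2 := by
  induction s with
  | zero =>
    refine Reaches.step (f := fun j => if j ≤ n - 2 then 1 else 0)
      (f' := fun j => if j + 0 + 1 < n then 1 else 2)
      (reaches_ones (by omega) (n - 2) (fun t ht hT => ?_) (n - 2) (by omega) le_rfl)
      ⟨n - 1, by omega⟩ (p := -2) ?_ fun j hj => ?_
    · rw [B_col ⟨t + 1, ht⟩ fun j => if j ≤ t then 1 else 0]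
      simp only
      split_ifs <;> first | contradiction | omega
    · rw [B_col ⟨n - 1, by omega⟩ fun j => if j ≤ n - 2 then 1 else 0]
      simp only
      split_ifs <;> omega
    · simp only
      split_ifs <;> omega
  | succ s ih =>
    refine Reaches.step (f := fun j => if j + s + 1 < n then 1 else 2)
      (f' := fun j => if j + (s + 1) + 1 < n then 1 else 2) (ih (by omega))
      ⟨n - 2 - s, by omega⟩ (p := -1) ?_ fun j hj => ?_
    · rw [B_col ⟨n - 2 - s, by omega⟩ fun j => if j + s + 1 < n then 1 else 2]
      simp only
      split_ifs <;> omega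
    · simp only
      split_ifs <;> omega

/-- The ratios of the squared length of the highest root to those of the simple roots. -/
def lengthB (n : ℕ) (j : Fin n) : ℕ := if (j : ℕ) + 1 = n then 2 else 1

/-- The coefficients of the highest root. -/
def markB (n : ℕ) (j : Fin n) : ℕ := if (j : ℕ) = 0 then 1 else 2

/-- The coefficients of the highest coroot. -/
def comarkB (n : ℕ) (j : Fin n) : ℕ := if (j : ℕ) = 0 ∨ (j : ℕ) + 1 = n then 1 else 2

theorem isHighestData_B {n : ℕ} (hn : 3 ≤ n) :
    IsHighestData (CartanMatrix.B n) (lengthB n) (markB n) (comarkB n) where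
  symm k l := by
    have := k.2
    have := l.2
    simp only [CartanMatrix.B, Matrix.of_apply, Fin.ext_iff, lengthB]
    split_ifs <;> omega
  one_le k := by
    unfold lengthB
    split_ifs <;> omega
  marks k := by
    unfold lengthB markB comarkB
    split_ifs <;> omega
  dominant k := by
    have := B_col k fun j => ((if j = 0 then 1 else 2 : ℕ) : ℤ)
    simp only [markB, this]
    have := k.2
    split_ifs <;> omega
  exists_root := by
    refine ⟨⟨0, by omega⟩, if_neg (by simp only; omega),
      connected_of_measure _ (fun k => k) fun k => ?_, ?_⟩
    · have := k.2
      rcases Nat.eq_zero_or_pos (k : ℕ) with h | h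
      · exact Or.inl (Fin.ext h)
      · refine Or.inr ⟨⟨k - 1, by omega⟩, by simp only; omega, ?_⟩
        simp only [CartanMatrix.B, Matrix.of_apply, Fin.ext_iff]
        split_ifs <;> omega
    · convert reaches_B hn (n - 2) (by omega) using 1
      funext j
      simp only [markB]
      split_ifs <;> omega

/-- The coweight is `e₁ + ⋯ + e_I`, with coordinate `min(I, j)` at the `j`-th simple coroot except
at the last coroot `2eₙ`, where it is `I/2`; hence `d = 2`. -/
theorem isDataIII_B {n : ℕ} (hn : 3 ≤ n) {i : Fin n} {I q a : ℕ} (hi : (i : ℕ) + 1 = I)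
    (hq : I + q = n) (ha : 2 * a = I * (I - 1)) :
    IsDataIII (CartanMatrix.B n) (lengthB n) (comarkB n) i (2 * (2 * q + 1)) (2 * (I - 1))
      a (I * (2 * q + 1)) 2
      (fun j => if (j : ℕ) + 1 = n then (I : ℤ) else 2 * min (I : ℤ) ((j : ℕ) + 1)) := by
  have hsum : ∑ j : Fin n, (if (j : ℕ) + 1 = n then (I : ℤ) else 2 * min (I : ℤ) ((j : ℕ) + 1)) =
      I * (2 * n - I) := by
    rw [sum_add_ite (t₀ := 0) (t₁ := n - 1) (a₀ := 0) (a₁ := -I)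
      (fun j => 2 * min (I : ℤ) (j + 1)) (by omega) (by omega), two_mul_sum_min_of_le (by omega)]
    · ring
    · intro j
      split_ifs <;> omega
  have hc : ∑ j : Fin n, (comarkB n j : ℤ) = 2 * n - 2 := by
    rw [sum_add_ite (t₀ := 0) (t₁ := n - 1) (a₀ := -1) (a₁ := -1) (fun _ => 2) (by omega) (by omega)]
    · simp
      ring
    · intro j
      have := j.2
      unfold comarkB
      split_ifs <;> omega
  have hxi : (if (i : ℕ) + 1 = n then (I : ℤ) else 2 * min (I : ℤ) ((i : ℕ) + 1)) * lengthB n i =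
      2 * I := by
    unfold lengthB
    split_ifs
    · push_cast; ring
    · rw [min_eq_left (by omega)]; push_cast; ring
  have ha' : 2 * (a : ℤ) = I * (I - 1) := by
    have := congrArg (Nat.cast : ℕ → ℤ) ha
    rw [← Nat.cast_pred (by omega)]
    exact_mod_cast this
  have hI : ((I - 1 : ℕ) : ℤ) = I - 1 := by omega
  have hn' : (n : ℤ) = I + q := by omega
  refine ⟨⟨fun k => ?_, by norm_num, ?_⟩, ⟨?_, ?_⟩, ?_, ?_⟩
  · rw [B_row k fun j => if j + 1 = n then (I : ℤ) else 2 * min (I : ℤ) (j + 1)]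
    have hk := k.2
    simp only [Fin.ext_iff]
    split_ifs <;> omega
  · simp only
    split_ifs <;> omega
  · rw [hxi, hc, hn']
    push_cast
    linear_combination 4 * ha'
  · rw [hsum, hn']
    push_cast
    linear_combination 2 * ha'
  · rw [hxi]
    push_cast
    ring
  · rw [hxi]
    push_cast [hI]
    linear_combination 4 * ha'

theorem isTypeData_B (n : ℕ) (hn : 3 ≤ n) :
    IsTypeData (.B n hn) (lengthB n) (markB n) (comarkB n) where
  highest := isHighestData_B hn
  tableII := by
    change ∀ i j : Fin n, _
    intro i j hij hi hj
    have hij' : (i : ℕ) < j := hij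
    change (if (j : ℕ) = 0 then 1 else 2) = 1 at hj
    rw [if_neg (by omega)] at hj
    omega
  tableIII := by
    change ∀ i : Fin n, _
    intro i hi
    have hi' := i.2
    change (if (i : ℕ) = 0 then 1 else 2) = 2 at hi
    have h0 : (i : ℕ) ≠ 0 := fun h => by rw [if_pos h] at hi; omega
    obtain ⟨a, ha⟩ := exists_two_mul_eq (i + 1)
    have h := TableIII.soOdd n hn (i + 1) (by omega) (by omega)
    have h' := isDataIII_B hn (i := i) (I := i + 1) (q := n - (i + 1)) rfl (by omega) ha
    rw [← ha, mul_assoc] at h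
    exact ⟨_, _, _, _, h, _, _, h'⟩

/-! ### Type `C` -/

/-- The only long simple root is the last one. Each reflection, moving towards the first node, adds
twice a short simple root. -/
theorem reaches_C {n : ℕ} (hn : 2 ≤ n) (s : ℕ) (hs : s + 1 ≤ n) :
    Reaches (CartanMatrix.C n) (Pi.single ⟨n - 1, by omega⟩ 1)
      fun j => if (j : ℕ) + s + 1 < n then 0 else if (j : ℕ) + 1 = n then 1 else 2 := by
  induction s with
  | zero =>
    have : (fun j : Fin n => if (j : ℕ) + 0 + 1 < n then (0 : ℤ) else if (j : ℕ) + 1 = n then 1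
        else 2) = Pi.single ⟨n - 1, by omega⟩ 1 := by
      funext j
      have := j.2
      simp only [Pi.single_apply, Fin.ext_iff]
      split_ifs <;> omega
    rw [this]
    exact Relation.ReflTransGen.refl
  | succ s ih =>
    refine Reaches.step (f := fun j => if j + s + 1 < n then 0 else if j + 1 = n then 1 else 2)
      (f' := fun j => if j + (s + 1) + 1 < n then 0 else if j + 1 = n then 1 else 2) (ih (by omega))
      ⟨n - 2 - s, by omega⟩ (p := -2) ?_ fun j hj => ?_
    · rw [C_col ⟨n - 2 - s, by omega⟩ fun j => if j + s + 1 < n then 0 else if j + 1 = n then 1 else 2]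
      simp only
      split_ifs <;> omega
    · simp only
      split_ifs <;> omega

/-- The ratios of the squared length of the highest root to those of the simple roots. -/
def lengthC (n : ℕ) (j : Fin n) : ℕ := if (j : ℕ) + 1 = n then 1 else 2

theorem isHighestData_C {n : ℕ} (hn : 2 ≤ n) :
    IsHighestData (CartanMatrix.C n) (lengthC n) (lengthC n) (fun _ => 1) where
  symm k l := by
    have := k.2
    have := l.2
    simp only [CartanMatrix.C, Matrix.of_apply, Fin.ext_iff, lengthC]
    split_ifs <;> omega
  one_le k := by
    unfold lengthC
    split_ifs <;> omega
  marks k := (mul_one _).symm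
  dominant k := by
    have := C_col k fun j => ((if j + 1 = n then 1 else 2 : ℕ) : ℤ)
    simp only [lengthC, this]
    have := k.2
    split_ifs <;> omega
  exists_root := by
    refine ⟨⟨n - 1, by omega⟩, if_pos (by simp only; omega),
      connected_of_measure _ (fun k => n - 1 - k) fun k => ?_, ?_⟩
    · have := k.2
      by_cases h : (k : ℕ) = n - 1
      · exact Or.inl (Fin.ext h)
      · refine Or.inr ⟨⟨k + 1, by omega⟩, by simp only; omega, ?_⟩
        simp only [CartanMatrix.C, Matrix.of_apply, Fin.ext_iff]
        split_ifs <;> omega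
    · convert reaches_C hn (n - 1) (by omega) using 1
      funext j
      simp only [lengthC]
      split_ifs <;> omega

/-- The coweight `e₁ + ⋯ + e_I` is an integral combination of the coroots `e_j - e_{j+1}` and `eₙ`,
so `d = 1` suffices. -/
theorem isDataIII_C {n : ℕ} {i : Fin n} {I q a : ℕ} (hi : (i : ℕ) + 1 = I)
    (hq : I + q = n) (hq0 : 0 < q) (ha : 2 * a = (I + 1) * I) :
    IsDataIII (CartanMatrix.C n) (lengthC n) (fun _ => 1) i (2 * q) (I + 1) a (2 * (I * q)) 1
      (fun j => min (I : ℤ) ((j : ℕ) + 1)) := by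
  have hsum : 2 * ∑ j : Fin n, min (I : ℤ) ((j : ℕ) + 1) = I * (2 * n - I + 1) := by
    rw [Fin.sum_univ_eq_sum_range (fun j => min (I : ℤ) (j + 1)) n, two_mul_sum_min,
      if_neg (by omega)]
  have hxi : min (I : ℤ) ((i : ℕ) + 1) * lengthC n i = 2 * I := by
    rw [min_eq_left (by omega), lengthC, if_neg (by omega), Nat.cast_ofNat, mul_comm]
  have ha' : 2 * (a : ℤ) = (I + 1) * I := by exact_mod_cast ha
  have hn' : (n : ℤ) = I + q := by omega
  refine ⟨⟨fun k => ?_, by norm_num, ?_⟩, ⟨?_, ?_⟩, ?_, ?_⟩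
  · rw [C_row k fun j => min (I : ℤ) (j + 1)]
    have hk := k.2
    simp only [Fin.ext_iff]
    split_ifs <;> omega
  · simp only
    omega
  · rw [hxi]
    simp only [Nat.cast_one, Finset.sum_const, Finset.card_univ, Fintype.card_fin, nsmul_eq_mul,
      mul_one, hn']
    push_cast
    linear_combination 2 * ha'
  · rw [hsum, hn']
    push_cast
    linear_combination ha'
  · rw [hxi]
    push_cast
    ring
  · rw [hxi]
    push_cast
    linear_combination 2 * ha'

theorem isTypeData_C (n : ℕ) (hn : 2 ≤ n) :
    IsTypeData (.C n hn) (lengthC n) (lengthC n) (fun _ => 1) where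
  highest := isHighestData_C hn
  tableII := by
    change ∀ i j : Fin n, _
    intro i j hij hi hj
    have hij' : (i : ℕ) < j := hij
    have hj' := j.2
    change (if (i : ℕ) + 1 = n then 1 else 2) = 1 at hi
    rw [if_neg (by omega)] at hi
    omega
  tableIII := by
    change ∀ i : Fin n, _
    intro i hi
    have hi' := i.2
    change (if (i : ℕ) + 1 = n then 1 else 2) = 2 at hi
    have h0 : (i : ℕ) + 1 ≠ n := fun h => by rw [if_pos h] at hi; omega
    obtain ⟨a, ha⟩ := exists_two_mul_eq (i + 1 + 1)
    have h := TableIII.sp n hn (i + 1) (by omega) (by omega)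
    have h' := isDataIII_C (i := i) (I := i + 1) (q := n - (i + 1)) rfl (by omega) (by omega) ha
    rw [mul_comm (i + 1 : ℕ) (i + 1 + 1), show (i + 1 + 1) * (i + 1 : ℕ) = 2 * a from ha.symm,
      show 4 * (i + 1 : ℕ) * (n - (i + 1)) = 2 * (2 * ((i + 1) * (n - (i + 1)))) by ring] at h
    exact ⟨_, _, _, _, h, _, _, h'⟩

/-! ### Type `D` -/

/-- After `α₁ + ⋯ + αₙ`, the reflections run back from the branch node and double one coefficient
each. -/
theorem reaches_D {n : ℕ} (hn : 4 ≤ n) (s : ℕ) (hs : s + 3 ≤ n) :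
    Reaches (CartanMatrix.D n) (Pi.single ⟨0, by omega⟩ 1)
      fun j => if (j : ℕ) + s + 2 < n ∨ n ≤ (j : ℕ) + 2 then 1 else 2 := by
  induction s with
  | zero =>
    refine Reaches.step (f := fun j => if j ≤ n - 2 then 1 else 0)
      (f' := fun j => if j + 0 + 2 < n ∨ n ≤ j + 2 then 1 else 2)
      (reaches_ones (by omega) (n - 2) (fun t ht hT => ?_) (n - 2) (by omega) le_rfl)
      ⟨n - 1, by omega⟩ (p := -1) ?_ fun j hj => ?_
    · rw [D_col hn ⟨t + 1, ht⟩ fun j => if j ≤ t then 1 else 0]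
      simp only
      split_ifs <;> first | contradiction | omega
    · rw [D_col hn ⟨n - 1, by omega⟩ fun j => if j ≤ n - 2 then 1 else 0]
      simp only
      split_ifs <;> omega
    · simp only
      split_ifs <;> omega
  | succ s ih =>
    refine Reaches.step (f := fun j => if j + s + 2 < n ∨ n ≤ j + 2 then 1 else 2)
      (f' := fun j => if j + (s + 1) + 2 < n ∨ n ≤ j + 2 then 1 else 2) (ih (by omega))
      ⟨n - 3 - s, by omega⟩ (p := -1) ?_ fun j hj => ?_
    · rw [D_col hn ⟨n - 3 - s, by omega⟩ fun j => if j + s + 2 < n ∨ n ≤ j + 2 then 1 else 2]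
      simp only
      split_ifs <;> omega
    · simp only
      split_ifs <;> omega

/-- The coefficients of the highest root. -/
def markD (n : ℕ) (j : Fin n) : ℕ := if (j : ℕ) = 0 ∨ n ≤ (j : ℕ) + 2 then 1 else 2

theorem isHighestData_D {n : ℕ} (hn : 4 ≤ n) :
    IsHighestData (CartanMatrix.D n) (fun _ => 1) (markD n) (markD n) where
  symm k l := by rw [← Matrix.transpose_apply (CartanMatrix.D n), CartanMatrix.D_transpose]
  one_le _ := le_rfl
  marks _ := (one_mul _).symm
  dominant k := by
    have := D_col hn k fun j => ((if j = 0 ∨ n ≤ j + 2 then 1 else 2 : ℕ) : ℤ)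
    simp only [markD, this]
    have := k.2
    split_ifs <;> omega
  exists_root := by
    refine ⟨⟨0, by omega⟩, rfl, connected_of_measure _ (fun k => k) fun k => ?_, ?_⟩
    · have := k.2
      rcases Nat.eq_zero_or_pos (k : ℕ) with h | h
      · exact Or.inl (Fin.ext h)
      · right
        by_cases h' : (k : ℕ) + 1 = n
        · refine ⟨⟨n - 3, by omega⟩, by simp only; omega, ?_⟩
          simp only [CartanMatrix.D, Matrix.of_apply, Fin.ext_iff]
          split_ifs <;> omega
        · refine ⟨⟨k - 1, by omega⟩, by simp only; omega, ?_⟩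
          simp only [CartanMatrix.D, Matrix.of_apply, Fin.ext_iff]
          split_ifs <;> omega
    · convert reaches_D hn (n - 3) (by omega) using 1
      funext j
      simp only [markD]
      split_ifs <;> omega

theorem sum_markD {n : ℕ} (hn : 4 ≤ n) : ∑ j : Fin n, (markD n j : ℤ) = 2 * n - 3 := by
  -- There are three exceptional nodes but `sum_add_ite` corrects only two, so the first node is
  -- raised to `2` beforehand.
  have h : ∑ j : Fin n, ((markD n j : ℤ) + if (j : ℕ) = 0 then 1 else 0) = 2 * n - 2 := by
    rw [sum_add_ite (t₀ := n - 2) (t₁ := n - 1) (a₀ := -1) (a₁ := -1) (fun _ => 2) (by omega)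
      (by omega)]
    · simp
      ring
    · intro j
      have := j.2
      unfold markD
      split_ifs <;> omega
  rw [Finset.sum_add_distrib,
    Fin.sum_univ_eq_sum_range (fun j => if j = 0 then (1 : ℤ) else 0) n] at h
  simp only [Finset.sum_ite_eq', Finset.mem_range, show 0 < n by omega, if_true] at h
  linarith

/-- The coweight is again `e₁ + ⋯ + e_I`; both end coroots `e_{n-1} ∓ eₙ` have coordinate `I/2`. -/
theorem isDataIII_D {n : ℕ} (hn : 4 ≤ n) {i : Fin n} {I q a : ℕ} (hi : (i : ℕ) + 1 = I)
    (hq : I + q = n) (hq2 : 2 ≤ q) (ha : 2 * a = I * (I - 1)) :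
    IsDataIII (CartanMatrix.D n) (fun _ => 1) (markD n) i (4 * q) (2 * (I - 1))
      a (2 * (I * q)) 2
      (fun j => if n ≤ (j : ℕ) + 2 then (I : ℤ) else 2 * min (I : ℤ) ((j : ℕ) + 1)) := by
  have hsum : ∑ j : Fin n, (if n ≤ (j : ℕ) + 2 then (I : ℤ) else 2 * min (I : ℤ) ((j : ℕ) + 1)) =
      I * (2 * n - I - 1) := by
    rw [sum_add_ite (t₀ := n - 2) (t₁ := n - 1) (a₀ := -I) (a₁ := -I)
      (fun j => 2 * min (I : ℤ) (j + 1)) (by omega) (by omega), two_mul_sum_min_of_le (by omega)]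
    · ring
    · intro j
      have := j.2
      split_ifs <;> omega
  have hxi : (if n ≤ (i : ℕ) + 2 then (I : ℤ) else 2 * min (I : ℤ) ((i : ℕ) + 1)) = 2 * I := by
    rw [if_neg (by omega), min_eq_left (by omega)]
  have ha' : 2 * (a : ℤ) = I * (I - 1) := by
    have := congrArg (Nat.cast : ℕ → ℤ) ha
    rw [← Nat.cast_pred (by omega)]
    exact_mod_cast this
  have hI : ((I - 1 : ℕ) : ℤ) = I - 1 := by omega
  have hn' : (n : ℤ) = I + q := by omega
  refine ⟨⟨fun k => ?_, by norm_num, ?_⟩, ⟨?_, ?_⟩, ?_, ?_⟩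
  · rw [D_row hn k fun j => if n ≤ j + 2 then (I : ℤ) else 2 * min (I : ℤ) (j + 1)]
    have hk := k.2
    simp only [Fin.ext_iff]
    split_ifs <;> omega
  · simp only [hxi]
    omega
  · simp only [hxi, sum_markD hn, hn']
    push_cast
    linear_combination 4 * ha'
  · rw [hsum, hn']
    push_cast
    linear_combination 2 * ha'
  · simp only [hxi]
    push_cast
    ring
  · simp only [hxi]
    push_cast [hI]
    linear_combination 4 * ha'

/-- The denominator `2` would suffice; `4` is used because `IsDataII` requires the same `d` for both
coweights, and the spin coweights need `4` in general. -/
theorem D_coweight_zero {n : ℕ} (hn : 4 ≤ n) (i k : Fin n) (hi : (i : ℕ) = 0) :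
    ∑ j : Fin n, CartanMatrix.D n k j * (if n ≤ (j : ℕ) + 2 then 2 else 4) =
      if k = i then (4 : ℤ) else 0 := by
  rw [D_row hn k fun j => if n ≤ j + 2 then 2 else 4]
  have hk := k.2
  simp only [Fin.ext_iff, hi]
  split_ifs <;> omega

theorem D_coweight_spin {n : ℕ} (hn : 4 ≤ n) (i k : Fin n) (hi : n ≤ (i : ℕ) + 2) :
    ∑ j : Fin n, CartanMatrix.D n k j *
      (if n ≤ (j : ℕ) + 2 then if (j : ℕ) = i then (n : ℤ) else n - 2 else 2 * ((j : ℕ) + 1)) =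
      if k = i then (4 : ℤ) else 0 := by
  rw [D_row hn k fun j => if n ≤ j + 2 then if j = (i : ℕ) then (n : ℤ) else n - 2 else 2 * (j + 1)]
  have hk := k.2
  have hi := i.2
  simp only [Fin.ext_iff]
  split_ifs <;> omega

theorem isDataII_D_spin {n : ℕ} (hn : 4 ≤ n) {i j : Fin n} {a : ℕ} (hi : (i : ℕ) + 2 = n)
    (hj : (j : ℕ) + 1 = n) (ha : 2 * a = (n - 1) * (n - 1 - 1)) :
    IsDataII (CartanMatrix.D n) (fun _ => 1) (markD n) i j 4 (2 * (n - 2)) (2 * (n - 2))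
      a (n - 1) (n - 1) 4
      (fun k => if n ≤ (k : ℕ) + 2 then if (k : ℕ) = i then (n : ℤ) else n - 2
        else 2 * ((k : ℕ) + 1))
      (fun k => if n ≤ (k : ℕ) + 2 then if (k : ℕ) = j then (n : ℤ) else n - 2
        else 2 * ((k : ℕ) + 1)) := by
  have h1 : ((n - 1 : ℕ) : ℤ) = n - 1 := by omega
  have h2 : ((n - 2 : ℕ) : ℤ) = n - 2 := by omega
  have ha' : 2 * (a : ℤ) = (n - 1) * (n - 2) := by
    rw [← h1, ← h2]
    exact_mod_cast ha
  refine ⟨⟨fun k => D_coweight_spin hn i k (by omega), fun k => D_coweight_spin hn j k (by omega)⟩,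
    ⟨rfl, rfl, by norm_num, ?_⟩, ⟨?_, ?_, ?_⟩, ?_, ?_, ?_⟩
  · simp only [if_pos (show n ≤ (i : ℕ) + 2 by omega), if_pos (show n ≤ (j : ℕ) + 2 by omega),
      if_true, if_neg (show ¬ (i : ℕ) = j by omega), if_neg (show ¬ (j : ℕ) = i by omega)]
    intro h0
    have : (4 : ℤ) * (n - 1) = 0 := by linear_combination h0
    omega
  all_goals
    simp only [if_pos (show n ≤ (i : ℕ) + 2 by omega), if_pos (show n ≤ (j : ℕ) + 2 by omega),
      if_true, if_neg (show ¬ (i : ℕ) = j by omega), if_neg (show ¬ (j : ℕ) = i by omega),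
      sum_markD hn]
    push_cast [h1, h2]
  · linear_combination 2 * ha'
  · linear_combination 2 * ha'
  · linear_combination 2 * ha'
  · ring
  · linear_combination 8 * ha'
  · linear_combination 8 * ha'

theorem isDataII_D_vector {n : ℕ} (hn : 4 ≤ n) {i j : Fin n} {a : ℕ} (hi : (i : ℕ) = 0)
    (hj : n ≤ (j : ℕ) + 2) (ha : 2 * a = (n - 1) * (n - 1 - 1)) :
    IsDataII (CartanMatrix.D n) (fun _ => 1) (markD n) i j (2 * (n - 2)) (2 * (n - 2)) 4
      (n - 1) (n - 1) a 4 (fun k => if n ≤ (k : ℕ) + 2 then 2 else 4)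
      (fun k => if n ≤ (k : ℕ) + 2 then if (k : ℕ) = j then (n : ℤ) else n - 2
        else 2 * ((k : ℕ) + 1)) := by
  have h1 : ((n - 1 : ℕ) : ℤ) = n - 1 := by omega
  have h2 : ((n - 2 : ℕ) : ℤ) = n - 2 := by omega
  have ha' : 2 * (a : ℤ) = (n - 1) * (n - 2) := by
    rw [← h1, ← h2]
    exact_mod_cast ha
  refine ⟨⟨fun k => D_coweight_zero hn i k hi, fun k => D_coweight_spin hn j k hj⟩,
    ⟨rfl, rfl, by norm_num, ?_⟩, ⟨?_, ?_, ?_⟩, ?_, ?_, ?_⟩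
  · simp only [hi, if_neg (show ¬ n ≤ 0 + 2 by omega), if_pos hj, if_true]
    intro h0
    have : (4 : ℤ) * (n - 1) = 0 := by linear_combination h0
    omega
  all_goals
    simp only [hi, if_neg (show ¬ n ≤ 0 + 2 by omega), if_pos hj, if_true, sum_markD hn]
    push_cast [h1, h2]
  · ring
  · ring
  · linear_combination 2 * ha'
  · linear_combination 4 * ha'
  · ring
  · ring

theorem isTypeData_D (n : ℕ) (hn : 4 ≤ n) :
    IsTypeData (.D n hn) (fun _ => 1) (markD n) (markD n) where
  highest := isHighestData_D hn
  tableII := by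
    change ∀ i j : Fin n, _
    intro i j hij hi hj
    have hij' : (i : ℕ) < j := hij
    have hj' := j.2
    change (if (i : ℕ) = 0 ∨ n ≤ (i : ℕ) + 2 then 1 else 2) = 1 at hi
    change (if (j : ℕ) = 0 ∨ n ≤ (j : ℕ) + 2 then 1 else 2) = 1 at hj
    have hi0 : (i : ℕ) = 0 ∨ n ≤ (i : ℕ) + 2 := by by_contra h; rw [if_neg h] at hi; omega
    have hj0 : (j : ℕ) = 0 ∨ n ≤ (j : ℕ) + 2 := by by_contra h; rw [if_neg h] at hj; omega
    obtain ⟨a, ha⟩ := exists_two_mul_eq (n - 1)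
    rcases hi0 with hi0 | hi0
    · have h : TableII (.D n hn) (i + 1) (j + 1) (2 * (n - 2)) (2 * (n - 2)) 4 (2 * (n - 1))
          (2 * (n - 1)) (2 * a) := by
        rw [ha, hi0]
        exact .so' n hn (j + 1) (by omega)
      exact ⟨_, _, _, _, _, _, h, _, _, _, isDataII_D_vector hn hi0 (by omega) ha⟩
    -- If `i` is not the first node, then `i < j` forces `i` and `j` to be the two spin nodes.
    · have h : TableII (.D n hn) (i + 1) (j + 1) 4 (2 * (n - 2)) (2 * (n - 2)) (2 * a)
          (2 * (n - 1)) (2 * (n - 1)) := by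
        rw [ha, show (i : ℕ) + 1 = n - 1 by omega, show (j : ℕ) + 1 = n by omega]
        exact .so n hn
      exact ⟨_, _, _, _, _, _, h, _, _, _, isDataII_D_spin hn (by omega) (by omega) ha⟩
  tableIII := by
    change ∀ i : Fin n, _
    intro i hi
    have hi' := i.2
    change (if (i : ℕ) = 0 ∨ n ≤ (i : ℕ) + 2 then 1 else 2) = 2 at hi
    have h0 : ¬ ((i : ℕ) = 0 ∨ n ≤ (i : ℕ) + 2) := fun h => by rw [if_pos h] at hi; omega
    obtain ⟨a, ha⟩ := exists_two_mul_eq (i + 1)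
    have h := TableIII.soEven n hn (i + 1) (by omega) (by omega)
    have h' := isDataIII_D hn (i := i) (I := i + 1) (q := n - (i + 1)) rfl (by omega) (by omega) ha
    rw [← ha, show 4 * (i + 1 : ℕ) * (n - (i + 1)) = 2 * (2 * ((i + 1) * (n - (i + 1)))) by ring] at h
    exact ⟨_, _, _, _, h, _, _, h'⟩

theorem exists_isTypeData (X : DynkinType) : ∃ s m c, IsTypeData X s m c := by
  cases X with
  | A n hn => exact ⟨_, _, _, isTypeData_A n hn⟩
  | B n hn => exact ⟨_, _, _, isTypeData_B n hn⟩
  | C n hn => exact ⟨_, _, _, isTypeData_C n hn⟩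
  | D n hn => exact ⟨_, _, _, isTypeData_D n hn⟩
  | E6 => exact ⟨_, _, _, isTypeData_E6⟩
  | E7 => exact ⟨_, _, _, isTypeData_E7⟩
  | E8 => exact ⟨_, _, _, isTypeData_E8⟩
  | F4 => exact ⟨_, _, _, isTypeData_F4⟩
  | G2 => exact ⟨_, _, _, isTypeData_G2⟩

end ThreeSymmetric

end

/-! ### Assembly of the tables -/

open ThreeSymmetric in
theorem proposition6p5 {g : Type*} [LieRing g] [LieAlgebra ℝ g] [Module.Finite ℝ g]
    [IsCompactSimple g] (X : DynkinType) (F : RootFrame g X.rank) (hF : F.cartanMatrix = X.cartan)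
    (μ : F.Root) (hμ : F.IsHighest μ) (S : Triple g) :
    (∀ i j : Fin X.rank, F.IsTypeII μ i j S →
      ∃ l k m d₁ d₂ d₃ : ℕ, TableII X (i + 1) (j + 1) l k m d₁ d₂ d₃ ∧
        S.isotropy = F.t.toSubmodule ⊔ F.planes (fun α => F.coeff α i = 0 ∧ F.coeff α j = 0) ∧
        DirectSum.IsInternal
          ![(F.planes fun α => F.coeff α i = 1 ∧ F.coeff α j = 1).comap S.tangent.subtype,
            (F.planes fun α => F.coeff α i = 1 ∧ F.coeff α j = 0).comap S.tangent.subtype,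
            (F.planes fun α => F.coeff α i = 0 ∧ F.coeff α j = 1).comap S.tangent.subtype] ∧
        IsEigenbundle S (F.planes fun α => F.coeff α i = 1 ∧ F.coeff α j = 1)
          (l * F.kappa μ) d₁ ∧
        IsEigenbundle S (F.planes fun α => F.coeff α i = 1 ∧ F.coeff α j = 0)
          (k * F.kappa μ) d₂ ∧
        IsEigenbundle S (F.planes fun α => F.coeff α i = 0 ∧ F.coeff α j = 1)
          (m * F.kappa μ) d₃) ∧
    (∀ i : Fin X.rank, F.IsTypeIII μ i S →
      ∃ l k d₁ d₂ : ℕ, TableIII X (i + 1) l k d₁ d₂ ∧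
        S.isotropy = F.t.toSubmodule ⊔ F.planes (fun α => F.coeff α i = 0) ∧
        DirectSum.IsInternal
          ![(F.planes fun α => F.coeff α i = 2).comap S.tangent.subtype,
            (F.planes fun α => F.coeff α i = 1).comap S.tangent.subtype] ∧
        IsEigenbundle S (F.planes fun α => F.coeff α i = 2) (l * F.kappa μ) d₁ ∧
        IsEigenbundle S (F.planes fun α => F.coeff α i = 1) (k * F.kappa μ) d₂) := by
  obtain ⟨s, m, c, hX⟩ := exists_isTypeData X
  have hd : IsHighestData F.cartanMatrix s m c := hF ▸ hX.highest
  have hm := (hμ.coeff_eq_and_Q hd).1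
  refine ⟨fun i j hT => ?_, fun i hT => ?_⟩
  · obtain ⟨hij, hi, hj, -⟩ := id hT
    rw [hm] at hi hj
    obtain ⟨l, k, r, a₁, a₂, a₃, hT', d, x, y, ⟨hx, hy⟩, ⟨hsi, hsj, hd0, hD⟩, ⟨e1, e2, e3⟩, hl, hk,
      hr⟩ := hX.tableII i j hij (by exact_mod_cast hi) (by exact_mod_cast hj)
    rw [← hF] at hx hy
    exact ⟨l, k, r, _, _, _, hT', hμ.typeII hd hsi hsj hx hy hd0 hD e1 e2 e3 hl hk hr hT⟩
  · have hi := hT.1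
    rw [hm] at hi
    obtain ⟨l, k, a₂, a₁, hT', d, x, ⟨hx, hd0, hx0⟩, ⟨e1, e2⟩, hl, hk⟩ :=
      hX.tableIII i (by exact_mod_cast hi)
    rw [← hF] at hx
    exact ⟨l, k, _, _, hT', hμ.typeIII hd hx hd0 hx0 e1 e2 hl hk hT⟩
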